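/- **Setting.** Let $\mathcal S,\mathcal A$ be measurable spaces, $H\ge 1$, $d\ge 2$, and let $\phi:\mathcal S\times\mathcal A\to\mathbb R^d$ be a known measurable feature map with $\|\phi(s,a)\|_2\le 1$. Consider an episodic MDP with horizon $H$, fixed initial state $s_1$ and unknown transition kernels $P_1,\dots,P_H$, which is linear: for every $h$ there is an $\mathbb R^d$-valued signed measure $\mu_h$ on $\mathcal S$ with $P_h(B\mid s,a)=\langle\phi(s,a),\mu_h(B)\rangle$ and $\|\mu_h(B)\|_2\le\sqrt d$ for all measurable $B\subseteq\mathcal S$. Policies may be randomized and history dependent; $\mathbb E_\pi$ is the expectation over trajectories $(s_1,a_1,\dots,s_H,a_H)$ generated by $\pi$. A *feasible linear reward* is $r=(r_h)_{h\le H}$ with $r_h(s,a)=\langle\phi(s,a),\theta_h\rangle\in[0,1]$ and $\|\theta_h\|_2\le\sqrt d$. Put $V^\pi(r)=\mathbb E_\pi\sum_h r_h(s_h,a_h)$ and $V^\star(r)=\sup_\pi V^\pi(r)$; $\pi$ is $\epsilon$-optimal for $r$ if $V^\pi(r)\ge V^\star(r)-\epsilon$. Assume $$\lambda^\star=\min_{h\le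 H}\ \sup_\pi\ \lambda_{\min}\big(\mathbb E_\pi[\phi(s_h,a_h)\phi(s_h,a_h)^\top]\big)>0 .$$ **Policy sets.** For $\epsilon_0>0$ let $\mathcal W$ be an $\frac{\epsilon_0}{2H}$-cover of $\{x\in\mathbb R^d:\|x\|_2\le 2H\sqrt d\}$ with $|\mathcal W|\le(1+8H^2\sqrt d/\epsilon_0)^d$, and let $\mathcal R$ be a sup-norm $\frac{\epsilon_0}{2H}$-cover of the functions $\sqrt{\phi^\top(I+\Sigma)^{-1}\phi}$, $\Sigma\succeq 0$, with $|\mathcal R|\le(1+32H^2\sqrt d/\epsilon_0^2)^{d^2}$. For every layer $h$, let $\Pi_h^2$ consist of one measurable greedy rule $s\mapsto\arg\max_a\phi(s,a)^\top w$ for each $w\in\mathcal W$, and $\Pi_h^1$ of one measurable greedy rule $s\mapsto\arg\max_a f(s,a)$ for each $f\in\mathcal R$ (the maxima are assumed to be attained by measurable rules, which is automatic for finite $\mathcal A$; ties are broken arbitrarily). Put $\Pi^{eval}_{\epsilon_0}=\prod_h\Pi^2_h$ and $\Pi^{exp}_{\epsilon_0}=\prod_h(\Pi_h^1\cup\Pi_h^2)$.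 **Estimators.** Given trajectories $(s^n_i,a^n_i)_{i\le H}$ indexed by $n$, put $\Lambda_i=I+\sum_n\phi(s_i^n,a_i^n)\phi(s_i^n,a_i^n)^\top$, and for a function $V$ on $\mathcal S$ put $w_i(V)=\Lambda_i^{-1}\sum_n\phi(s_i^n,a_i^n)V(s_{i+1}^n)$. Write $(x)_{[0,B]}=\max(0,\min(B,x))$. For a deterministic policy $\pi$: * $\mathrm{EstimateV}(\pi,r)=V_1(s_1)$, where $V_{H+1}=0$ and $V_i(s)=\big(\phi(s,\pi_i(s))^\top w_i(V_{i+1})+r_i(s,\pi_i(s))\big)_{[0,H]}$ for $i=H,\dots,1$. * $\mathrm{EstimateER}(\pi,f,B,h)=V_1(s_1)$, where $V_h(s)=f(s,\pi_h(s))$ and $V_i(s)=\big(\phi(s,\pi_i(s))^\top w_i(V_{i+1})\big)_{[0,B]}$ for $i=h-1,\dots,1$. * $\widehat\Sigma_\pi$ (for layer $h$) has entries $2\,\mathrm{EstimateER}(\pi,\frac{\phi_i\phi_j+1}{2},1,h)-1$, and $\widehat\Sigma_p=\sum_\pi p_\pi\widehat\Sigma_\pi$ for a distribution $p$ on deterministic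 policies. **Exploration.** Given $\epsilon,\delta$ and constants $C_1,C_2,C_3$, let $\iota=\log\frac{dH}{\epsilon\delta}$, $\bar\epsilon=\frac{C_1\epsilon}{H^2\sqrt d\,\iota}$ and $N=\lceil C_2d\iota/\bar\epsilon^2\rceil$. For $h=1,\dots,H$: with all the data collected so far, choose (measurably in these data) $$\pi_h\in\operatorname*{arg\,min}_{p\in\Delta(\Pi^{exp}_{\epsilon/3}),\ \lambda_{\min}(\widehat\Sigma_p)\ge C_3d^2H\bar\epsilon\iota}\ \ \max_{\widehat\pi\in\Pi^{exp}_{\epsilon/3}}\mathrm{EstimateER}\Big(\widehat\pi,\ \phi^\top(N\widehat\Sigma_p)^{-1}\phi,\ \tfrac{\bar\epsilon}{C_2d^3H\iota^2},\ h\Big)$$ (arbitrarily if there is no feasible $p$), and deploy it: draw $N$ independent trajectories, each generated by a policy drawn from $\pi_h$, and add them to the data. **Planning.** Given the final data and $r$, $\mathrm{Planning}(r)$ is any maximizer of $\mathrm{EstimateV}(\pi,r)$ over $\pi\in\Pi^{eval}_{\epsilon/3}$. **Theorem.** There are universal constants $C_1,C_2,C_3,C_4,C_5>0$ such that for all $\mathcal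 S,\mathcal A,H,d,\phi$, all linear MDPs with $\lambda^\star>0$, all choices of covers and tie-breaking, all $\delta\in(0,1)$ and all $\epsilon>0$ with $$\epsilon<\frac{H(\lambda^\star)^2}{C_4\,d^{7/2}\log(1/\lambda^\star)}\qquad\text{and}\qquad\frac{\epsilon}{3}\le\frac{\lambda^\star}{4},$$ the following holds. The exploration uses exactly $H$ deployments, of $N$ trajectories each, and in total $$HN\ \le\ C_5\,\frac{d^2H^5}{\epsilon^2}\,\log^3\frac{dH}{\epsilon\delta}$$ trajectories. With probability at least $1-\delta$ over the collected data, the optimization problems of all $H$ layers are feasible and, simultaneously for every feasible linear reward $r$, $\mathrm{Planning}(r)$ exists and every such policy is $\epsilon$-optimal for $r$. -/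

import Mathlib

open MeasureTheory ProbabilityTheory
open scoped Matrix

noncomputable section

namespace RewardFree

/-- `ℝ^d` with the Euclidean norm. -/
abbrev Vec (d : ℕ) : Type := EuclideanSpace ℝ (Fin d)

/-- A trajectory `(s_1, a_1, …, s_H, a_H)` (layers are numbered `0, …, H - 1`). -/
abbrev Traj (S A : Type*) (H : ℕ) : Type _ := Fin H → S × A

/-- The data of `k` deployments with `N` trajectories each. -/
abbrev Dataset (S A : Type*) (H N k : ℕ) : Type _ := Fin k → Fin N → Traj S A H

/-- The smallest eigenvalue of a (symmetric) matrix. -/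
def minEig {d : ℕ} (X : Matrix (Fin d) (Fin d) ℝ) : ℝ := sInf (spectrum ℝ X)

/-- The quadratic form `xᵀ X x`. -/
def quad {d : ℕ} (X : Matrix (Fin d) (Fin d) ℝ) (x : Vec d) : ℝ :=
  x.ofLp ⬝ᵥ (X *ᵥ x.ofLp)

/-- Truncation `(x)_{[0,B]}`. -/
def clip (B x : ℝ) : ℝ := max 0 (min B x)

section Model

variable {S A : Type*} [MeasurableSpace S] [MeasurableSpace A] {H d : ℕ}

/-- A reward-free episodic MDP with horizon `H`, a fixed initial state and non-stationary
transition kernels. -/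
structure MDP (S A : Type*) [MeasurableSpace S] [MeasurableSpace A] (H : ℕ) where
  init : S
  P : Fin H → Kernel (S × A) S
  markov : ∀ h, IsMarkovKernel (P h)

/-- A (possibly history dependent) randomized policy: the law of `a_h` given
`(s_1, a_1, …, s_{h-1}, a_{h-1})` and `s_h`. -/
structure Policy (S A : Type*) [MeasurableSpace S] [MeasurableSpace A] (H : ℕ) where
  act : (h : Fin H) → Kernel ((Fin h → S × A) × S) A
  markov : ∀ h, IsMarkovKernel (act h)

/-- A deterministic decision rule for one layer. -/
abbrev DetRule (S A : Type*) [MeasurableSpace S] [MeasurableSpace A] : Type _ :=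
  {f : S → A // Measurable f}

/-- A deterministic Markov policy. -/
abbrev DetPolicy (S A : Type*) [MeasurableSpace S] [MeasurableSpace A] (H : ℕ) : Type _ :=
  Fin H → DetRule S A

/-- A deterministic Markov policy, seen as a policy. -/
def DetPolicy.toPolicy (π : DetPolicy S A H) : Policy S A H where
  act h := Kernel.deterministic (fun x : (Fin h → S × A) × S => (π h).1 x.2)
    ((π h).2.comp measurable_snd)
  markov _ := inferInstance

/-- The law of the state `s_n` given the history before it. -/
def MDP.stateKernel (M : MDP S A H) : (n : ℕ) → n < H → Kernel (Fin n → S × A) S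
  | 0, _ => Kernel.const _ (Measure.dirac M.init)
  | n + 1, hn => (M.P ⟨n, Nat.lt_of_succ_lt hn⟩).comap (fun x => x (Fin.last n))
      (measurable_pi_apply _)

/-- The law of the first `n` state-action pairs of a trajectory generated by `π`. -/
def MDP.prefixLaw (M : MDP S A H) (π : Policy S A H) :
    (n : ℕ) → n ≤ H → Measure (Fin n → S × A)
  | 0, _ => Measure.dirac (fun i => i.elim0)
  | n + 1, hn =>
      ((M.prefixLaw π n (Nat.le_of_succ_le hn)) ⊗ₘ
        (M.stateKernel n hn ⊗ₖ π.act ⟨n, hn⟩)).map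
          (fun p => (Fin.snoc p.1 p.2 : Fin (n + 1) → S × A))

/-- The law `ℙ_π` of a trajectory generated by `π`. -/
def MDP.trajLaw (M : MDP S A H) (π : Policy S A H) : Measure (Traj S A H) :=
  M.prefixLaw π H le_rfl

/-- The value `V^π(r) = 𝔼_π [∑_h r_h(s_h, a_h)]`. -/
def MDP.value (M : MDP S A H) (π : Policy S A H) (r : Fin H → S → A → ℝ) : ℝ :=
  ∫ τ, ∑ h, r h (τ h).1 (τ h).2 ∂(M.trajLaw π)

/-- The optimal value `V^⋆(r)`. -/
def MDP.optValue (M : MDP S A H) (r : Fin H → S → A → ℝ) : ℝ :=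
  ⨆ π : Policy S A H, M.value π r

/-- A feature map with values in the unit ball of `ℝ^d`. -/
structure FeatureMap (S A : Type*) [MeasurableSpace S] [MeasurableSpace A] (d : ℕ) where
  toFun : S → A → Vec d
  measurable_toFun : Measurable fun p : S × A => toFun p.1 p.2
  norm_le_one : ∀ s a, ‖toFun s a‖ ≤ 1

instance : CoeFun (FeatureMap S A d) (fun _ => S → A → Vec d) := ⟨FeatureMap.toFun⟩

/-- `M` is a linear MDP with feature map `φ`: `P_h(· | s, a) = ⟨φ(s, a), μ_h(·)⟩` for vector-valued
signed measures `μ_h` of size at most `√d`. The size is measured by `sup_B ‖μ_h(B)‖`, which is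
at most the Euclidean norm of the vector of total variations of the coordinates of `μ_h`. -/
def MDP.IsLinear (M : MDP S A H) (φ : FeatureMap S A d) : Prop :=
  ∀ h : Fin H, ∃ μ : VectorMeasure S (Vec d),
    (∀ s a B, MeasurableSet B → (M.P h (s, a)).real B = inner ℝ (φ s a) (μ B)) ∧
    ∀ B, MeasurableSet B → ‖μ B‖ ≤ √(d : ℝ)

/-- Feasible linear reward functions: `r_h(s, a) = ⟨φ(s, a), θ_h⟩ ∈ [0, 1]` with `‖θ_h‖ ≤ √d`. -/
def FeasibleReward (φ : FeatureMap S A d) (r : Fin H → S → A → ℝ) : Prop :=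
  ∀ h : Fin H, ∃ θ : Vec d, ‖θ‖ ≤ √(d : ℝ) ∧
    ∀ s a, r h s a = inner ℝ (φ s a) θ ∧ 0 ≤ r h s a ∧ r h s a ≤ 1

/-- The expected covariance matrix `Λ_{π,h} = 𝔼_π [φ(s_h, a_h) φ(s_h, a_h)ᵀ]`. -/
def MDP.covariance (M : MDP S A H) (φ : FeatureMap S A d) (π : Policy S A H) (h : Fin H) :
    Matrix (Fin d) (Fin d) ℝ :=
  Matrix.of fun i j => ∫ τ, φ (τ h).1 (τ h).2 i * φ (τ h).1 (τ h).2 j ∂(M.trajLaw π)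

/-- The explorability parameter `λ^⋆ = min_h sup_π λ_min(Λ_{π,h})`. -/
def MDP.explorability (M : MDP S A H) (φ : FeatureMap S A d) : ℝ :=
  ⨅ h : Fin H, ⨆ π : Policy S A H, minEig (M.covariance φ π h)

end Model

section Measurability

variable {S A : Type*} [MeasurableSpace S] [MeasurableSpace A] {H : ℕ}

lemma measurable_snoc {X : Type*} [MeasurableSpace X] (n : ℕ) :
    Measurable fun p : (Fin n → X) × X => (Fin.snoc p.1 p.2 : Fin (n + 1) → X) := by
  refine measurable_pi_lambda _ fun i => ?_
  refine Fin.lastCases ?_ (fun j => ?_) i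
  · simpa using measurable_snd
  · simpa [Function.comp_def] using (measurable_pi_apply j).comp measurable_fst

instance (M : MDP S A H) (n : ℕ) (hn : n < H) : IsMarkovKernel (M.stateKernel n hn) := by
  cases n with
  | zero => unfold MDP.stateKernel; infer_instance
  | succ n =>
    have := M.markov ⟨n, Nat.lt_of_succ_lt hn⟩
    unfold MDP.stateKernel; infer_instance

instance (M : MDP S A H) (π : Policy S A H) (n : ℕ) (hn : n ≤ H) :
    IsProbabilityMeasure (M.prefixLaw π n hn) := by
  induction n with
  | zero => unfold MDP.prefixLaw; infer_instance
  | succ n ih =>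
    have := ih (Nat.le_of_succ_le hn)
    have := π.markov ⟨n, hn⟩
    unfold MDP.prefixLaw
    exact Measure.isProbabilityMeasure_map (measurable_snoc n).aemeasurable

instance (M : MDP S A H) (π : Policy S A H) : IsProbabilityMeasure (M.trajLaw π) := by
  unfold MDP.trajLaw; infer_instance

/-- The trajectory law of the mixture that runs policy `π ∈ T` with probability `p π`. -/
def MDP.mixLaw (M : MDP S A H) (T : Finset (DetPolicy S A H)) (p : T → ℝ) :
    Measure (Traj S A H) :=
  ∑ π : T, ENNReal.ofReal (p π) • M.trajLaw (DetPolicy.toPolicy π.1)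

lemma MDP.isProbabilityMeasure_mixLaw (M : MDP S A H) (T : Finset (DetPolicy S A H)) (p : T → ℝ)
    (hp : p ∈ stdSimplex ℝ T) : IsProbabilityMeasure (M.mixLaw T p) := by
  constructor
  simp only [MDP.mixLaw, Measure.coe_finsetSum, Measure.coe_smul, Finset.sum_apply, Pi.smul_apply,
    measure_univ, smul_eq_mul, mul_one]
  rw [← ENNReal.ofReal_sum_of_nonneg fun i _ => hp.1 i, hp.2, ENNReal.ofReal_one]

end Measurability

section Deployment

variable {S A : Type*} [MeasurableSpace S] [MeasurableSpace A] {H : ℕ}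

/-- A deployment based exploration algorithm: it performs `deployments` deployments, each of them
collecting `batch` trajectories (both numbers are fixed a priori); the mixture of deterministic
policies used in a deployment is a measurable function of the data of the previous ones. -/
structure DeploymentAlgorithm (S A : Type*) [MeasurableSpace S] [MeasurableSpace A] (H : ℕ) where
  deployments : ℕ
  batch : ℕ
  policies : Finset (DetPolicy S A H)
  weights : (k : Fin deployments) → Dataset S A H batch k → policies → ℝ
  measurable_weights : ∀ k, Measurable (weights k)
  weights_mem : ∀ k D, weights k D ∈ stdSimplex ℝ policies

/-- Given the previous data, the new trajectories are drawn independently from the deployed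
mixture. -/
def DeploymentAlgorithm.batchKernel (alg : DeploymentAlgorithm S A H) (M : MDP S A H)
    (k : ℕ) (hk : k < alg.deployments) :
    Kernel (Dataset S A H alg.batch k) (Fin alg.batch → Traj S A H) where
  toFun D := Measure.pi fun _ => M.mixLaw alg.policies (alg.weights ⟨k, hk⟩ D)
  measurable' := by
    have hp : ∀ D, IsProbabilityMeasure (M.mixLaw alg.policies (alg.weights ⟨k, hk⟩ D)) :=
      fun D => M.isProbabilityMeasure_mixLaw _ _ (alg.weights_mem ⟨k, hk⟩ D)
    refine Measurable.measure_of_isPiSystem_of_isProbabilityMeasure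
      generateFrom_pi.symm isPiSystem_pi ?_
    rintro _ ⟨B, hB, rfl⟩
    simp only [Measure.pi_pi]
    refine Finset.measurable_prod _ fun i _ => ?_
    simp only [MDP.mixLaw, Measure.coe_finsetSum, Measure.coe_smul, Finset.sum_apply,
      Pi.smul_apply, smul_eq_mul]
    refine Finset.measurable_sum _ fun π _ => ?_
    exact (((measurable_pi_apply π).comp (alg.measurable_weights ⟨k, hk⟩)).ennreal_ofReal).mul_const _

/-- The law of the data of the first `k` deployments in the MDP `M`. -/
def DeploymentAlgorithm.lawUpTo (alg : DeploymentAlgorithm S A H) (M : MDP S A H) :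
    (k : ℕ) → k ≤ alg.deployments → Measure (Dataset S A H alg.batch k)
  | 0, _ => Measure.dirac (fun i => i.elim0)
  | k + 1, hk =>
      ((alg.lawUpTo M k (Nat.le_of_succ_le hk)) ⊗ₘ (alg.batchKernel M k hk)).map
        (fun p => (Fin.snoc p.1 p.2 : Dataset S A H alg.batch (k + 1)))

/-- The law of the whole data set. -/
def DeploymentAlgorithm.law (alg : DeploymentAlgorithm S A H) (M : MDP S A H) :
    Measure (Dataset S A H alg.batch alg.deployments) :=
  alg.lawUpTo M alg.deployments le_rfl

/-- The total number of trajectories. -/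
def DeploymentAlgorithm.trajectories (alg : DeploymentAlgorithm S A H) : ℕ :=
  alg.deployments * alg.batch

instance (alg : DeploymentAlgorithm S A H) (M : MDP S A H) (k : ℕ) (hk : k < alg.deployments) :
    IsMarkovKernel (alg.batchKernel M k hk) := by
  have hp : ∀ D, IsProbabilityMeasure (M.mixLaw alg.policies (alg.weights ⟨k, hk⟩ D)) :=
    fun D => M.isProbabilityMeasure_mixLaw _ _ (alg.weights_mem ⟨k, hk⟩ D)
  exact ⟨fun D => by
    change IsProbabilityMeasure (Measure.pi fun _ => M.mixLaw alg.policies (alg.weights ⟨k, hk⟩ D))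
    infer_instance⟩

instance (alg : DeploymentAlgorithm S A H) (M : MDP S A H) (k : ℕ) (hk : k ≤ alg.deployments) :
    IsProbabilityMeasure (alg.lawUpTo M k hk) := by
  induction k with
  | zero => unfold DeploymentAlgorithm.lawUpTo; infer_instance
  | succ k ih =>
    have := ih (Nat.le_of_succ_le hk)
    unfold DeploymentAlgorithm.lawUpTo
    exact Measure.isProbabilityMeasure_map (measurable_snoc k).aemeasurable

end Deployment

section PolicySets

variable {S A : Type*} [MeasurableSpace S] [MeasurableSpace A] {H d : ℕ}

/-- `f(s) ∈ argmax_a Q(s, a)` for all `s`. -/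
def IsGreedy (Q : S → A → ℝ) (f : S → A) : Prop := ∀ s a, Q s a ≤ Q s (f s)

/-- The reward function `√(φᵀ (I + X)⁻¹ φ)`. -/
def ellipticReward (φ : FeatureMap S A d) (X : Matrix (Fin d) (Fin d) ℝ) (s : S) (a : A) : ℝ :=
  √(quad ((1 + X)⁻¹) (φ s a))

/-- The ingredients of the construction of the policy sets at accuracy `ε`: an `ε/(2H)`-cover
`linCover` of the Euclidean ball of radius `2H√d`, an `ε/(2H)`-cover `rewCover` (in the sup norm)
of the reward functions `√(φᵀ (I + X)⁻¹ φ)` with `X` positive semidefinite, both of the standard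
size, and for every layer and every element of the covers a (measurable) greedy decision rule,
with ties broken arbitrarily. -/
structure Discretization (φ : FeatureMap S A d) (H : ℕ) (ε : ℝ) where
  linCover : Finset (Vec d)
  linCover_covers : ∀ x : Vec d, ‖x‖ ≤ 2 * H * √(d : ℝ) →
    ∃ w ∈ linCover, ‖x - w‖ ≤ ε / (2 * H)
  linCover_card : (linCover.card : ℝ) ≤ (1 + 8 * (H : ℝ) ^ 2 * √(d : ℝ) / ε) ^ d
  linRule : Fin H → Vec d → DetRule S A
  linRule_greedy : ∀ h, ∀ w ∈ linCover,
    IsGreedy (fun s a => inner ℝ (φ s a) w) (linRule h w).1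
  rewCover : Finset (S → A → ℝ)
  rewCover_covers : ∀ X : Matrix (Fin d) (Fin d) ℝ, X.PosSemidef →
    ∃ f ∈ rewCover, ∀ s a, |ellipticReward φ X s a - f s a| ≤ ε / (2 * H)
  rewCover_card :
    (rewCover.card : ℝ) ≤ (1 + 32 * (H : ℝ) ^ 2 * √(d : ℝ) / ε ^ 2) ^ (d ^ 2)
  rewRule : Fin H → (S → A → ℝ) → DetRule S A
  rewRule_greedy : ∀ h, ∀ f ∈ rewCover, IsGreedy f (rewRule h f).1

variable {φ : FeatureMap S A d} {ε : ℝ}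

open Classical in
/-- The policies to evaluate, `Π^{eval}_ε`. -/
def Discretization.evalSet (Δ : Discretization φ H ε) : Finset (DetPolicy S A H) :=
  Fintype.piFinset fun h => Δ.linCover.image (Δ.linRule h)

open Classical in
/-- The explorative policies, `Π^{exp}_ε`. -/
def Discretization.expSet (Δ : Discretization φ H ε) : Finset (DetPolicy S A H) :=
  Fintype.piFinset fun h => Δ.rewCover.image (Δ.rewRule h) ∪ Δ.linCover.image (Δ.linRule h)

end PolicySets

section Estimation

variable {S A : Type*} [MeasurableSpace S] [MeasurableSpace A] {H d N k : ℕ}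

/-- `Λ_h = I + ∑_n φ(s_h^n, a_h^n) φ(s_h^n, a_h^n)ᵀ`, over all trajectories of the data set. -/
def empCov (φ : FeatureMap S A d) (D : Dataset S A H N k) (h : Fin H) :
    Matrix (Fin d) (Fin d) ℝ :=
  1 + ∑ i, ∑ n, Matrix.vecMulVec (φ (D i n h).1 (D i n h).2).ofLp (φ (D i n h).1 (D i n h).2).ofLp

/-- `V(s_{h+1})` along a trajectory; after the last layer the value is `0`. -/
def nextValue (V : S → ℝ) (τ : Traj S A H) (h : Fin H) : ℝ :=
  if hh : h.1 + 1 < H then V (τ ⟨h.1 + 1, hh⟩).1 else 0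

/-- The ridge regression weights `Λ_h⁻¹ ∑_n φ(s_h^n, a_h^n) V(s_{h+1}^n)`. -/
def ridgeWeights (φ : FeatureMap S A d) (D : Dataset S A H N k) (h : Fin H) (V : S → ℝ) :
    Fin d → ℝ :=
  (empCov φ D h)⁻¹ *ᵥ
    ∑ i, ∑ n, nextValue V (D i n) h • (φ (D i n h).1 (D i n h).2).ofLp

/-- One backward step: from `V_{h+1}` to
`V_h(s) = (φ(s, π_h(s))ᵀ w_h + r_h(s, π_h(s)))_{[0,B]}`. -/
def backupStep (φ : FeatureMap S A d) (D : Dataset S A H N k) (π : DetPolicy S A H)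
    (r : Fin H → S → A → ℝ) (B : ℝ) (h : Fin H) (V : S → ℝ) (s : S) : ℝ :=
  clip B ((φ s ((π h).1 s)).ofLp ⬝ᵥ ridgeWeights φ D h V + r h s ((π h).1 s))

/-- Backward recursion from the value function `V` of layer `n` to that of the first layer. -/
def backward (φ : FeatureMap S A d) (D : Dataset S A H N k) (π : DetPolicy S A H)
    (r : Fin H → S → A → ℝ) (B : ℝ) : (n : ℕ) → n ≤ H → (S → ℝ) → S → ℝ
  | 0, _, V => V
  | n + 1, hn, V =>
      backward φ D π r B n (Nat.le_of_succ_le hn) (backupStep φ D π r B ⟨n, hn⟩ V)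

/-- The algorithm EstimateV: the estimate of `V^π(r)`. -/
def estimateV (φ : FeatureMap S A d) (s₁ : S) (D : Dataset S A H N k) (π : DetPolicy S A H)
    (r : Fin H → S → A → ℝ) : ℝ :=
  backward φ D π r H H le_rfl (fun _ => 0) s₁

/-- The algorithm EstimateER: the estimate of `𝔼_π f(s_h, a_h)` for a reward function `f` with
upper bound `B`. -/
def estimateER (φ : FeatureMap S A d) (s₁ : S) (D : Dataset S A H N k) (π : DetPolicy S A H)
    (f : S → A → ℝ) (B : ℝ) (h : Fin H) : ℝ :=
  backward φ D π (fun _ _ _ => 0) B h h.isLt.le (fun s => f s ((π h).1 s)) s₁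

/-- The estimate of `𝔼_π [φ(s_h, a_h) φ(s_h, a_h)ᵀ]`, entry by entry, through the reward functions
`(φ_i φ_j + 1) / 2 ∈ [0, 1]`. -/
def estCov (φ : FeatureMap S A d) (s₁ : S) (D : Dataset S A H N k) (π : DetPolicy S A H)
    (h : Fin H) : Matrix (Fin d) (Fin d) ℝ :=
  Matrix.of fun i j =>
    2 * estimateER φ s₁ D π (fun s a => (φ s a i * φ s a j + 1) / 2) 1 h - 1

/-- The estimate of the covariance matrix of a mixture of policies. -/
def estCovMix (φ : FeatureMap S A d) (s₁ : S) (D : Dataset S A H N k)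
    (T : Finset (DetPolicy S A H)) (p : T → ℝ) (h : Fin H) : Matrix (Fin d) (Fin d) ℝ :=
  ∑ π : T, p π • estCov φ s₁ D π.1 h

/-- The feasible set of the design problem: mixtures `p` whose estimated covariance matrix has
smallest eigenvalue at least `c`. -/
def DesignFeasible (φ : FeatureMap S A d) (s₁ : S) (D : Dataset S A H N k)
    (T : Finset (DetPolicy S A H)) (c : ℝ) (h : Fin H) (p : T → ℝ) : Prop :=
  p ∈ stdSimplex ℝ T ∧ c ≤ minEig (estCovMix φ s₁ D T p h)

/-- The objective of the design problem: the maximum over `π̂ ∈ T` of the estimate of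
`𝔼_π̂ [φ(s_h, a_h)ᵀ (N · Σ̂_p)⁻¹ φ(s_h, a_h)]`. -/
def designObjective (φ : FeatureMap S A d) (s₁ : S) (D : Dataset S A H N k)
    (T : Finset (DetPolicy S A H)) (B : ℝ) (h : Fin H) (p : T → ℝ) : ℝ :=
  ⨆ π' : T, estimateER φ s₁ D π'.1
    (fun s a => quad (((N : ℝ) • estCovMix φ s₁ D T p h)⁻¹) (φ s a)) B h

end Estimation

section Algorithms

/-- `ι = log(dH / (εδ))`. -/
def logFactor (d H : ℕ) (ε δ : ℝ) : ℝ := Real.log (d * H / (ε * δ))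

/-- The error budget per layer `ε̄ = C₁ ε / (H² √d ι)`. -/
def layerBudget (C₁ : ℝ) (d H : ℕ) (ε δ : ℝ) : ℝ :=
  C₁ * ε / ((H : ℝ) ^ 2 * √(d : ℝ) * logFactor d H ε δ)

/-- The number of episodes per deployment `N = C₂ d ι / ε̄²` (rounded up). -/
def episodes (C₁ C₂ : ℝ) (d H : ℕ) (ε δ : ℝ) : ℕ :=
  ⌈C₂ * d * logFactor d H ε δ / layerBudget C₁ d H ε δ ^ 2⌉₊

/-- The eigenvalue threshold `C₃ d² H ε̄ ι`. -/
def eigThreshold (C₁ C₃ : ℝ) (d H : ℕ) (ε δ : ℝ) : ℝ :=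
  C₃ * (d : ℝ) ^ 2 * H * layerBudget C₁ d H ε δ * logFactor d H ε δ

/-- The upper bound `ε̄ / (C₂ d³ H ι²)` of the reward functions in the design objective. -/
def rewardBound (C₁ C₂ : ℝ) (d H : ℕ) (ε δ : ℝ) : ℝ :=
  layerBudget C₁ d H ε δ / (C₂ * (d : ℝ) ^ 3 * H * logFactor d H ε δ ^ 2)

variable {S A : Type*} [MeasurableSpace S] [MeasurableSpace A] {H d : ℕ}

/-- A rule that solves the design problem of every layer `h` from the data of the previous
deployments, with ties broken in an arbitrary measurable way. Where the problem has no feasible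
point, the rule is unconstrained. -/
structure DesignSolver (φ : FeatureMap S A d) (s₁ : S) (C₁ C₂ C₃ ε δ : ℝ)
    (Δ : Discretization φ H (ε / 3)) where
  weights : (h : Fin H) → Dataset S A H (episodes C₁ C₂ d H ε δ) h → Δ.expSet → ℝ
  measurable_weights : ∀ h, Measurable (weights h)
  weights_mem : ∀ h D, weights h D ∈ stdSimplex ℝ Δ.expSet
  argmin : ∀ h D,
    (∃ p, DesignFeasible φ s₁ D Δ.expSet (eigThreshold C₁ C₃ d H ε δ) h p) →
      DesignFeasible φ s₁ D Δ.expSet (eigThreshold C₁ C₃ d H ε δ) h (weights h D) ∧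
      ∀ p, DesignFeasible φ s₁ D Δ.expSet (eigThreshold C₁ C₃ d H ε δ) h p →
        designObjective φ s₁ D Δ.expSet (rewardBound C₁ C₂ d H ε δ) h (weights h D) ≤
          designObjective φ s₁ D Δ.expSet (rewardBound C₁ C₂ d H ε δ) h p

variable {φ : FeatureMap S A d} {s₁ : S} {C₁ C₂ C₃ ε δ : ℝ} {Δ : Discretization φ H (ε / 3)}

/-- The exploration algorithm: one deployment per layer, running the solution of the design problem
of that layer. It has access to `φ`, `s₁`, `ε`, `δ`, but not to the transition kernels. -/
def explorationAlgorithm (sol : DesignSolver φ s₁ C₁ C₂ C₃ ε δ Δ) : DeploymentAlgorithm S A H where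
  deployments := H
  batch := episodes C₁ C₂ d H ε δ
  policies := Δ.expSet
  weights := sol.weights
  measurable_weights := sol.measurable_weights
  weights_mem := sol.weights_mem

/-- The data of the first `k` deployments. -/
def Dataset.before {S A : Type*} {H N m : ℕ} (D : Dataset S A H N m) (k : Fin m) :
    Dataset S A H N k :=
  fun i => D (Fin.castLE k.isLt.le i)

/-- `π` is an output of the planning algorithm on the data set `D` and the reward function `r`:
a maximizer over `Π^{eval}_{ε/3}` of the estimated value. -/
def IsPlanningOutput {N k : ℕ} (s₁ : S) (Δ : Discretization φ H (ε / 3)) (D : Dataset S A H N k)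
    (r : Fin H → S → A → ℝ) (π : DetPolicy S A H) : Prop :=
  π ∈ Δ.evalSet ∧ ∀ π' ∈ Δ.evalSet, estimateV φ s₁ D π' r ≤ estimateV φ s₁ D π r

end Algorithms

end RewardFree

end

universe u v

open RewardFree

/-! In a linear MDP the conditional expectation of a bounded next value is linear in the features
(`MDP.IsLinear.exists_weight`). Ridge regression at layer `i` therefore errs at `(s, a)` by at most
the range of the values times `β ‖φ(s, a)‖` in the norm of `Λ_i⁻¹`. By
`abs_backward_sub_detValue_le` these errors add up along the backward recursion, so an estimate is
off by the range times `β` times the sum of the expected bonuses of the layers it passes. It thus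
suffices to make the expected bonus of every layer at most `ε̄`, for all explorative policies at
once.

The value functions fed to the regression depend on the data, so the bound must be uniform. All of
them are truncated linear or quadratic functions of the features along one of finitely many decision
rules, and a union bound over rules and a parameter grid covers them. No mixture over directions is
needed for the self-normalized noise. The direction `Λ⁻¹ · noise` is put on the grid too, and there
the Hoeffding exponent is at least half of the squared norm (`quad_inv_noiseVec_le`,
`DeploymentAlgorithm.exists_uniform_event`). Explorative rules have entropy of order `d²`, giving `β
≲ dι`. The rules to evaluate have entropy of order `d`, giving `β ≲ √d ι`, and only this smaller
factor enters the planning error.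

Exploration is an induction over layers (`layer_step`, `explore_layers`), because the estimates at
layer `h` pass only through earlier layers. A good design at layer `h` exists by
`MDP.IsLinear.exists_exploring_mixture`: a mixture maximizing a regularized determinant has small
expected elliptic norms under all explorative policies. Were it blind to some direction, a policy
nearly attaining `λ^⋆` would have a large elliptic reward, and so would an explorative policy that
nearly maximizes this reward. This mixture is feasible for the estimated problem, so the chosen one
is nearly as good, up to estimation error.

The eigenvalue constraint turns entrywise errors into relative ones: estimation and sampling errors
together cost at most half of the estimated matrix. It also bounds the rewards of the objective by a
`B` of order `ε̄ / (d³Hι²)`, so that their estimation error `B · β · Hε̄` is below `ε̄²`. By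
Jensen's inequality the expected bonus at layer `h` is then at most `ε̄`.

For planning, `ε` is split into three: one third for restricting to the policy cover and one third
for each of the two value estimates that are compared. -/

namespace RewardFree

/-! ### Quadratic forms, inverses and optimal designs. -/

section LinearAlgebra

variable {d : ℕ}

lemma dotProduct_self_eq_norm_sq (x : Vec d) : x.ofLp ⬝ᵥ x.ofLp = ‖x‖ ^ 2 := by
  rw [EuclideanSpace.norm_sq_eq]
  simp [dotProduct, sq]

lemma inner_eq_dotProduct (x y : Vec d) : inner ℝ x y = x.ofLp ⬝ᵥ y.ofLp := by
  simp [PiLp.inner_apply, dotProduct, mul_comm]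

lemma abs_coord_le_norm (x : Vec d) (i : Fin d) : |x i| ≤ ‖x‖ := by
  simpa using PiLp.norm_apply_le x i

lemma quad_add (X Y : Matrix (Fin d) (Fin d) ℝ) (x : Vec d) :
    quad (X + Y) x = quad X x + quad Y x := by
  simp [quad, Matrix.add_mulVec]

lemma quad_sub (X Y : Matrix (Fin d) (Fin d) ℝ) (x : Vec d) :
    quad (X - Y) x = quad X x - quad Y x := by
  simp [quad, Matrix.sub_mulVec]

lemma quad_smul (c : ℝ) (X : Matrix (Fin d) (Fin d) ℝ) (x : Vec d) :
    quad (c • X) x = c * quad X x := by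
  simp [quad, Matrix.smul_mulVec]

lemma quad_one (x : Vec d) : quad 1 x = ‖x‖ ^ 2 := by
  simp [quad, dotProduct_self_eq_norm_sq]

lemma quad_sum {ι : Type*} (s : Finset ι) (X : ι → Matrix (Fin d) (Fin d) ℝ) (x : Vec d) :
    quad (∑ i ∈ s, X i) x = ∑ i ∈ s, quad (X i) x := by
  simp [quad, Matrix.sum_mulVec, dotProduct_sum]

lemma quad_eq_sum (X : Matrix (Fin d) (Fin d) ℝ) (x : Vec d) :
    quad X x = ∑ i, ∑ j, X i j * (x i * x j) := by
  simp only [quad, dotProduct, Matrix.mulVec, Finset.mul_sum]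
  exact Finset.sum_congr rfl fun i _ => Finset.sum_congr rfl fun j _ => by ring

lemma quad_vecMulVec (y x : Vec d) :
    quad (Matrix.vecMulVec y.ofLp y.ofLp) x = (inner ℝ x y) ^ 2 := by
  rw [inner_eq_dotProduct]
  simp only [quad, Matrix.vecMulVec_mulVec, dotProduct_smul, MulOpposite.smul_eq_mul_unop,
    MulOpposite.unop_op, dotProduct_comm y.ofLp x.ofLp, sq]

/-- The quadratic form of a matrix with small entries is small. -/
lemma abs_quad_le_of_entry_le {X : Matrix (Fin d) (Fin d) ℝ} {η : ℝ} (h : ∀ i j, |X i j| ≤ η)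
    (x : Vec d) : |quad X x| ≤ d * η * ‖x‖ ^ 2 := by
  rcases isEmpty_or_nonempty (Fin d) with he | ⟨⟨i₀⟩⟩
  · have : x = 0 := Subsingleton.elim _ _
    simp [quad_eq_sum, this]
  have hη : 0 ≤ η := (abs_nonneg _).trans (h i₀ i₀)
  have h1 : |quad X x| ≤ η * (∑ i, |x i|) ^ 2 := by
    rw [quad_eq_sum, sq, Finset.sum_mul_sum, Finset.mul_sum]
    refine (Finset.abs_sum_le_sum_abs _ _).trans (Finset.sum_le_sum fun i _ => ?_)
    rw [Finset.mul_sum]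
    refine (Finset.abs_sum_le_sum_abs _ _).trans (Finset.sum_le_sum fun j _ => ?_)
    rw [abs_mul, abs_mul]
    exact mul_le_mul_of_nonneg_right (h i j) (by positivity)
  have h2 : (∑ i, |x i|) ^ 2 ≤ d * ‖x‖ ^ 2 := by
    have := sq_sum_le_card_mul_sum_sq (s := Finset.univ) (f := fun i : Fin d => |x i|)
    simpa [EuclideanSpace.norm_sq_eq] using this
  calc _ ≤ η * (∑ i, |x i|) ^ 2 := h1
    _ ≤ η * (d * ‖x‖ ^ 2) := by gcongr
    _ = _ := by ring

lemma posDef_of_quad {X : Matrix (Fin d) (Fin d) ℝ} (hX : X.IsHermitian) {c : ℝ} (hc : 0 < c)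
    (h : ∀ x : Vec d, c * ‖x‖ ^ 2 ≤ quad X x) : X.PosDef := by
  refine Matrix.PosDef.of_dotProduct_mulVec_pos hX fun x hx => ?_
  have h1 := h (WithLp.toLp 2 x)
  have h2 : 0 < ‖WithLp.toLp 2 x‖ := norm_pos_iff.2 (by simpa using hx)
  have : 0 < c * ‖WithLp.toLp 2 x‖ ^ 2 := by positivity
  simpa [quad] using this.trans_le h1

lemma posSemidef_of_quad {X : Matrix (Fin d) (Fin d) ℝ} (hX : X.IsHermitian)
    (h : ∀ x : Vec d, 0 ≤ quad X x) : X.PosSemidef :=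
  Matrix.PosSemidef.of_dotProduct_mulVec_nonneg hX fun x => by
    simpa [quad] using h (WithLp.toLp 2 x)

lemma quad_nonneg {X : Matrix (Fin d) (Fin d) ℝ} (hX : X.PosSemidef) (x : Vec d) :
    0 ≤ quad X x := by
  simpa [quad] using hX.dotProduct_mulVec_nonneg x.ofLp

lemma dotProduct_mulVec_comm {X : Matrix (Fin d) (Fin d) ℝ} (hX : X.IsHermitian)
    (x y : Fin d → ℝ) : x ⬝ᵥ (X *ᵥ y) = y ⬝ᵥ (X *ᵥ x) := by
  rw [Matrix.dotProduct_mulVec, ← Matrix.mulVec_transpose, dotProduct_comm]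
  have : Xᵀ = X := by simpa [Matrix.IsHermitian] using hX
  rw [this]

/-- This trades the spectral definition for bounds on quadratic forms, the form used everywhere
below. Positivity of `d` makes the spectrum nonempty, so that `sInf` is a genuine minimum. -/
lemma le_minEig_iff (hd : 0 < d) {X : Matrix (Fin d) (Fin d) ℝ} (hX : X.IsHermitian) (c : ℝ) :
    c ≤ minEig X ↔ ∀ x : Vec d, c * ‖x‖ ^ 2 ≤ quad X x := by
  have : Nonempty (Fin d) := ⟨⟨0, hd⟩⟩
  constructor
  · intro h x
    have hs : ∀ t ∈ spectrum ℝ X, c ≤ t := fun t ht => h.trans (by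
      refine csInf_le ?_ ht
      rw [hX.spectrum_real_eq_range_eigenvalues]
      exact (Set.finite_range _).bddBelow)
    have hY : (X - c • (1 : Matrix (Fin d) (Fin d) ℝ)).IsHermitian := by
      refine hX.sub ?_
      simp [Matrix.IsHermitian]
    have hps : (X - c • (1 : Matrix (Fin d) (Fin d) ℝ)).PosSemidef := by
      rw [hY.posSemidef_iff_eigenvalues_nonneg]
      intro i
      obtain ⟨t, ht⟩ : ∃ t, t = hY.eigenvalues i := ⟨_, rfl⟩
      have hi := hY.eigenvalues_mem_spectrum_real i
      rw [← ht] at hi ⊢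
      have : t + c ∈ spectrum ℝ X := by
        rw [← Algebra.algebraMap_eq_smul_one] at hi
        have h4 := spectrum.add_mem_add_iff (r := t) (s := c) (a := X - algebraMap ℝ _ c)
        rw [add_sub_cancel] at h4
        exact h4.2 hi
      have := hs _ this
      simp; linarith
    have := quad_nonneg hps x
    rw [quad_sub, quad_smul, quad_one] at this
    linarith
  · intro h
    refine le_csInf ⟨_, hX.eigenvalues_mem_spectrum_real ⟨0, hd⟩⟩ fun t ht => ?_
    rw [hX.spectrum_real_eq_range_eigenvalues] at ht
    obtain ⟨i, rfl⟩ := ht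
    have h1 := h (hX.eigenvectorBasis i)
    have h2 := hX.eigenvalues_eq i
    have h3 : ‖hX.eigenvectorBasis i‖ = 1 := hX.eigenvectorBasis.orthonormal.1 i
    rw [h3] at h1
    rw [h2]
    simpa [quad] using h1

lemma inv_mulVec_mulVec {X : Matrix (Fin d) (Fin d) ℝ} (hX : X.PosDef) (x : Fin d → ℝ) :
    X *ᵥ (X⁻¹ *ᵥ x) = x := by
  rw [Matrix.mulVec_mulVec, Matrix.mul_nonsing_inv _ ((Matrix.isUnit_iff_isUnit_det _).1 hX.isUnit),
    Matrix.one_mulVec]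

lemma mulVec_inv_mulVec {X : Matrix (Fin d) (Fin d) ℝ} (hX : X.PosDef) (x : Fin d → ℝ) :
    X⁻¹ *ᵥ (X *ᵥ x) = x := by
  rw [Matrix.mulVec_mulVec, Matrix.nonsing_inv_mul _ ((Matrix.isUnit_iff_isUnit_det _).1 hX.isUnit),
    Matrix.one_mulVec]

lemma sq_dotProduct_mulVec_le {X : Matrix (Fin d) (Fin d) ℝ} (hX : X.PosSemidef)
    (x y : Fin d → ℝ) :
    (x ⬝ᵥ (X *ᵥ y)) ^ 2 ≤ (x ⬝ᵥ (X *ᵥ x)) * (y ⬝ᵥ (X *ᵥ y)) := by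
  have h : ∀ t : ℝ, 0 ≤ (x ⬝ᵥ (X *ᵥ x)) * (t * t) + (2 * (x ⬝ᵥ (X *ᵥ y))) * t
      + y ⬝ᵥ (X *ᵥ y) := by
    intro t
    have h0 := hX.dotProduct_mulVec_nonneg (t • x + y)
    have h1 := dotProduct_mulVec_comm hX.1 y x
    simp only [star_trivial, Matrix.mulVec_add, Matrix.mulVec_smul, dotProduct_add, add_dotProduct,
      smul_dotProduct, dotProduct_smul, smul_eq_mul, h1] at h0
    linarith
  have := discrim_le_zero h
  rw [discrim] at this
  nlinarith

/-- The Cauchy-Schwarz inequality for the dual norms given by `X` and `X⁻¹`. -/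
lemma sq_dotProduct_le {X : Matrix (Fin d) (Fin d) ℝ} (hX : X.PosDef) (x y : Vec d) :
    (x.ofLp ⬝ᵥ y.ofLp) ^ 2 ≤ quad X⁻¹ x * quad X y := by
  have h := sq_dotProduct_mulVec_le hX.posSemidef (X⁻¹ *ᵥ x.ofLp) y.ofLp
  rw [inv_mulVec_mulVec hX, dotProduct_mulVec_comm hX.1, inv_mulVec_mulVec hX,
    dotProduct_comm y.ofLp, dotProduct_comm (X⁻¹ *ᵥ x.ofLp)] at h
  exact h

lemma abs_dotProduct_inv_mulVec_le {X : Matrix (Fin d) (Fin d) ℝ} (hX : X.PosDef)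
    (x y : Vec d) : |x.ofLp ⬝ᵥ (X⁻¹ *ᵥ y.ofLp)| ≤ √(quad X⁻¹ x) * √(quad X⁻¹ y) := by
  rw [← Real.sqrt_mul (quad_nonneg hX.inv.posSemidef x)]
  exact Real.abs_le_sqrt (sq_dotProduct_mulVec_le hX.inv.posSemidef _ _)

/-- Inversion reverses the order of positive definite matrices. No matrix square roots are needed:
Cauchy-Schwarz for `X⁻¹` and `X`, tested at `y = Y⁻¹ x`, bounds the square of `quad Y⁻¹ x` by a
multiple of itself. -/
lemma quad_inv_le_of_le {X Y : Matrix (Fin d) (Fin d) ℝ} (hX : X.PosDef) (hY : Y.PosDef) {c : ℝ}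
    (hc : 0 < c) (h : ∀ x : Vec d, c * quad X x ≤ quad Y x) (x : Vec d) :
    quad Y⁻¹ x ≤ c⁻¹ * quad X⁻¹ x := by
  set y : Vec d := WithLp.toLp 2 (Y⁻¹ *ᵥ x.ofLp)
  have hxy : x.ofLp ⬝ᵥ y.ofLp = quad Y⁻¹ x := rfl
  have hYy : quad Y y = quad Y⁻¹ x := by
    simp only [quad, y, inv_mulVec_mulVec hY]
    exact dotProduct_comm _ _
  have h1 := sq_dotProduct_le hX x y
  have h2 := h y
  rw [hxy] at h1
  rw [hYy] at h2
  have h3 := quad_nonneg hX.inv.posSemidef x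
  have h4 := quad_nonneg hY.inv.posSemidef x
  rcases h4.eq_or_lt with h5 | h5
  · rw [← h5]; positivity
  · have h6 : quad X y ≤ c⁻¹ * quad Y⁻¹ x := by
      rw [← div_eq_inv_mul, le_div_iff₀ hc]; linarith
    have : quad Y⁻¹ x * quad Y⁻¹ x ≤ c⁻¹ * quad X⁻¹ x * quad Y⁻¹ x := by
      calc _ = quad Y⁻¹ x ^ 2 := by ring
        _ ≤ quad X⁻¹ x * quad X y := h1
        _ ≤ quad X⁻¹ x * (c⁻¹ * quad Y⁻¹ x) := by gcongr
        _ = _ := by ring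
    exact le_of_mul_le_mul_right this h5

lemma quad_inv_le_norm_sq {X : Matrix (Fin d) (Fin d) ℝ} (hX : X.PosDef) {c : ℝ} (hc : 0 < c)
    (h : ∀ x : Vec d, c * ‖x‖ ^ 2 ≤ quad X x) (x : Vec d) : quad X⁻¹ x ≤ c⁻¹ * ‖x‖ ^ 2 := by
  have := quad_inv_le_of_le (X := 1) (Y := X) Matrix.PosDef.one hX hc (by simpa [quad_one] using h) x
  simpa [quad_one] using this

/-- Since `X` dominates the identity, its inverse is a contraction. This yields crude but
deterministic radii for the parameter grids. -/
lemma norm_inv_mulVec_le {X : Matrix (Fin d) (Fin d) ℝ} (hX : X.PosDef)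
    (h : ∀ x : Vec d, ‖x‖ ^ 2 ≤ quad X x) (x : Vec d) :
    ‖(WithLp.toLp 2 (X⁻¹ *ᵥ x.ofLp) : Vec d)‖ ≤ ‖x‖ := by
  set y : Vec d := WithLp.toLp 2 (X⁻¹ *ᵥ x.ofLp)
  have h1 : ‖y‖ ^ 2 ≤ inner ℝ y x := by
    refine (h y).trans_eq ?_
    simp only [quad, y, inv_mulVec_mulVec hX, inner_eq_dotProduct]
  have h2 := h1.trans (real_inner_le_norm y x)
  rcases (norm_nonneg y).eq_or_lt with h3 | h3
  · rw [← h3]; positivity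
  · rw [sq] at h2
    exact le_of_mul_le_mul_left h2 h3

lemma trace_mul_vecMulVec (X : Matrix (Fin d) (Fin d) ℝ) (x : Vec d) :
    (X * Matrix.vecMulVec x.ofLp x.ofLp).trace = quad X x := by
  rw [Matrix.mul_vecMulVec, Matrix.trace_vecMulVec, quad, dotProduct_comm]

lemma minEig_le_of_trace_le (hd : 0 < d) {X : Matrix (Fin d) (Fin d) ℝ} (hX : X.IsHermitian)
    {b : ℝ} (h : X.trace ≤ b) : minEig X ≤ b / d := by
  have h1 := (le_minEig_iff hd hX (minEig X)).1 le_rfl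
  rw [le_div_iff₀ (by exact_mod_cast hd)]
  refine le_trans ?_ h
  have h2 : ∀ i : Fin d, minEig X ≤ X i i := fun i => by
    have := h1 (EuclideanSpace.single i 1)
    simpa [quad] using this
  calc minEig X * d = ∑ _i : Fin d, minEig X := by simp [mul_comm]
    _ ≤ ∑ i, X i i := Finset.sum_le_sum fun i _ => h2 i
    _ = X.trace := rfl

/-- First order condition for the maximization of `det` along a segment. -/
lemma trace_inv_mul_nonpos_of_det_max {X Y : Matrix (Fin d) (Fin d) ℝ} (hX : X.PosDef)
    (h : ∀ t ∈ Set.Icc (0 : ℝ) 1, (X + t • Y).det ≤ X.det) : (X⁻¹ * Y).trace ≤ 0 := by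
  -- `q` is the remainder of the polynomial `det (1 + t X⁻¹Y)` after its constant and linear terms;
  -- the linear coefficient is the trace in question.
  set q := ((1 + (Polynomial.X : Polynomial ℝ) • (X⁻¹ * Y).map Polynomial.C).det).divX.divX
  have hdet : ∀ t : ℝ, (X + t • Y).det =
      X.det * (1 + (X⁻¹ * Y).trace * t + q.eval t * t ^ 2) := by
    intro t
    rw [← Matrix.det_one_add_smul, ← Matrix.det_mul, mul_add, mul_one, Matrix.mul_smul,
      ← mul_assoc, Matrix.mul_nonsing_inv _ ((Matrix.isUnit_iff_isUnit_det _).1 hX.isUnit), one_mul]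
  have h1 : ∀ t ∈ Set.Ioc (0 : ℝ) 1, (X⁻¹ * Y).trace + q.eval t * t ≤ 0 := by
    intro t ht
    have h2 := h t ⟨ht.1.le, ht.2⟩
    rw [hdet] at h2
    have h3 := hX.det_pos
    have h4 : ((X⁻¹ * Y).trace + q.eval t * t) * t ≤ 0 := by
      by_contra hcon
      push Not at hcon
      nlinarith [mul_pos h3 hcon]
    by_contra hcon
    push Not at hcon
    exact absurd h4 (not_le.2 (mul_pos hcon ht.1))
  have hlim : Filter.Tendsto (fun t : ℝ => (X⁻¹ * Y).trace + q.eval t * t) (nhdsWithin 0 (Set.Ioi 0))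
      (nhds ((X⁻¹ * Y).trace + q.eval 0 * 0)) :=
    Filter.Tendsto.mono_left (Continuous.tendsto (by fun_prop) 0) nhdsWithin_le_nhds
  have := le_of_tendsto hlim (Filter.eventually_of_mem (Ioc_mem_nhdsGT (zero_lt_one)) h1)
  simpa using this

/-- A regularized `G`-optimal design: for positive semidefinite matrices `Y i` there is a mixture
`Y_p` such that `tr ((1 + n Y_p)⁻¹ Y i) ≤ d / n` for all `i`. -/
lemma exists_design {ι : Type*} [Fintype ι] [Nonempty ι] (Y : ι → Matrix (Fin d) (Fin d) ℝ)
    (hY : ∀ i, (Y i).PosSemidef) {n : ℝ} (hn : 0 < n) :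
    ∃ p ∈ stdSimplex ℝ ι, ∀ i, ((1 + n • ∑ j, p j • Y j)⁻¹ * Y i).trace ≤ d / n := by
  classical
  have hcont : Continuous fun p : ι → ℝ => (1 + n • ∑ j, p j • Y j).det := by
    refine Continuous.matrix_det ?_
    fun_prop
  obtain ⟨p, hp, hmax⟩ := (isCompact_stdSimplex ℝ ι).exists_isMaxOn
    ⟨_, single_mem_stdSimplex ℝ (Classical.arbitrary ι)⟩ hcont.continuousOn
  refine ⟨p, hp, fun i => ?_⟩
  set Z := ∑ j, p j • Y j
  have hZ : Z.PosSemidef := Matrix.posSemidef_sum _ fun j _ => (hY j).smul (hp.1 j)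
  set X := 1 + n • Z
  have hX : X.PosDef := Matrix.PosDef.one.add_posSemidef (hZ.smul hn.le)
  have hXu : IsUnit X.det := (Matrix.isUnit_iff_isUnit_det _).1 hX.isUnit
  -- Moving the maximizer `p` towards the vertex `i` cannot increase the determinant.
  have h1 : (X⁻¹ * (n • (Y i - Z))).trace ≤ 0 := by
    refine trace_inv_mul_nonpos_of_det_max hX fun t ht => ?_
    have hm := hmax (convex_stdSimplex ℝ ι hp (single_mem_stdSimplex ℝ i) (sub_nonneg.2 ht.2) ht.1
      (sub_add_cancel _ _))
    refine le_of_eq_of_le (congrArg Matrix.det ?_) hm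
    have h2 : ∑ j, ((1 - t) • p + t • (Pi.single i 1 : ι → ℝ)) j • Y j = (1 - t) • Z + t • Y i := by
      simp only [Pi.add_apply, Pi.smul_apply, smul_eq_mul, add_smul, Finset.sum_add_distrib,
        mul_smul, ← Finset.smul_sum]
      congr 2
      simp [Pi.single_apply]
    simp only [h2, X]
    module
  -- The trace of `X⁻¹ (X - 1)` is `d - tr X⁻¹`; this is where the bound `d` of the design comes
  -- from.
  have h2 : (X⁻¹ * (n • Z)).trace ≤ d := by
    have h3 : n • Z = X - 1 := by simp [X]
    rw [h3, mul_sub, Matrix.nonsing_inv_mul _ hXu, mul_one, Matrix.trace_sub, Matrix.trace_one]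
    have := hX.inv.posSemidef.trace_nonneg
    simp only [Fintype.card_fin]
    linarith
  have h3 : n * (X⁻¹ * Y i).trace ≤ d := by
    have : n * (X⁻¹ * Y i).trace = (X⁻¹ * (n • (Y i - Z))).trace + (X⁻¹ * (n • Z)).trace := by
      simp [mul_sub]
    linarith
  rw [le_div_iff₀ hn]
  linarith

end LinearAlgebra

/-! ### Truncation. -/

section Clip

lemma clip_mem {B : ℝ} (hB : 0 ≤ B) (x : ℝ) : clip B x ∈ Set.Icc 0 B :=
  ⟨le_max_left _ _, max_le hB (min_le_left _ _)⟩

lemma abs_clip_sub_clip_le (B x y : ℝ) : |clip B x - clip B y| ≤ |x - y| := by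
  unfold clip
  rw [max_comm 0, max_comm 0]
  refine (abs_max_sub_max_le_abs _ _ _).trans ?_
  refine (abs_min_sub_min_le_max B x B y).trans ?_
  simp

lemma clip_of_mem {B x : ℝ} (h : x ∈ Set.Icc 0 B) : clip B x = x := by
  rw [clip, min_eq_right h.2, max_eq_right h.1]

lemma clip_eq_mul {B : ℝ} (hB : 0 < B) (x : ℝ) : clip B x = B * clip 1 (x / B) := by
  unfold clip
  rw [mul_max_of_nonneg _ _ hB.le, mul_min_of_nonneg _ _ hB.le]
  congr 2
  · simp
  · simp
  · field_simp

lemma measurable_clip (B : ℝ) : Measurable (clip B) := by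
  unfold clip; fun_prop

end Clip

/-! ### Trajectory laws and the Markov property. -/

section Trajectories

variable {S A : Type*} [MeasurableSpace S] [MeasurableSpace A] {H d : ℕ}

lemma integrable_of_abs_le {X : Type*} [MeasurableSpace X] {μ : Measure X} [IsFiniteMeasure μ]
    {f : X → ℝ} (hf : Measurable f) {C : ℝ} (h : ∀ x, |f x| ≤ C) : Integrable f μ :=
  Integrable.of_bound hf.aestronglyMeasurable C (Filter.Eventually.of_forall h)

lemma integrable_of_mem_Icc {X : Type*} [MeasurableSpace X] {μ : Measure X} [IsFiniteMeasure μ]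
    {f : X → ℝ} (hf : Measurable f) {a b : ℝ} (h : ∀ x, f x ∈ Set.Icc a b) : Integrable f μ :=
  Integrable.of_mem_Icc a b hf.aemeasurable (Filter.Eventually.of_forall h)

lemma integral_mem_Icc {X : Type*} [MeasurableSpace X] {μ : Measure X} [IsProbabilityMeasure μ]
    {f : X → ℝ} (hf : Measurable f) {a b : ℝ} (h : ∀ x, f x ∈ Set.Icc a b) :
    ∫ x, f x ∂μ ∈ Set.Icc a b := by
  have hi := integrable_of_mem_Icc (μ := μ) hf h
  constructor
  · simpa using integral_mono (μ := μ) (integrable_const a) hi fun x => (h x).1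
  · simpa using integral_mono (μ := μ) hi (integrable_const b) fun x => (h x).2

/-- Jensen's inequality for the square root. -/
lemma integral_sqrt_le {X : Type*} [MeasurableSpace X] {μ : Measure X} [IsProbabilityMeasure μ]
    {f : X → ℝ} (hf : Measurable f) {C : ℝ} (h : ∀ x, f x ∈ Set.Icc 0 C) :
    ∫ x, √(f x) ∂μ ≤ √(∫ x, f x ∂μ) := by
  have h1 : ∀ x, √(f x) ∈ Set.Icc 0 (√C) := fun x => ⟨Real.sqrt_nonneg _, Real.sqrt_le_sqrt (h x).2⟩
  have hi := integrable_of_mem_Icc (μ := μ) hf.sqrt h1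
  refine Real.le_sqrt_of_sq_le ?_
  have hi2 := integrable_of_mem_Icc (μ := μ) hf h
  set m := ∫ x, √(f x) ∂μ
  -- The tangent line inequality `2m√f - m² ≤ f`, with `m` the mean of `√f`, integrates to `m² ≤ ∫
  -- f`.
  have h2 : ∫ x, (2 * m * √(f x) - m ^ 2) ∂μ ≤ ∫ x, f x ∂μ := by
    refine integral_mono ((hi.const_mul _).sub (integrable_const _)) hi2 fun x => ?_
    have := Real.sq_sqrt (h x).1
    simp only
    nlinarith [sq_nonneg (√(f x) - m)]
  rw [integral_sub (hi.const_mul _) (integrable_const _), integral_const_mul] at h2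
  have h3 : ∫ _x : X, m ^ 2 ∂μ = m ^ 2 := by simp
  rw [h3] at h2
  change 2 * m * m - m ^ 2 ≤ _ at h2
  linarith

instance (M : MDP S A H) (h : Fin H) : IsMarkovKernel (M.P h) := M.markov h

lemma measurable_restrict {X : Type*} [MeasurableSpace X] {n m : ℕ} (hnm : n ≤ m) :
    Measurable fun (x : Fin m → X) (i : Fin n) => x (Fin.castLE hnm i) :=
  measurable_pi_lambda _ fun _ => measurable_pi_apply _

/-- The kernels of later layers are Markov, so they integrate out. Statements about one or two
consecutive layers of a trajectory thus reduce to a prefix ending there. -/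
lemma MDP.map_prefixLaw (M : MDP S A H) (π : Policy S A H) {n m : ℕ} (hnm : n ≤ m) (hm : m ≤ H) :
    (M.prefixLaw π m hm).map (fun x (i : Fin n) => x (Fin.castLE hnm i)) =
      M.prefixLaw π n (hnm.trans hm) := by
  induction m, hnm using Nat.le_induction with
  | base => simp
  | succ m hnm ih =>
    rw [← ih (Nat.le_of_succ_le hm)]
    conv_lhs => rw [MDP.prefixLaw]
    rw [Measure.map_map (measurable_restrict _) (measurable_snoc m)]
    have : (fun (x : Fin (m + 1) → S × A) (i : Fin n) => x (Fin.castLE (Nat.le_succ_of_le hnm) i)) ∘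
        (fun p : (Fin m → S × A) × (S × A) => (Fin.snoc p.1 p.2 : Fin (m + 1) → S × A)) =
        (fun x (i : Fin n) => x (Fin.castLE hnm i)) ∘ Prod.fst := by
      funext p i
      have : Fin.castLE (Nat.le_succ_of_le hnm) i = (Fin.castLE hnm i).castSucc := rfl
      simp only [Function.comp_apply, this, Fin.snoc_castSucc]
    rw [this, ← Measure.map_map (measurable_restrict _) measurable_fst]
    congr 1
    have := π.markov ⟨m, hm⟩
    exact Measure.fst_compProd _ _

lemma MDP.lintegral_trajLaw_restrict (M : MDP S A H) (π : Policy S A H) {n : ℕ} (hn : n ≤ H)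
    {F : (Fin n → S × A) → ENNReal} (hF : Measurable F) :
    ∫⁻ τ, F (fun i => τ (Fin.castLE hn i)) ∂(M.trajLaw π) = ∫⁻ x, F x ∂(M.prefixLaw π n hn) := by
  rw [← M.map_prefixLaw π hn le_rfl, lintegral_map hF (measurable_restrict _)]
  rfl

lemma MDP.lintegral_prefixLaw_succ (M : MDP S A H) (π : Policy S A H) {n : ℕ} (hn : n + 1 ≤ H)
    {F : (Fin (n + 1) → S × A) → ENNReal} (hF : Measurable F) :
    ∫⁻ x, F x ∂(M.prefixLaw π (n + 1) hn) =
      ∫⁻ x, ∫⁻ s, ∫⁻ a, F (Fin.snoc x (s, a)) ∂(π.act ⟨n, hn⟩ (x, s)) ∂(M.stateKernel n hn x)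
        ∂(M.prefixLaw π n (Nat.le_of_succ_le hn)) := by
  have := π.markov ⟨n, hn⟩
  have hF' : Measurable fun p : (Fin n → S × A) × (S × A) =>
    F (Fin.snoc p.1 p.2 : Fin (n + 1) → S × A) := hF.comp (measurable_snoc n)
  rw [MDP.prefixLaw, lintegral_map hF (measurable_snoc n), Measure.lintegral_compProd hF']
  refine lintegral_congr fun x => ?_
  rw [Kernel.lintegral_compProd]
  exact hF'.comp measurable_prodMk_left

/-- The Markov property: the law of `(s_h, a_h, s_{h+1})`. -/
lemma MDP.map_pair_trajLaw (M : MDP S A H) (π : Policy S A H) (i : Fin H) (hi : i.1 + 1 < H) :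
    (M.trajLaw π).map (fun τ => (τ i, (τ ⟨i.1 + 1, hi⟩).1)) =
      ((M.trajLaw π).map (fun τ => τ i)) ⊗ₘ (M.P i) := by
  obtain ⟨n, hn⟩ := i
  refine Measure.ext_of_lintegral _ fun F hF => ?_
  have hm1 : Measurable fun τ : Traj S A H => (τ ⟨n, hn⟩, (τ ⟨n + 1, hi⟩).1) :=
    (measurable_pi_apply _).prodMk (measurable_fst.comp (measurable_pi_apply _))
  rw [lintegral_map hF hm1, Measure.lintegral_compProd hF,
    lintegral_map (Measurable.lintegral_kernel_prod_right' hF) (measurable_pi_apply _)]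
  have e1 := M.lintegral_trajLaw_restrict π (n := n + 2) hi
    (F := fun x => F (x (Fin.last n).castSucc, (x (Fin.last (n + 1))).1))
    (hF.comp ((measurable_pi_apply _).prodMk (measurable_fst.comp (measurable_pi_apply _))))
  have e2 := M.lintegral_trajLaw_restrict π (n := n + 1) hn
    (F := fun x => ∫⁻ s, F (x (Fin.last n), s) ∂(M.P ⟨n, hn⟩ (x (Fin.last n))))
    ((Measurable.lintegral_kernel_prod_right' hF).comp (measurable_pi_apply _))
  refine e1.trans (Eq.trans ?_ e2.symm)
  have := π.markov ⟨n + 1, hi⟩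
  refine (M.lintegral_prefixLaw_succ π (n := n + 1) hi
    (F := fun x => F (x (Fin.last n).castSucc, (x (Fin.last (n + 1))).1))
    (hF.comp ((measurable_pi_apply _).prodMk (measurable_fst.comp (measurable_pi_apply _))))).trans ?_
  refine lintegral_congr fun x => ?_
  simp only [Fin.snoc_castSucc, Fin.snoc_last, lintegral_const, measure_univ, mul_one]
  rfl

lemma MDP.lintegral_next (M : MDP S A H) (π : Policy S A H) (i : Fin H) (hi : i.1 + 1 < H)
    {F : (S × A) × S → ENNReal} (hF : Measurable F) :
    ∫⁻ τ, F (τ i, (τ ⟨i.1 + 1, hi⟩).1) ∂(M.trajLaw π) =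
      ∫⁻ τ, ∫⁻ s, F (τ i, s) ∂(M.P i (τ i)) ∂(M.trajLaw π) := by
  have h := congrArg (fun μ => ∫⁻ x, F x ∂μ) (M.map_pair_trajLaw π i hi)
  have hm1 : Measurable fun τ : Traj S A H => (τ i, (τ ⟨i.1 + 1, hi⟩).1) :=
    (measurable_pi_apply _).prodMk (measurable_fst.comp (measurable_pi_apply _))
  rwa [lintegral_map hF hm1, Measure.lintegral_compProd hF,
    lintegral_map (Measurable.lintegral_kernel_prod_right' hF) (measurable_pi_apply _)] at h

/-- The conditional expectation `(P_h V)(s, a)` of `V(s_{h+1})`. -/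
noncomputable def MDP.transition (M : MDP S A H) (h : Fin H) (V : S → ℝ) (s : S) (a : A) : ℝ :=
  ∫ s', V s' ∂(M.P h (s, a))

lemma MDP.measurable_transition (M : MDP S A H) (h : Fin H) {V : S → ℝ} (hV : Measurable V) :
    Measurable fun p : S × A => M.transition h V p.1 p.2 :=
  (StronglyMeasurable.integral_kernel (κ := M.P h) hV.stronglyMeasurable).measurable

lemma MDP.transition_mem_Icc (M : MDP S A H) (h : Fin H) {V : S → ℝ} (hV : Measurable V) {a b : ℝ}
    (hb : ∀ s, V s ∈ Set.Icc a b) (s : S) (x : A) : M.transition h V s x ∈ Set.Icc a b :=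
  integral_mem_Icc hV hb

lemma MDP.transition_sub (M : MDP S A H) (h : Fin H) {V W : S → ℝ} (hV : Measurable V)
    (hW : Measurable W) {B C : ℝ} (hVB : ∀ s, |V s| ≤ B) (hWC : ∀ s, |W s| ≤ C) (s : S) (a : A) :
    M.transition h (fun s => V s - W s) s a = M.transition h V s a - M.transition h W s a :=
  integral_sub (integrable_of_abs_le hV hVB) (integrable_of_abs_le hW hWC)

lemma MDP.abs_transition_le (M : MDP S A H) (h : Fin H) {V : S → ℝ} {C : ℝ} (hC : ∀ s, |V s| ≤ C)
    (s : S) (a : A) : |M.transition h V s a| ≤ C := by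
  have := norm_integral_le_of_norm_le_const (μ := M.P h (s, a)) (f := V) (C := C)
    (Filter.Eventually.of_forall hC)
  simpa [MDP.transition] using this

lemma MDP.integral_next (M : MDP S A H) (π : Policy S A H) (i : Fin H) (hi : i.1 + 1 < H)
    {V : S → ℝ} (hV : Measurable V) {C : ℝ} (hC : ∀ s, |V s| ≤ C) :
    ∫ τ, V (τ ⟨i.1 + 1, hi⟩).1 ∂(M.trajLaw π) =
      ∫ τ, M.transition i V (τ i).1 (τ i).2 ∂(M.trajLaw π) := by
  have h := congrArg (fun μ => ∫ x, V x.2 ∂μ) (M.map_pair_trajLaw π i hi)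
  have hV' : Measurable fun p : (S × A) × S => V p.2 := hV.comp measurable_snd
  have hm1 : Measurable fun τ : Traj S A H => (τ i, (τ ⟨i.1 + 1, hi⟩).1) :=
    (measurable_pi_apply _).prodMk (measurable_fst.comp (measurable_pi_apply _))
  have hp : IsProbabilityMeasure ((M.trajLaw π).map fun τ => τ i) :=
    Measure.isProbabilityMeasure_map (measurable_pi_apply _).aemeasurable
  rw [integral_map hm1.aemeasurable hV'.aestronglyMeasurable,
    Measure.integral_compProd (integrable_of_abs_le hV' fun x => hC x.2)] at h
  rw [h, integral_map (measurable_pi_apply _).aemeasurable]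
  · rfl
  · exact (M.measurable_transition i hV).aestronglyMeasurable

lemma MDP.lintegral_init (M : MDP S A H) (π : Policy S A H) (hH : 0 < H) {g : S → ENNReal}
    (hg : Measurable g) : ∫⁻ τ, g (τ ⟨0, hH⟩).1 ∂(M.trajLaw π) = g M.init := by
  have e1 := M.lintegral_trajLaw_restrict π (n := 1) hH
    (F := fun x => g (x (Fin.last 0)).1) (hg.comp (measurable_fst.comp (measurable_pi_apply _)))
  refine e1.trans ?_
  have := π.markov ⟨0, hH⟩
  refine (M.lintegral_prefixLaw_succ π (n := 0) hH (F := fun x => g (x (Fin.last 0)).1)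
    (hg.comp (measurable_fst.comp (measurable_pi_apply _)))).trans ?_
  simp only [Fin.snoc_last, lintegral_const, measure_univ, mul_one, MDP.prefixLaw, MDP.stateKernel,
    Kernel.const_apply]
  simp only [lintegral_dirac' _ hg]

lemma MDP.map_init (M : MDP S A H) (π : Policy S A H) (hH : 0 < H) :
    (M.trajLaw π).map (fun τ => (τ ⟨0, hH⟩).1) = Measure.dirac M.init := by
  refine Measure.ext_of_lintegral _ fun g hg => ?_
  have hm : Measurable fun τ : Traj S A H => (τ ⟨0, hH⟩).1 :=
    measurable_fst.comp (measurable_pi_apply _)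
  rw [lintegral_map hg hm, lintegral_dirac' _ hg]
  exact M.lintegral_init π hH hg

lemma measurable_prod_rule (ρ : DetRule S A) : Measurable fun s => (s, ρ.1 s) :=
  measurable_id.prodMk ρ.2

/-- Under a deterministic policy, `a_h = π_h(s_h)`. -/
lemma MDP.map_trajLaw_det (M : MDP S A H) (π : DetPolicy S A H) (h : Fin H) :
    (M.trajLaw (DetPolicy.toPolicy π)).map (fun τ => τ h) =
      ((M.trajLaw (DetPolicy.toPolicy π)).map (fun τ => (τ h).1)).map
        (fun s => (s, (π h).1 s)) := by
  obtain ⟨n, hn⟩ := h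
  have hm : Measurable fun x : Traj S A H => (x ⟨n, hn⟩).1 :=
    measurable_fst.comp (measurable_pi_apply _)
  refine Measure.ext_of_lintegral _ fun F hF => ?_
  have hFm : Measurable fun s => F (s, (π ⟨n, hn⟩).1 s) := hF.comp (measurable_prod_rule _)
  rw [lintegral_map hF (measurable_pi_apply _), lintegral_map hF (measurable_prod_rule _),
    lintegral_map hFm hm]
  have e1 := M.lintegral_trajLaw_restrict (DetPolicy.toPolicy π) (n := n + 1) hn
    (F := fun x => F (x (Fin.last n))) (hF.comp (measurable_pi_apply _))
  have e2 := M.lintegral_trajLaw_restrict (DetPolicy.toPolicy π) (n := n + 1) hn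
    (F := fun x => F ((x (Fin.last n)).1, (π ⟨n, hn⟩).1 (x (Fin.last n)).1))
    (hFm.comp (measurable_fst.comp (measurable_pi_apply _)))
  refine e1.trans (Eq.trans ?_ e2.symm)
  have := (DetPolicy.toPolicy π).markov ⟨n, hn⟩
  refine (M.lintegral_prefixLaw_succ _ hn (F := fun x => F (x (Fin.last n)))
    (hF.comp (measurable_pi_apply _))).trans (Eq.trans ?_ (M.lintegral_prefixLaw_succ _ hn
      (F := fun x => F ((x (Fin.last n)).1, (π ⟨n, hn⟩).1 (x (Fin.last n)).1))
      (hFm.comp (measurable_fst.comp (measurable_pi_apply _)))).symm)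
  refine lintegral_congr fun x => lintegral_congr fun s => ?_
  simp only [Fin.snoc_last, lintegral_const, measure_univ, mul_one, DetPolicy.toPolicy]
  have hFs : Measurable fun a => F (s, a) := hF.comp measurable_prodMk_left
  rw [Kernel.lintegral_deterministic' _ hFs]

/-- The law of `s_n` under a deterministic policy (also for `n = H`). -/
noncomputable def MDP.detStateLaw (M : MDP S A H) (π : DetPolicy S A H) :
    (n : ℕ) → n ≤ H → Measure S
  | 0, _ => Measure.dirac M.init
  | n + 1, hn => ((M.detStateLaw π n (Nat.le_of_succ_le hn)) ⊗ₘ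
      ((M.P ⟨n, hn⟩).comap (fun s => (s, (π ⟨n, hn⟩).1 s)) (measurable_prod_rule _))).snd

instance (M : MDP S A H) (π : DetPolicy S A H) (n : ℕ) (hn : n ≤ H) :
    IsProbabilityMeasure (M.detStateLaw π n hn) := by
  induction n with
  | zero => unfold MDP.detStateLaw; infer_instance
  | succ n ih =>
    have := ih (Nat.le_of_succ_le hn)
    unfold MDP.detStateLaw
    infer_instance

lemma MDP.integral_detStateLaw_succ (M : MDP S A H) (π : DetPolicy S A H) {n : ℕ} (hn : n + 1 ≤ H)
    {V : S → ℝ} (hV : Measurable V) {C : ℝ} (hC : ∀ s, |V s| ≤ C) :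
    ∫ s, V s ∂(M.detStateLaw π (n + 1) hn) =
      ∫ s, M.transition ⟨n, hn⟩ V s ((π ⟨n, hn⟩).1 s)
        ∂(M.detStateLaw π n (Nat.le_of_succ_le hn)) := by
  have hV' : Measurable fun p : S × S => V p.2 := hV.comp measurable_snd
  rw [MDP.detStateLaw, Measure.snd, integral_map measurable_snd.aemeasurable
    hV.aestronglyMeasurable, Measure.integral_compProd (integrable_of_abs_le hV' fun x => hC x.2)]
  rfl

lemma MDP.lintegral_detStateLaw_succ (M : MDP S A H) (π : DetPolicy S A H) {n : ℕ} (hn : n + 1 ≤ H)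
    {V : S → ENNReal} (hV : Measurable V) :
    ∫⁻ s, V s ∂(M.detStateLaw π (n + 1) hn) =
      ∫⁻ s, ∫⁻ s', V s' ∂(M.P ⟨n, hn⟩ (s, (π ⟨n, hn⟩).1 s))
        ∂(M.detStateLaw π n (Nat.le_of_succ_le hn)) := by
  have hV' : Measurable fun p : S × S => V p.2 := hV.comp measurable_snd
  rw [MDP.detStateLaw, Measure.snd, lintegral_map hV measurable_snd,
    Measure.lintegral_compProd hV']
  rfl

/-- A deterministic Markov policy makes the states a Markov chain, so the history can be dropped.
Expectations along trajectories then match the layerwise recursion of the estimators. -/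
lemma MDP.map_state_trajLaw_det (M : MDP S A H) (π : DetPolicy S A H) (n : ℕ) (hn : n < H) :
    (M.trajLaw (DetPolicy.toPolicy π)).map (fun τ => (τ ⟨n, hn⟩).1) =
      M.detStateLaw π n hn.le := by
  induction n with
  | zero => exact M.map_init _ hn
  | succ n ih =>
    have ih := ih (Nat.lt_of_succ_lt hn)
    have hm : ∀ h : Fin H, Measurable fun x : Traj S A H => (x h).1 :=
      fun h => measurable_fst.comp (measurable_pi_apply _)
    refine Measure.ext_of_lintegral _ fun V hV => ?_
    have hF : Measurable fun p : S × A =>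
        ∫⁻ s', V s' ∂(M.P ⟨n, Nat.lt_of_succ_lt hn⟩ p) := hV.lintegral_kernel
    have hF' : Measurable fun s : S => ∫⁻ s', V s'
        ∂(M.P ⟨n, Nat.lt_of_succ_lt hn⟩ (s, (π ⟨n, Nat.lt_of_succ_lt hn⟩).1 s)) :=
      hF.comp (measurable_prod_rule _)
    rw [M.lintegral_detStateLaw_succ π (Nat.lt_of_succ_lt hn) hV, ← ih, lintegral_map hV (hm _),
      lintegral_map hF' (hm _)]
    have e1 := M.lintegral_next (DetPolicy.toPolicy π) ⟨n, Nat.lt_of_succ_lt hn⟩ hn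
      (F := fun p => V p.2) (hV.comp measurable_snd)
    refine e1.trans ?_
    have e2 := congrArg (fun μ => ∫⁻ p, ∫⁻ s', V s' ∂(M.P ⟨n, Nat.lt_of_succ_lt hn⟩ p) ∂μ)
      (M.map_trajLaw_det π ⟨n, Nat.lt_of_succ_lt hn⟩)
    rwa [lintegral_map hF (measurable_pi_apply _), lintegral_map hF (measurable_prod_rule _),
      lintegral_map hF' (hm _)] at e2

lemma MDP.integral_trajLaw_det (M : MDP S A H) (π : DetPolicy S A H) (h : Fin H)
    {F : S → A → ℝ} (hF : Measurable fun p : S × A => F p.1 p.2) :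
    ∫ τ, F (τ h).1 (τ h).2 ∂(M.trajLaw (DetPolicy.toPolicy π)) =
      ∫ s, F s ((π h).1 s) ∂(M.detStateLaw π h h.isLt.le) := by
  have e := congrArg (fun μ => ∫ p : S × A, F p.1 p.2 ∂μ) (M.map_trajLaw_det π h)
  rwa [integral_map (measurable_pi_apply _).aemeasurable hF.aestronglyMeasurable,
    M.map_state_trajLaw_det π h h.isLt,
    integral_map (measurable_prod_rule _).aemeasurable hF.aestronglyMeasurable] at e

lemma MDP.integral_init (M : MDP S A H) (π : Policy S A H) (hH : 0 < H) {g : S → ℝ}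
    (hg : Measurable g) : ∫ τ, g (τ ⟨0, hH⟩).1 ∂(M.trajLaw π) = g M.init := by
  have e := congrArg (fun μ => ∫ s, g s ∂μ) (M.map_init π hH)
  have hm : Measurable fun τ : Traj S A H => (τ ⟨0, hH⟩).1 :=
    measurable_fst.comp (measurable_pi_apply _)
  rwa [integral_map hm.aemeasurable
    hg.aestronglyMeasurable, integral_dirac' _ _ hg.stronglyMeasurable] at e

end Trajectories

/-! ### Linearity of transitions and backward recursion for values. -/

section LinearMDP

variable {S A : Type*} [MeasurableSpace S] [MeasurableSpace A] {H d : ℕ}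

lemma FeatureMap.measurable_coord (φ : FeatureMap S A d) (i : Fin d) :
    Measurable fun p : S × A => φ p.1 p.2 i :=
  (measurable_pi_apply i).comp ((WithLp.measurable_ofLp 2 (Fin d → ℝ)).comp φ.measurable_toFun)

lemma FeatureMap.measurable_inner (φ : FeatureMap S A d) (x : Vec d) :
    Measurable fun p : S × A => inner ℝ (φ p.1 p.2) x :=
  φ.measurable_toFun.inner measurable_const

lemma FeatureMap.abs_inner_le (φ : FeatureMap S A d) (x : Vec d) (s : S) (a : A) :
    |inner ℝ (φ s a) x| ≤ ‖x‖ := by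
  refine (abs_real_inner_le_norm _ _).trans ?_
  exact mul_le_of_le_one_left (norm_nonneg _) (φ.norm_le_one s a)

lemma FeatureMap.abs_coord_le (φ : FeatureMap S A d) (s : S) (a : A) (i : Fin d) :
    |φ s a i| ≤ 1 :=
  (abs_coord_le_norm _ _).trans (φ.norm_le_one s a)

lemma FeatureMap.measurable_quad (φ : FeatureMap S A d) (X : Matrix (Fin d) (Fin d) ℝ) :
    Measurable fun p : S × A => quad X (φ p.1 p.2) := by
  simp only [quad_eq_sum]
  exact Finset.measurable_sum _ fun i _ => Finset.measurable_sum _ fun j _ =>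
    ((φ.measurable_coord i).mul (φ.measurable_coord j)).const_mul _

lemma sum_threshold_indicator {m : ℕ} {y : ℝ} (hy : y ∈ Set.Icc (0 : ℝ) m) :
    |y - ∑ j ∈ Finset.range m, if ((j + 1 : ℕ) : ℝ) ≤ y then (1 : ℝ) else 0| ≤ 1 := by
  have h1 : (Finset.range m).filter (fun j => ((j + 1 : ℕ) : ℝ) ≤ y) = Finset.range ⌊y⌋₊ := by
    ext j
    simp only [Finset.mem_filter, Finset.mem_range]
    rw [← Nat.le_floor_iff hy.1]
    have : ⌊y⌋₊ ≤ m := Nat.floor_le_of_le hy.2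
    omega
  rw [← Finset.sum_filter, h1]
  simp only [Finset.sum_const, Finset.card_range, nsmul_eq_mul, mul_one]
  rw [abs_le]
  constructor
  · linarith [Nat.floor_le hy.1]
  · linarith [Nat.lt_floor_add_one y]

/-- Only `‖μ(B)‖ ≤ √d` on sets is available, so `V` is approximated by averages of indicators of its
superlevel sets. The averages of the vectors `μ(E)` keep norm at most `√d`, with no loss from a
variation norm. Compactness of the ball provides a limit weight valid at all `(s, a)`
simultaneously. -/
lemma MDP.IsLinear.exists_weight_unit {M : MDP S A H} {φ : FeatureMap S A d} (hM : M.IsLinear φ)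
    (h : Fin H) {V : S → ℝ} (hV : Measurable V) (hV1 : ∀ s, V s ∈ Set.Icc (0 : ℝ) 1) :
    ∃ w : Vec d, ‖w‖ ≤ √(d : ℝ) ∧ ∀ s a, M.transition h V s a = inner ℝ (φ s a) w := by
  obtain ⟨μ, hμ, hn⟩ := hM h
  let E : ℕ → ℕ → Set S := fun n j => {s | ((j + 1 : ℕ) : ℝ) ≤ V s * (n + 1 : ℕ)}
  have hE : ∀ n j, MeasurableSet (E n j) := fun n j =>
    measurableSet_le measurable_const (hV.mul_const _)
  let w : ℕ → Vec d := fun n => ((n + 1 : ℕ) : ℝ)⁻¹ • ∑ j ∈ Finset.range (n + 1), μ (E n j)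
  have hw : ∀ n, w n ∈ Metric.closedBall (0 : Vec d) √(d : ℝ) := by
    intro n
    rw [mem_closedBall_zero_iff, norm_smul, Real.norm_of_nonneg (by positivity)]
    have : ‖∑ j ∈ Finset.range (n + 1), μ (E n j)‖ ≤ ((n + 1 : ℕ) : ℝ) * √(d : ℝ) := by
      refine (norm_sum_le _ _).trans ((Finset.sum_le_sum fun j _ => hn _ (hE n j)).trans ?_)
      simp
    rw [inv_mul_le_iff₀ (by positivity)]
    exact this
  have hclose : ∀ n s a, |M.transition h V s a - inner ℝ (φ s a) (w n)| ≤ ((n + 1 : ℕ) : ℝ)⁻¹ := by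
    intro n s a
    let W : S → ℝ := fun s' => ((n + 1 : ℕ) : ℝ)⁻¹ *
      ∑ j ∈ Finset.range (n + 1), (E n j).indicator (fun _ => (1 : ℝ)) s'
    have hWi : ∀ j, Integrable ((E n j).indicator (fun _ => (1 : ℝ))) (M.P h (s, a)) := fun j =>
      (integrable_const 1).indicator (hE n j)
    have hW : Integrable W (M.P h (s, a)) :=
      (integrable_finsetSum _ fun j _ => hWi j).const_mul _
    have hWint : ∫ s', W s' ∂(M.P h (s, a)) = inner ℝ (φ s a) (w n) := by
      simp only [W, w]
      rw [integral_const_mul, integral_finsetSum _ fun j _ => hWi j, inner_smul_right, inner_sum]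
      congr 1
      refine Finset.sum_congr rfl fun j _ => ?_
      rw [integral_indicator_const _ (hE n j), hμ s a _ (hE n j)]
      simp
    have hd : ∀ s', |V s' - W s'| ≤ ((n + 1 : ℕ) : ℝ)⁻¹ := by
      intro s'
      have hy : V s' * (n + 1 : ℕ) ∈ Set.Icc (0 : ℝ) (n + 1 : ℕ) :=
        ⟨mul_nonneg (hV1 s').1 (by positivity), mul_le_of_le_one_left (by positivity) (hV1 s').2⟩
      have h1 := sum_threshold_indicator hy
      have h2 : W s' = ((n + 1 : ℕ) : ℝ)⁻¹ * ∑ j ∈ Finset.range (n + 1),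
          if ((j + 1 : ℕ) : ℝ) ≤ V s' * (n + 1 : ℕ) then (1 : ℝ) else 0 := by
        simp only [W, E, Set.indicator_apply, Set.mem_ofPred_eq]
      rw [h2]
      have h3 : V s' = ((n + 1 : ℕ) : ℝ)⁻¹ * (V s' * (n + 1 : ℕ)) := by
        field_simp
      nth_rewrite 1 [h3]
      rw [← mul_sub, abs_mul, abs_of_nonneg (by positivity)]
      exact mul_le_of_le_one_right (by positivity) h1
    rw [← hWint, MDP.transition, ← integral_sub (integrable_of_mem_Icc hV hV1) hW]
    have := norm_integral_le_of_norm_le_const (μ := M.P h (s, a)) (f := fun s' => V s' - W s')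
      (Filter.Eventually.of_forall hd)
    simpa using this
  obtain ⟨w₀, hw₀, ψ, hψ, hlim⟩ := (isCompact_closedBall (0 : Vec d) √(d : ℝ)).tendsto_subseq hw
  refine ⟨w₀, by simpa using hw₀, fun s a => ?_⟩
  have l1 : Filter.Tendsto (fun n => inner ℝ (φ s a) (w (ψ n))) Filter.atTop
      (nhds (inner ℝ (φ s a) w₀)) := (Filter.Tendsto.inner tendsto_const_nhds hlim)
  have l2 : Filter.Tendsto (fun n => inner ℝ (φ s a) (w n)) Filter.atTop
      (nhds (M.transition h V s a)) := by
    rw [tendsto_iff_dist_tendsto_zero]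
    have l3 : Filter.Tendsto (fun n : ℕ => ((n + 1 : ℕ) : ℝ)⁻¹) Filter.atTop (nhds 0) :=
      (tendsto_inv_atTop_nhds_zero_nat (𝕜 := ℝ)).comp (Filter.tendsto_add_atTop_nat 1)
    refine squeeze_zero (fun _ => dist_nonneg) (fun n => ?_) l3
    rw [dist_comm, Real.dist_eq]
    exact hclose n s a
  exact tendsto_nhds_unique (l2.comp hψ.tendsto_atTop) l1

/-- In a linear MDP, the conditional expectation of the next value is linear in the features. -/
lemma MDP.IsLinear.exists_weight {M : MDP S A H} {φ : FeatureMap S A d} (hM : M.IsLinear φ)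
    (h : Fin H) {V : S → ℝ} (hV : Measurable V) {B : ℝ} (hB : 0 ≤ B)
    (hVB : ∀ s, V s ∈ Set.Icc 0 B) :
    ∃ w : Vec d, ‖w‖ ≤ B * √(d : ℝ) ∧ ∀ s a, M.transition h V s a = inner ℝ (φ s a) w := by
  rcases hB.eq_or_lt with rfl | hB
  · refine ⟨0, by simp, fun s a => ?_⟩
    have : V = fun _ => 0 := funext fun s => le_antisymm (hVB s).2 (hVB s).1
    simp [MDP.transition, this]
  obtain ⟨w, hw, hwt⟩ := hM.exists_weight_unit h (V := fun s => V s / B) (hV.div_const B) fun s =>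
    ⟨div_nonneg (hVB s).1 hB.le, div_le_one_of_le₀ (hVB s).2 hB.le⟩
  refine ⟨B • w, ?_, fun s a => ?_⟩
  · rw [norm_smul, Real.norm_of_nonneg hB.le]
    gcongr
  · rw [inner_smul_right, ← hwt s a]
    simp only [MDP.transition]
    rw [integral_div]
    field_simp

lemma FeasibleReward.measurable {φ : FeatureMap S A d} {r : Fin H → S → A → ℝ}
    (hr : FeasibleReward φ r) (h : Fin H) : Measurable fun p : S × A => r h p.1 p.2 := by
  obtain ⟨θ, -, hθ⟩ := hr h
  simp only [fun s a => (hθ s a).1]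
  exact φ.measurable_inner θ

lemma FeasibleReward.mem_Icc {φ : FeatureMap S A d} {r : Fin H → S → A → ℝ}
    (hr : FeasibleReward φ r) (h : Fin H) (s : S) (a : A) : r h s a ∈ Set.Icc (0 : ℝ) 1 := by
  obtain ⟨θ, -, hθ⟩ := hr h
  exact (hθ s a).2

/-- With zero rewards, results about values specialize to the expectation of a terminal function at
one layer, which is what `estimateER` estimates. -/
lemma feasibleReward_zero (φ : FeatureMap S A d) :
    FeasibleReward φ (fun (_ : Fin H) _ _ => (0 : ℝ)) :=
  fun _ => ⟨0, by simp, fun _ _ => by simp⟩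

/-- Backward recursion for the true value of a deterministic policy. -/
noncomputable def MDP.detValue (M : MDP S A H) (π : DetPolicy S A H) (r : Fin H → S → A → ℝ) :
    (n : ℕ) → n ≤ H → (S → ℝ) → S → ℝ
  | 0, _, V => V
  | n + 1, hn, V => M.detValue π r n (Nat.le_of_succ_le hn) fun s =>
      r ⟨n, hn⟩ s ((π ⟨n, hn⟩).1 s) + M.transition ⟨n, hn⟩ V s ((π ⟨n, hn⟩).1 s)

lemma MDP.measurable_detBackup (M : MDP S A H) {φ : FeatureMap S A d} {r : Fin H → S → A → ℝ}
    (hr : FeasibleReward φ r) (h : Fin H) (ρ : DetRule S A) {V : S → ℝ} (hV : Measurable V) :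
    Measurable fun s => r h s (ρ.1 s) + M.transition h V s (ρ.1 s) :=
  ((hr.measurable h).comp (measurable_prod_rule ρ)).add
    ((M.measurable_transition h hV).comp (measurable_prod_rule ρ))

lemma MDP.detBackup_mem (M : MDP S A H) {φ : FeatureMap S A d} {r : Fin H → S → A → ℝ}
    (hr : FeasibleReward φ r) (h : Fin H) (ρ : DetRule S A) {V : S → ℝ} (hV : Measurable V)
    {b : ℝ} (hb : ∀ s, V s ∈ Set.Icc 0 b) (s : S) :
    r h s (ρ.1 s) + M.transition h V s (ρ.1 s) ∈ Set.Icc 0 (b + 1) := by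
  have h1 := hr.mem_Icc h s (ρ.1 s)
  have h2 := M.transition_mem_Icc h hV hb s (ρ.1 s)
  exact ⟨add_nonneg h1.1 h2.1, by linarith [h1.2, h2.2]⟩

/-- The backward recursion unrolls into a forward sum. It is used with `n = H` and `V = 0` for full
values, and with zero rewards and `n = h` for a reward at one layer. -/
lemma MDP.detValue_eq (M : MDP S A H) (π : DetPolicy S A H) {φ : FeatureMap S A d}
    {r : Fin H → S → A → ℝ} (hr : FeasibleReward φ r) (n : ℕ) (hn : n ≤ H) {V : S → ℝ}
    (hV : Measurable V) {b : ℝ} (hb : ∀ s, V s ∈ Set.Icc 0 b) :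
    M.detValue π r n hn V M.init =
      ∑ i : Fin n, ∫ s, r (Fin.castLE hn i) s ((π (Fin.castLE hn i)).1 s)
          ∂(M.detStateLaw π i (i.isLt.le.trans hn)) +
        ∫ s, V s ∂(M.detStateLaw π n hn) := by
  induction n generalizing V b with
  | zero => simp [MDP.detValue, MDP.detStateLaw, integral_dirac' _ _ hV.stronglyMeasurable]
  | succ n ih =>
    rw [MDP.detValue, ih (Nat.le_of_succ_le hn) (M.measurable_detBackup hr _ _ hV)
      (M.detBackup_mem hr _ _ hV hb), Fin.sum_univ_castSucc, add_assoc,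
      M.integral_detStateLaw_succ π hn hV (C := b) fun s =>
        abs_le.2 ⟨by linarith [(hb s).1, (hb s).2], (hb s).2⟩]
    congr 1
    rw [integral_add]
    · rfl
    · exact integrable_of_mem_Icc ((hr.measurable _).comp (measurable_prod_rule _))
        fun s => hr.mem_Icc _ _ _
    · exact integrable_of_mem_Icc ((M.measurable_transition _ hV).comp (measurable_prod_rule _))
        fun s => M.transition_mem_Icc _ hV hb _ _

lemma MDP.value_eq_sum (M : MDP S A H) (π : Policy S A H) {φ : FeatureMap S A d}
    {r : Fin H → S → A → ℝ} (hr : FeasibleReward φ r) :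
    M.value π r = ∑ h, ∫ τ, r h (τ h).1 (τ h).2 ∂(M.trajLaw π) := by
  rw [MDP.value, integral_finsetSum]
  exact fun h _ => integrable_of_mem_Icc ((hr.measurable h).comp (measurable_pi_apply h))
    fun τ => hr.mem_Icc h _ _

lemma MDP.value_eq_detValue (M : MDP S A H) (π : DetPolicy S A H) {φ : FeatureMap S A d}
    {r : Fin H → S → A → ℝ} (hr : FeasibleReward φ r) :
    M.value (DetPolicy.toPolicy π) r = M.detValue π r H le_rfl (fun _ => 0) M.init := by
  rw [M.value_eq_sum _ hr, M.detValue_eq π hr H le_rfl measurable_const (b := 0) (by simp)]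
  simp only [integral_zero, add_zero]
  exact Finset.sum_congr rfl fun h _ => M.integral_trajLaw_det π h (hr.measurable h)

/-- Backward induction: against a terminal value function at layer `n`, the greedy rules of the
cover are nearly optimal. -/
lemma MDP.IsLinear.exists_greedy {M : MDP S A H} {φ : FeatureMap S A d} (hM : M.IsLinear φ)
    {ε : ℝ} (Δ : Discretization φ H ε) {r : Fin H → S → A → ℝ} (hr : FeasibleReward φ r)
    (n : ℕ) (hn : n < H) {V : S → ℝ} (hV : Measurable V) {b : ℝ} (hb0 : 0 ≤ b)
    (hb : ∀ s, V s ∈ Set.Icc 0 b) (hbn : b + n ≤ H) (π₀ : DetPolicy S A H) :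
    ∃ π : DetPolicy S A H, (∀ i : Fin H, n ≤ i.1 → π i = π₀ i) ∧
      (∀ i : Fin H, i.1 < n → ∃ w ∈ Δ.linCover, π i = Δ.linRule i w) ∧
      ∀ π' : Policy S A H,
        ∑ i : Fin n, ∫ τ, r (Fin.castLE hn.le i) (τ (Fin.castLE hn.le i)).1
            (τ (Fin.castLE hn.le i)).2 ∂(M.trajLaw π') +
          ∫ τ, V (τ ⟨n, hn⟩).1 ∂(M.trajLaw π') ≤
        M.detValue π r n hn.le V M.init + n * (ε / H) := by
  induction n generalizing V b π₀ with
  | zero =>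
    refine ⟨π₀, fun _ _ => rfl, fun i hi => absurd hi (Nat.not_lt_zero _), fun π' => ?_⟩
    simp [MDP.detValue, M.integral_init π' hn hV]
  | succ n ih =>
    have hn' : n < H := Nat.lt_of_succ_lt hn
    have hH : (0 : ℝ) < H := by exact_mod_cast (Nat.zero_le n).trans_lt hn'
    obtain ⟨w, hw, hwt⟩ := hM.exists_weight ⟨n, hn'⟩ hV hb0 hb
    obtain ⟨θ, hθ, hθr⟩ := hr ⟨n, hn'⟩
    have hx : ‖w + θ‖ ≤ 2 * H * √(d : ℝ) := by
      have h1 : b + 1 ≤ 2 * H := by push_cast at hbn; linarith [(Nat.cast_nonneg n : (0 : ℝ) ≤ n)]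
      calc ‖w + θ‖ ≤ b * √(d : ℝ) + √(d : ℝ) := (norm_add_le _ _).trans (add_le_add hw hθ)
        _ = (b + 1) * √(d : ℝ) := by ring
        _ ≤ _ := by gcongr
    obtain ⟨w', hw', hww⟩ := Δ.linCover_covers _ hx
    set ρ := Δ.linRule ⟨n, hn'⟩ w'
    have hQ : ∀ s a, r ⟨n, hn'⟩ s a + M.transition ⟨n, hn'⟩ V s a = inner ℝ (φ s a) (w + θ) := by
      intro s a
      rw [inner_add_right, (hθr s a).1, hwt, add_comm]
    -- The cover error `ε/(2H)` is paid twice, at `a` and at the greedy action.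
    have hgreedy : ∀ s a, r ⟨n, hn'⟩ s a + M.transition ⟨n, hn'⟩ V s a ≤
        r ⟨n, hn'⟩ s (ρ.1 s) + M.transition ⟨n, hn'⟩ V s (ρ.1 s) + ε / H := by
      intro s a
      rw [hQ, hQ]
      have g1 := Δ.linRule_greedy ⟨n, hn'⟩ w' hw' s a
      simp only at g1
      have g2 := φ.abs_inner_le (w + θ - w') s a
      have g3 := φ.abs_inner_le (w + θ - w') s (ρ.1 s)
      rw [inner_sub_right] at g2 g3
      have g4 := (abs_le.1 (g2.trans hww)).2
      have g5 := (abs_le.1 (g3.trans hww)).1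
      have g6 : ε / H = ε / (2 * H) + ε / (2 * H) := by field_simp; norm_num
      have g7 : inner ℝ (φ s a) w' ≤ inner ℝ (φ s (ρ.1 s)) w' := g1
      linarith
    -- The induction hypothesis is applied to the backed-up function with terminal layer `n`. Fixing
    -- `ρ` at layer `n` in `π₀` beforehand ensures that the policy obtained still uses it. The
    -- competitor `π'` may depend on the history, because the greedy inequality holds pointwise in
    -- `(s, a)`.
    set V' : S → ℝ := fun s => r ⟨n, hn'⟩ s (ρ.1 s) + M.transition ⟨n, hn'⟩ V s (ρ.1 s)
    have hV' : Measurable V' := M.measurable_detBackup hr _ ρ hV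
    have hb' : ∀ s, V' s ∈ Set.Icc 0 (b + 1) := M.detBackup_mem hr _ ρ hV hb
    obtain ⟨π, hπ1, hπ2, hπ3⟩ := ih hn' hV' (by linarith) hb' (by push_cast at hbn; linarith)
      (Function.update π₀ ⟨n, hn'⟩ ρ)
    have hπn : π ⟨n, hn'⟩ = ρ := by rw [hπ1 ⟨n, hn'⟩ le_rfl, Function.update_self]
    refine ⟨π, fun i hi => ?_, fun i hi => ?_, fun π' => ?_⟩
    · rw [hπ1 i (by omega), Function.update_of_ne]
      rintro rfl
      simp at hi
    · rcases Nat.lt_succ_iff_lt_or_eq.1 hi with h | h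
      · exact hπ2 i h
      · obtain rfl : i = ⟨n, hn'⟩ := Fin.ext h
        exact ⟨w', hw', hπn⟩
    · have h3 := hπ3 π'
      have h4 : M.detValue π r (n + 1) hn.le V M.init = M.detValue π r n hn'.le V' M.init := by
        rw [MDP.detValue]
        simp only [hπn]
        rfl
      rw [h4, Fin.sum_univ_castSucc, M.integral_next π' ⟨n, hn'⟩ hn hV (C := b) fun s =>
        abs_le.2 ⟨by linarith [(hb s).1, (hb s).2], (hb s).2⟩]
      have i1 : Integrable (fun τ : Traj S A H => r ⟨n, hn'⟩ (τ ⟨n, hn'⟩).1 (τ ⟨n, hn'⟩).2)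
          (M.trajLaw π') :=
        integrable_of_mem_Icc ((hr.measurable _).comp (measurable_pi_apply _))
          fun τ => hr.mem_Icc _ _ _
      have i2 : Integrable (fun τ : Traj S A H =>
          M.transition ⟨n, hn'⟩ V (τ ⟨n, hn'⟩).1 (τ ⟨n, hn'⟩).2) (M.trajLaw π') :=
        integrable_of_mem_Icc ((M.measurable_transition _ hV).comp (measurable_pi_apply _))
          fun τ => M.transition_mem_Icc _ hV hb _ _
      have i3 : Integrable (fun τ : Traj S A H => V' (τ ⟨n, hn'⟩).1) (M.trajLaw π') :=
        integrable_of_mem_Icc (hV'.comp (measurable_fst.comp (measurable_pi_apply _)))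
          fun τ => hb' _
      have h5 : ∫ τ, r ⟨n, hn'⟩ (τ ⟨n, hn'⟩).1 (τ ⟨n, hn'⟩).2 ∂(M.trajLaw π') +
          ∫ τ, M.transition ⟨n, hn'⟩ V (τ ⟨n, hn'⟩).1 (τ ⟨n, hn'⟩).2 ∂(M.trajLaw π') ≤
          ∫ τ, V' (τ ⟨n, hn'⟩).1 ∂(M.trajLaw π') + ε / H := by
        rw [← integral_add i1 i2]
        have : ∫ τ, V' (τ ⟨n, hn'⟩).1 ∂(M.trajLaw π') + ε / H =
            ∫ τ, (V' (τ ⟨n, hn'⟩).1 + ε / H) ∂(M.trajLaw π') := by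
          rw [integral_add i3 (integrable_const _)]; simp
        rw [this]
        exact integral_mono (i1.add i2) (i3.add (integrable_const _)) fun τ => hgreedy _ _
      have h6 : ∀ i : Fin n, Fin.castLE hn.le i.castSucc = Fin.castLE hn'.le i := fun i => rfl
      have h7 : Fin.castLE hn.le (Fin.last n) = ⟨n, hn'⟩ := rfl
      simp only [h6, h7]
      push_cast
      linarith

end LinearMDP

/-! ### Near-optimal policies in the finite policy sets. -/

section PolicyApproximation

variable {S A : Type*} [MeasurableSpace S] [MeasurableSpace A] {H d : ℕ}
  {φ : FeatureMap S A d} {ε : ℝ}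

lemma Discretization.linCover_nonempty (Δ : Discretization φ H ε) : Δ.linCover.Nonempty := by
  obtain ⟨w, hw, -⟩ := Δ.linCover_covers 0 (by simp; positivity)
  exact ⟨w, hw⟩

lemma Discretization.mem_evalSet (Δ : Discretization φ H ε) {π : DetPolicy S A H} :
    π ∈ Δ.evalSet ↔ ∀ h, ∃ w ∈ Δ.linCover, Δ.linRule h w = π h := by
  simp [Discretization.evalSet, Fintype.mem_piFinset]

lemma Discretization.mem_expSet (Δ : Discretization φ H ε) {π : DetPolicy S A H} :
    π ∈ Δ.expSet ↔ ∀ h, (∃ f ∈ Δ.rewCover, Δ.rewRule h f = π h) ∨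
      ∃ w ∈ Δ.linCover, Δ.linRule h w = π h := by
  simp [Discretization.expSet, Fintype.mem_piFinset]

lemma Discretization.evalSet_subset_expSet (Δ : Discretization φ H ε) :
    Δ.evalSet ⊆ Δ.expSet := fun π hπ => by
  rw [Δ.mem_evalSet] at hπ
  rw [Δ.mem_expSet]
  exact fun h => Or.inr (hπ h)

lemma Discretization.evalSet_nonempty (Δ : Discretization φ H ε) : Δ.evalSet.Nonempty := by
  obtain ⟨w, hw⟩ := Δ.linCover_nonempty
  exact ⟨fun h => Δ.linRule h w, Δ.mem_evalSet.2 fun h => ⟨w, hw, rfl⟩⟩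

lemma measurable_ellipticReward (X : Matrix (Fin d) (Fin d) ℝ) :
    Measurable fun p : S × A => ellipticReward φ X p.1 p.2 :=
  (φ.measurable_quad _).sqrt

lemma quad_one_add_inv_mem {X : Matrix (Fin d) (Fin d) ℝ} (hX : X.PosSemidef) (s : S) (a : A) :
    quad (1 + X)⁻¹ (φ s a) ∈ Set.Icc (0 : ℝ) 1 := by
  have hp : (1 + X).PosDef := Matrix.PosDef.one.add_posSemidef hX
  refine ⟨quad_nonneg hp.inv.posSemidef _, ?_⟩
  have h1 := quad_inv_le_norm_sq hp one_pos
    (fun x => by rw [quad_add, quad_one]; linarith [quad_nonneg hX x]) (φ s a)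
  have h2 := φ.norm_le_one s a
  have h3 := norm_nonneg (φ s a)
  simp only [inv_one, one_mul] at h1
  nlinarith

lemma ellipticReward_mem {X : Matrix (Fin d) (Fin d) ℝ} (hX : X.PosSemidef) (s : S) (a : A) :
    ellipticReward φ X s a ∈ Set.Icc (0 : ℝ) 1 :=
  ⟨Real.sqrt_nonneg _, Real.sqrt_le_one.2 (quad_one_add_inv_mem hX s a).2⟩

/-- The policies to evaluate contain a nearly optimal policy for every feasible reward. -/
lemma MDP.IsLinear.exists_evalSet_near_optimal {M : MDP S A H} (hM : M.IsLinear φ) (hH : 1 ≤ H)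
    (Δ : Discretization φ H ε) {r : Fin H → S → A → ℝ} (hr : FeasibleReward φ r) :
    ∃ π ∈ Δ.evalSet, ∀ π' : Policy S A H,
      M.value π' r ≤ M.value (DetPolicy.toPolicy π) r + ε := by
  -- `MDP.IsLinear.exists_greedy` needs a state at its terminal layer, hence a layer below `H`. The
  -- last decision is therefore made greedy by hand, and its `ε/H` completes the `m` losses to `ε`.
  obtain ⟨m, rfl⟩ : ∃ m, H = m + 1 := ⟨H - 1, by omega⟩
  have hm : m < m + 1 := Nat.lt_succ_self m
  obtain ⟨θ, hθ, hθr⟩ := hr ⟨m, hm⟩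
  have hx : ‖θ‖ ≤ 2 * ((m + 1 : ℕ) : ℝ) * √(d : ℝ) := by
    refine hθ.trans (le_mul_of_one_le_left (Real.sqrt_nonneg _) ?_)
    push_cast
    linarith [(Nat.cast_nonneg m : (0 : ℝ) ≤ m)]
  obtain ⟨w', hw', hww⟩ := Δ.linCover_covers _ hx
  set ρ := Δ.linRule ⟨m, hm⟩ w'
  have hgreedy : ∀ s a, r ⟨m, hm⟩ s a ≤ r ⟨m, hm⟩ s (ρ.1 s) + ε / ((m + 1 : ℕ) : ℝ) := by
    intro s a
    rw [(hθr _ _).1, (hθr _ _).1]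
    have g1 : inner ℝ (φ s a) w' ≤ inner ℝ (φ s (ρ.1 s)) w' := Δ.linRule_greedy ⟨m, hm⟩ w' hw' s a
    have g2 := φ.abs_inner_le (θ - w') s a
    have g3 := φ.abs_inner_le (θ - w') s (ρ.1 s)
    rw [inner_sub_right] at g2 g3
    have g4 := (abs_le.1 (g2.trans hww)).2
    have g5 := (abs_le.1 (g3.trans hww)).1
    have g6 : ε / ((m + 1 : ℕ) : ℝ) =
      ε / (2 * ((m + 1 : ℕ) : ℝ)) + ε / (2 * ((m + 1 : ℕ) : ℝ)) := by field_simp; norm_num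
    linarith
  have hV : Measurable fun s => r ⟨m, hm⟩ s (ρ.1 s) :=
    (hr.measurable _).comp (measurable_prod_rule ρ)
  have hVm : ∀ s, r ⟨m, hm⟩ s (ρ.1 s) ∈ Set.Icc (0 : ℝ) 1 := fun s => hr.mem_Icc _ _ _
  obtain ⟨π, hπ1, hπ2, hπ3⟩ := hM.exists_greedy Δ hr m hm hV zero_le_one hVm
    (by push_cast; linarith) (fun _ => ρ)
  refine ⟨π, Δ.mem_evalSet.2 fun h => ?_, fun π' => ?_⟩
  · rcases Nat.lt_succ_iff_lt_or_eq.1 h.isLt with h' | h'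
    · obtain ⟨w, hw, hwe⟩ := hπ2 h h'
      exact ⟨w, hw, hwe.symm⟩
    · obtain rfl : h = ⟨m, hm⟩ := Fin.ext h'
      exact ⟨w', hw', (hπ1 _ le_rfl).symm⟩
  · have h3 := hπ3 π'
    have hπm : π ⟨m, hm⟩ = ρ := hπ1 _ le_rfl
    rw [M.detValue_eq π hr m hm.le hV hVm] at h3
    rw [M.value_eq_sum _ hr, M.value_eq_sum _ hr, Fin.sum_univ_castSucc, Fin.sum_univ_castSucc]
    have i1 : Integrable (fun τ : Traj S A (m + 1) => r ⟨m, hm⟩ (τ ⟨m, hm⟩).1 (τ ⟨m, hm⟩).2)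
        (M.trajLaw π') :=
      integrable_of_mem_Icc ((hr.measurable _).comp (measurable_pi_apply _))
        fun τ => hr.mem_Icc _ _ _
    have i3 : Integrable (fun τ : Traj S A (m + 1) => r ⟨m, hm⟩ (τ ⟨m, hm⟩).1 (ρ.1 (τ ⟨m, hm⟩).1))
        (M.trajLaw π') :=
      integrable_of_mem_Icc (hV.comp (measurable_fst.comp (measurable_pi_apply _)))
        fun τ => hVm _
    have h5 : ∫ τ, r ⟨m, hm⟩ (τ ⟨m, hm⟩).1 (τ ⟨m, hm⟩).2 ∂(M.trajLaw π') ≤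
        ∫ τ, r ⟨m, hm⟩ (τ ⟨m, hm⟩).1 (ρ.1 (τ ⟨m, hm⟩).1) ∂(M.trajLaw π') +
          ε / ((m + 1 : ℕ) : ℝ) := by
      have : ∀ c : ℝ, ∫ τ, r ⟨m, hm⟩ (τ ⟨m, hm⟩).1 (ρ.1 (τ ⟨m, hm⟩).1) ∂(M.trajLaw π') + c =
          ∫ τ, (r ⟨m, hm⟩ (τ ⟨m, hm⟩).1 (ρ.1 (τ ⟨m, hm⟩).1) + c) ∂(M.trajLaw π') := by
        intro c
        rw [integral_add i3 (integrable_const _)]; simp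
      rw [this]
      exact integral_mono i1 (i3.add (integrable_const _)) fun τ => hgreedy _ _
    have h6 : ∑ i : Fin m, ∫ τ, r i.castSucc (τ i.castSucc).1 (τ i.castSucc).2
          ∂(M.trajLaw (DetPolicy.toPolicy π)) =
        ∑ i : Fin m, ∫ s, r (Fin.castLE hm.le i) s ((π (Fin.castLE hm.le i)).1 s)
          ∂(M.detStateLaw π i (i.isLt.le.trans hm.le)) :=
      Finset.sum_congr rfl fun i _ => M.integral_trajLaw_det π i.castSucc (hr.measurable _)
    have h7 : ∫ τ, r (Fin.last m) (τ (Fin.last m)).1 (τ (Fin.last m)).2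
          ∂(M.trajLaw (DetPolicy.toPolicy π)) =
        ∫ s, r ⟨m, hm⟩ s (ρ.1 s) ∂(M.detStateLaw π m hm.le) := by
      rw [M.integral_trajLaw_det π (Fin.last m) (hr.measurable _), ← hπm]
      rfl
    have h8 : (m : ℝ) * (ε / ((m + 1 : ℕ) : ℝ)) + ε / ((m + 1 : ℕ) : ℝ) = ε := by
      push_cast; field_simp
    rw [h6, h7]
    have h9 : ∀ i : Fin m, Fin.castLE hm.le i = i.castSucc := fun i => rfl
    have h10 : Fin.last m = ⟨m, hm⟩ := rfl
    simp only [h9, h10] at h3 ⊢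
    linarith

/-- The explorative policies contain a nearly optimal policy for every elliptic reward. -/
lemma MDP.IsLinear.exists_expSet_near_optimal {M : MDP S A H} (hM : M.IsLinear φ) (hε : 0 ≤ ε)
    (Δ : Discretization φ H ε) (h : Fin H) {X : Matrix (Fin d) (Fin d) ℝ} (hX : X.PosSemidef) :
    ∃ π ∈ Δ.expSet, ∀ π' : Policy S A H,
      ∫ τ, ellipticReward φ X (τ h).1 (τ h).2 ∂(M.trajLaw π') ≤
        ∫ τ, ellipticReward φ X (τ h).1 (τ h).2 ∂(M.trajLaw (DetPolicy.toPolicy π)) + ε := by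
  have hH : (0 : ℝ) < H := by exact_mod_cast (Nat.zero_le _).trans_lt h.isLt
  obtain ⟨f, hf, hfX⟩ := Δ.rewCover_covers X hX
  set ρ := Δ.rewRule h f
  set g := ellipticReward φ X
  have hgm : Measurable fun p : S × A => g p.1 p.2 := measurable_ellipticReward X
  have hgreedy : ∀ s a, g s a ≤ g s (ρ.1 s) + ε / H := by
    intro s a
    have g1 : f s a ≤ f s (ρ.1 s) := Δ.rewRule_greedy h f hf s a
    have g4 := (abs_le.1 (hfX s a)).2
    have g5 := (abs_le.1 (hfX s (ρ.1 s))).1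
    have g6 : ε / H = ε / (2 * H) + ε / (2 * H) := by field_simp; norm_num
    linarith
  have hV : Measurable fun s => g s (ρ.1 s) := hgm.comp (measurable_prod_rule ρ)
  have hVm : ∀ s, g s (ρ.1 s) ∈ Set.Icc (0 : ℝ) 1 := fun s => ellipticReward_mem hX _ _
  obtain ⟨w₀, hw₀⟩ := Δ.linCover_nonempty
  -- Layers after `h` do not affect the reward; an arbitrary linear rule there keeps the policy in
  -- `Δ.expSet`.
  obtain ⟨π, hπ1, hπ2, hπ3⟩ := hM.exists_greedy Δ (feasibleReward_zero φ) h.1 h.isLt hV zero_le_one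
    hVm (by have := h.isLt; exact_mod_cast (by omega : 1 + h.1 ≤ H))
    (Function.update (fun i => Δ.linRule i w₀) h ρ)
  have hπh : π h = ρ := by rw [hπ1 _ le_rfl, Function.update_self]
  refine ⟨π, Δ.mem_expSet.2 fun i => ?_, fun π' => ?_⟩
  · rcases lt_trichotomy i h with h' | rfl | h'
    · obtain ⟨w, hw, hwe⟩ := hπ2 i h'
      exact Or.inr ⟨w, hw, hwe.symm⟩
    · exact Or.inl ⟨f, hf, hπh.symm⟩
    · exact Or.inr ⟨w₀, hw₀, by rw [hπ1 i (Fin.le_def.1 h'.le), Function.update_of_ne h'.ne']⟩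
  · have h3 := hπ3 π'
    rw [M.detValue_eq π (feasibleReward_zero φ) h.1 h.isLt.le hV hVm] at h3
    simp only [integral_zero, Finset.sum_const_zero, zero_add, Fin.eta] at h3
    rw [M.integral_trajLaw_det π h hgm, hπh]
    have i1 : Integrable (fun τ : Traj S A H => g (τ h).1 (τ h).2) (M.trajLaw π') :=
      integrable_of_mem_Icc (hgm.comp (measurable_pi_apply _)) fun τ => ellipticReward_mem hX _ _
    have i3 : Integrable (fun τ : Traj S A H => g (τ h).1 (ρ.1 (τ h).1)) (M.trajLaw π') :=
      integrable_of_mem_Icc (hV.comp (measurable_fst.comp (measurable_pi_apply _)))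
        fun τ => hVm _
    have h5 : ∫ τ, g (τ h).1 (τ h).2 ∂(M.trajLaw π') ≤
        ∫ τ, g (τ h).1 (ρ.1 (τ h).1) ∂(M.trajLaw π') + ε / H := by
      have : ∀ c : ℝ, ∫ τ, g (τ h).1 (ρ.1 (τ h).1) ∂(M.trajLaw π') + c =
          ∫ τ, (g (τ h).1 (ρ.1 (τ h).1) + c) ∂(M.trajLaw π') := by
        intro c
        rw [integral_add i3 (integrable_const _)]; simp
      rw [this]
      exact integral_mono i1 (i3.add (integrable_const _)) fun τ => hgreedy _ _
    have h8 : (h.1 : ℝ) * (ε / H) + ε / H ≤ ε := by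
      have : (h.1 : ℝ) + 1 ≤ H := by exact_mod_cast h.isLt
      calc (h.1 : ℝ) * (ε / H) + ε / H = (h.1 + 1) * (ε / H) := by ring
        _ ≤ H * (ε / H) := by gcongr
        _ = ε := by field_simp
    linarith

end PolicyApproximation

/-! ### Covariance matrices and the existence of an exploring design. -/

section Covariance

variable {S A : Type*} [MeasurableSpace S] [MeasurableSpace A] {H d : ℕ}

lemma MDP.integrable_coord_mul (M : MDP S A H) (φ : FeatureMap S A d) (π : Policy S A H)
    (h : Fin H) (i j : Fin d) :
    Integrable (fun τ : Traj S A H => φ (τ h).1 (τ h).2 i * φ (τ h).1 (τ h).2 j)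
      (M.trajLaw π) := by
  refine integrable_of_abs_le (C := 1) (((φ.measurable_coord i).mul (φ.measurable_coord j)).comp
    (measurable_pi_apply h)) fun τ => ?_
  rw [abs_mul]
  exact mul_le_one₀ (φ.abs_coord_le _ _ _) (abs_nonneg _) (φ.abs_coord_le _ _ _)

lemma MDP.isHermitian_covariance (M : MDP S A H) (φ : FeatureMap S A d) (π : Policy S A H)
    (h : Fin H) : (M.covariance φ π h).IsHermitian := by
  ext i j
  simp [MDP.covariance, Matrix.of_apply, mul_comm]

lemma MDP.trace_mul_covariance (M : MDP S A H) (φ : FeatureMap S A d) (π : Policy S A H)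
    (h : Fin H) (X : Matrix (Fin d) (Fin d) ℝ) :
    (X * M.covariance φ π h).trace = ∫ τ, quad X (φ (τ h).1 (τ h).2) ∂(M.trajLaw π) := by
  simp only [quad_eq_sum]
  rw [integral_finsetSum]
  · simp only [Matrix.trace, Matrix.diag_apply, Matrix.mul_apply]
    refine Finset.sum_congr rfl fun i _ => ?_
    rw [integral_finsetSum]
    · refine Finset.sum_congr rfl fun j _ => ?_
      rw [integral_const_mul]
      simp [MDP.covariance, mul_comm]
    · exact fun j _ => (M.integrable_coord_mul φ π h i j).const_mul _
  · exact fun i _ => integrable_finsetSum _ fun j _ =>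
      (M.integrable_coord_mul φ π h i j).const_mul _

lemma MDP.quad_covariance (M : MDP S A H) (φ : FeatureMap S A d) (π : Policy S A H)
    (h : Fin H) (x : Vec d) :
    quad (M.covariance φ π h) x = ∫ τ, (inner ℝ (φ (τ h).1 (τ h).2) x) ^ 2 ∂(M.trajLaw π) := by
  rw [← trace_mul_vecMulVec, Matrix.trace_mul_comm, M.trace_mul_covariance]
  simp only [quad_vecMulVec]

lemma MDP.posSemidef_covariance (M : MDP S A H) (φ : FeatureMap S A d) (π : Policy S A H)
    (h : Fin H) : (M.covariance φ π h).PosSemidef :=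
  posSemidef_of_quad (M.isHermitian_covariance φ π h) fun x => by
    rw [M.quad_covariance]
    exact integral_nonneg fun _ => sq_nonneg _

lemma MDP.minEig_covariance_le (M : MDP S A H) (φ : FeatureMap S A d) (π : Policy S A H)
    (h : Fin H) (hd : 0 < d) : minEig (M.covariance φ π h) ≤ 1 / d := by
  refine minEig_le_of_trace_le hd (M.isHermitian_covariance φ π h) ?_
  have h1 := M.trace_mul_covariance φ π h 1
  rw [one_mul] at h1
  rw [h1]
  have h2 : ∀ τ : Traj S A H, quad 1 (φ (τ h).1 (τ h).2) ∈ Set.Icc (0 : ℝ) 1 := fun τ => by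
    rw [quad_one]
    exact ⟨by positivity, pow_le_one₀ (norm_nonneg _) (φ.norm_le_one _ _)⟩
  exact (integral_mem_Icc ((φ.measurable_quad 1).comp (measurable_pi_apply h)) h2).2

lemma MDP.explorability_le (M : MDP S A H) (φ : FeatureMap S A d) (h : Fin H) :
    M.explorability φ ≤ ⨆ π : Policy S A H, minEig (M.covariance φ π h) :=
  ciInf_le (Set.finite_range _).bddBelow h

/-- A covariance matrix has trace at most `1`. Together with `d ≥ 2` this later bounds `ε` by `3/8`
and keeps `log(1/λ^⋆)` away from `0`. -/
lemma MDP.explorability_le_inv (M : MDP S A H) (φ : FeatureMap S A d) (hH : 0 < H) (hd : 0 < d) :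
    M.explorability φ ≤ 1 / d :=
  (M.explorability_le φ ⟨0, hH⟩).trans
    (Real.iSup_le (fun π => M.minEig_covariance_le φ π _ hd) (by positivity))

/-- The supremum over policies need not be attained, hence the strict inequality. -/
lemma MDP.exists_policy_of_lt_explorability (M : MDP S A H) (φ : FeatureMap S A d) (h : Fin H)
    (hd : 0 < d) {c : ℝ} (hc0 : 0 ≤ c) (hc : c < M.explorability φ) :
    ∃ π : Policy S A H, ∀ x : Vec d, c * ‖x‖ ^ 2 ≤ quad (M.covariance φ π h) x := by
  have h1 := hc.trans_le (M.explorability_le φ h)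
  -- Without policies the real supremum takes the default value `0`, which `0 ≤ c` excludes.
  have hne : Nonempty (Policy S A H) := by
    by_contra hcon
    rw [not_nonempty_iff] at hcon
    rw [Real.iSup_of_isEmpty] at h1
    linarith
  obtain ⟨π, hπ⟩ := exists_lt_of_lt_ciSup h1
  exact ⟨π, (le_minEig_iff hd (M.isHermitian_covariance φ π h) c).1 hπ.le⟩

/-- The covariance matrix of a mixture of deterministic policies. -/
noncomputable def MDP.mixCov (M : MDP S A H) (φ : FeatureMap S A d) (T : Finset (DetPolicy S A H))
    (p : T → ℝ) (h : Fin H) : Matrix (Fin d) (Fin d) ℝ :=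
  ∑ π : T, p π • M.covariance φ (DetPolicy.toPolicy π.1) h

/-- There is a mixture of explorative policies which explores all directions and is nearly a
`G`-optimal design. -/
lemma MDP.IsLinear.exists_exploring_mixture {M : MDP S A H} {φ : FeatureMap S A d}
    (hM : M.IsLinear φ) {ε : ℝ} (hε : 0 ≤ ε) (Δ : Discretization φ H ε) (h : Fin H) (hd : 0 < d)
    (hlam : 0 < M.explorability φ) (hεlam : ε ≤ M.explorability φ / 4) :
    ∃ p ∈ stdSimplex ℝ Δ.expSet,
      (∀ x : Vec d, M.explorability φ ^ 2 / (16 * d) * ‖x‖ ^ 2 ≤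
        quad (M.mixCov φ Δ.expSet p h) x) ∧
      ∀ π ∈ Δ.expSet, ∫ τ, quad (M.mixCov φ Δ.expSet p h)⁻¹ (φ (τ h).1 (τ h).2)
        ∂(M.trajLaw (DetPolicy.toPolicy π)) ≤ 2 * d := by
  set lam := M.explorability φ
  have hd' : (0 : ℝ) < d := by exact_mod_cast hd
  -- Chosen so that the design bound `d / n` equals `λ²/16`, whose square root is `λ/4`.
  set n : ℝ := 16 * d / lam ^ 2 with hn_def
  have hn : 0 < n := by positivity
  have hne : Nonempty Δ.expSet :=
    (Δ.evalSet_nonempty.mono Δ.evalSet_subset_expSet).to_subtype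
  obtain ⟨p, hp, hpd⟩ := exists_design
    (fun π : Δ.expSet => M.covariance φ (DetPolicy.toPolicy π.1) h)
    (fun π => M.posSemidef_covariance φ _ h) hn
  refine ⟨p, hp, ?_⟩
  change ∀ i : Δ.expSet, ((1 + n • M.mixCov φ Δ.expSet p h)⁻¹ *
    M.covariance φ (DetPolicy.toPolicy i.1) h).trace ≤ d / n at hpd
  set Z := M.mixCov φ Δ.expSet p h with hZdef
  have hZ : Z.PosSemidef :=
    Matrix.posSemidef_sum _ fun π _ => (M.posSemidef_covariance φ _ h).smul (hp.1 π)
  have hnZ : (n • Z).PosSemidef := hZ.smul hn.le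
  have hY : (1 + n • Z).PosDef := Matrix.PosDef.one.add_posSemidef hnZ
  have hint : ∀ π ∈ Δ.expSet, ∫ τ, quad (1 + n • Z)⁻¹ (φ (τ h).1 (τ h).2)
      ∂(M.trajLaw (DetPolicy.toPolicy π)) ≤ d / n := fun π hπ => by
    rw [← M.trace_mul_covariance]
    exact hpd ⟨π, hπ⟩
  -- Suppose `Z` is small in a direction `v`. Explorative policies have expected elliptic reward at
  -- most `λ/4`, and one of them is `λ/4`-optimal, so every policy has at most `λ/2`. A policy that
  -- explores `v` contradicts this.
  have hmin1 : ∀ x : Vec d, ‖x‖ = 1 → n⁻¹ ≤ quad Z x := by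
    intro v hv
    by_contra hcon
    push Not at hcon
    have hYv : quad (1 + n • Z) v ≤ 2 := by
      rw [quad_add, quad_one, quad_smul, hv]
      have : n * quad Z v ≤ n * n⁻¹ := by gcongr
      rw [mul_inv_cancel₀ hn.ne'] at this
      linarith
    obtain ⟨π, hπ, hopt⟩ := hM.exists_expSet_near_optimal hε Δ h hnZ
    have hup : ∫ τ, ellipticReward φ (n • Z) (τ h).1 (τ h).2
        ∂(M.trajLaw (DetPolicy.toPolicy π)) ≤ lam / 4 := by
      refine (integral_sqrt_le ((φ.measurable_quad _).comp (measurable_pi_apply h))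
        (fun τ : Traj S A H => quad_one_add_inv_mem hnZ (τ h).1 (τ h).2)).trans ?_
      refine (Real.sqrt_le_sqrt (hint π hπ)).trans (Real.sqrt_le_iff.2 ⟨by positivity, ?_⟩)
      rw [hn_def]
      field_simp
      norm_num
    have hlow : ∀ c, 0 ≤ c → c < lam → c * (2 / 3) ≤ lam / 2 := by
      intro c hc0 hc
      obtain ⟨π', hπ'⟩ := M.exists_policy_of_lt_explorability φ h hd hc0 hc
      have h1 := hπ' v
      rw [hv, M.quad_covariance] at h1
      have h2 := hopt π'
      -- Cauchy-Schwarz with `quad (1 + n • Z) v ≤ 2` bounds `⟨φ, v⟩²` by twice the squared reward.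
      -- Since `|⟨φ, v⟩| ≤ 1` and `2/3 ≤ 1/√2`, the square `⟨φ, v⟩²` itself, times `2/3`, is below
      -- the reward.
      have h3 : ∀ s a, (inner ℝ (φ s a) v) ^ 2 * (2 / 3) ≤ ellipticReward φ (n • Z) s a := by
        intro s a
        have q1 := sq_dotProduct_le hY (φ s a) v
        rw [← inner_eq_dotProduct] at q1
        have q2 := (quad_one_add_inv_mem (φ := φ) hnZ s a).1
        have q3 : (inner ℝ (φ s a) v) ^ 2 ≤ quad (1 + n • Z)⁻¹ (φ s a) * 2 :=
          q1.trans (by gcongr)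
        have q4 : |inner ℝ (φ s a) v| ≤ 1 := (φ.abs_inner_le v s a).trans hv.le
        refine Real.le_sqrt_of_sq_le ?_
        have q5 : (inner ℝ (φ s a) v) ^ 2 ≤ 1 := by rw [sq_le_one_iff_abs_le_one]; exact q4
        nlinarith [sq_nonneg (inner ℝ (φ s a) v)]
      have h4 : (∫ τ, (inner ℝ (φ (τ h).1 (τ h).2) v) ^ 2 ∂(M.trajLaw π')) * (2 / 3) ≤
          ∫ τ, ellipticReward φ (n • Z) (τ h).1 (τ h).2 ∂(M.trajLaw π') := by
        rw [← integral_mul_const]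
        refine integral_mono (Integrable.mul_const ?_ _) ?_ fun τ => h3 _ _
        · refine integrable_of_abs_le (C := 1) (((φ.measurable_inner v).pow_const 2).comp
            (measurable_pi_apply h)) fun τ => ?_
          rw [abs_pow]
          exact pow_le_one₀ (abs_nonneg _) ((φ.abs_inner_le v _ _).trans hv.le)
        · exact integrable_of_mem_Icc ((measurable_ellipticReward _).comp (measurable_pi_apply h))
            fun τ => ellipticReward_mem hnZ _ _
      linarith
    -- Any factor strictly between `3/4` and `1` works: here `4/5 · 2/3 > 1/2`.
    have := hlow (lam * (4 / 5)) (by positivity) (by linarith)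
    linarith
  have hmin : ∀ x : Vec d, n⁻¹ * ‖x‖ ^ 2 ≤ quad Z x := by
    intro x
    rcases eq_or_ne x 0 with rfl | hx
    · simp [quad]
    · have hx' := norm_pos_iff.2 hx
      have h1 := hmin1 (‖x‖⁻¹ • x) (by rw [norm_smul, norm_inv, norm_norm]; field_simp)
      have h2 : quad Z (‖x‖⁻¹ • x) = quad Z x / ‖x‖ ^ 2 := by
        simp only [quad, WithLp.ofLp_smul, Matrix.mulVec_smul, dotProduct_smul, smul_dotProduct,
          smul_eq_mul]
        field_simp
      rw [h2, le_div_iff₀ (by positivity)] at h1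
      exact h1
  have hZd : Z.PosDef := posDef_of_quad hZ.1 (inv_pos.2 hn) hmin
  refine ⟨fun x => ?_, fun π hπ => ?_⟩
  · have : lam ^ 2 / (16 * d) = n⁻¹ := by rw [hn_def]; field_simp
    rw [this]
    exact hmin x
  -- Now `1 ≤ nZ`, so `1 + nZ ≤ 2nZ`: the regularization is removed at the cost of a factor two,
  -- turning `d / n` into `2d`.
  · have hcmp : ∀ x : Vec d, quad Z⁻¹ x ≤ (2 * n) * quad (1 + n • Z)⁻¹ x := by
      intro x
      have := quad_inv_le_of_le hY hZd (c := (2 * n)⁻¹) (by positivity) (fun y => by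
        rw [quad_add, quad_one, quad_smul]
        have := hmin y
        have h3 : (2 * n)⁻¹ * (‖y‖ ^ 2 + n * quad Z y) = (n⁻¹ * ‖y‖ ^ 2) / 2 + quad Z y / 2 := by
          field_simp
        rw [h3]
        linarith) x
      rwa [inv_inv] at this
    have hbd : ∀ τ : Traj S A H, quad Z⁻¹ (φ (τ h).1 (τ h).2) ∈ Set.Icc 0 (2 * n * 1) := fun τ =>
      ⟨quad_nonneg hZd.inv.posSemidef _, (hcmp _).trans (by
        gcongr
        exact (quad_one_add_inv_mem hnZ _ _).2)⟩
    calc ∫ τ, quad Z⁻¹ (φ (τ h).1 (τ h).2) ∂(M.trajLaw (DetPolicy.toPolicy π))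
        ≤ ∫ τ, (2 * n) * quad (1 + n • Z)⁻¹ (φ (τ h).1 (τ h).2)
            ∂(M.trajLaw (DetPolicy.toPolicy π)) := by
          refine integral_mono (integrable_of_mem_Icc ((φ.measurable_quad _).comp
            (measurable_pi_apply h)) hbd) (Integrable.const_mul (integrable_of_mem_Icc
              ((φ.measurable_quad _).comp (measurable_pi_apply h))
              fun τ => quad_one_add_inv_mem hnZ (τ h).1 (τ h).2) _) fun τ => hcmp _
      _ = (2 * n) * ∫ τ, quad (1 + n • Z)⁻¹ (φ (τ h).1 (τ h).2)
            ∂(M.trajLaw (DetPolicy.toPolicy π)) := integral_const_mul _ _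
      _ ≤ (2 * n) * (d / n) := by gcongr; exact hint π hπ
      _ = 2 * d := by field_simp

end Covariance

/-! ### Exponential moments and Chernoff bounds along adaptive deployments. -/

section ExponentialMoments

/-- Hoeffding's lemma: a variable with range `[-1, 1]` has variance proxy `1`. This range covers
both products of two feature coordinates and values in `[0, 1]`. -/
lemma lintegral_exp_hoeffding {X : Type*} [MeasurableSpace X] {μ : Measure X}
    [IsProbabilityMeasure μ] {V : X → ℝ} (hV : Measurable V) (hV1 : ∀ x, V x ∈ Set.Icc (-1 : ℝ) 1)
    (c : ℝ) :
    ∫⁻ x, ENNReal.ofReal (Real.exp (c * (V x - ∫ y, V y ∂μ) - c ^ 2 / 2)) ∂μ ≤ 1 := by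
  have hs := hasSubgaussianMGF_of_mem_Icc (μ := μ) hV.aemeasurable (Filter.Eventually.of_forall hV1)
  have h1 := hs.mgf_le c
  have hi := hs.integrable_exp_mul c
  have h2 : ((((‖(1 : ℝ) - -1‖₊ / 2) ^ 2 : NNReal)) : ℝ) = 1 := by
    norm_num
  rw [h2, mgf] at h1
  have h3 : ∀ x, Real.exp (c * (V x - ∫ y, V y ∂μ) - c ^ 2 / 2) =
      Real.exp (c * (V x - ∫ y, V y ∂μ)) * Real.exp (-(c ^ 2 / 2)) := fun x => by
    rw [← Real.exp_add, sub_eq_add_neg]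
  simp only [h3]
  rw [← ofReal_integral_eq_lintegral_ofReal (hi.mul_const _)
    (Filter.Eventually.of_forall fun x => by positivity), integral_mul_const]
  refine ENNReal.ofReal_le_one.2 ?_
  calc _ ≤ Real.exp (1 * c ^ 2 / 2) * Real.exp (-(c ^ 2 / 2)) := by gcongr
    _ = 1 := by rw [← Real.exp_add]; simp

variable {S A : Type*} [MeasurableSpace S] [MeasurableSpace A] {H d : ℕ}

/-- A mixture averages its components, so a moment bound valid for every policy does not see how the
weights were chosen from the data. -/
lemma MDP.lintegral_mixLaw_le_one (M : MDP S A H) (T : Finset (DetPolicy S A H)) {p : T → ℝ}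
    (hp : p ∈ stdSimplex ℝ T) {F : Traj S A H → ENNReal}
    (hF : ∀ π : T, ∫⁻ τ, F τ ∂(M.trajLaw (DetPolicy.toPolicy π.1)) ≤ 1) :
    ∫⁻ τ, F τ ∂(M.mixLaw T p) ≤ 1 := by
  rw [MDP.mixLaw, lintegral_finsetSum_measure]
  simp only [lintegral_smul_measure]
  calc ∑ π : T, ENNReal.ofReal (p π) • ∫⁻ τ, F τ ∂(M.trajLaw (DetPolicy.toPolicy π.1))
      ≤ ∑ π : T, ENNReal.ofReal (p π) := Finset.sum_le_sum fun π _ => by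
        rw [smul_eq_mul]
        exact mul_le_of_le_one_right (zero_le) (hF π)
    _ = 1 := by rw [← ENNReal.ofReal_sum_of_nonneg fun i _ => hp.1 i, hp.2, ENNReal.ofReal_one]

lemma lintegral_pi_prod_le_one {X : Type*} [MeasurableSpace X] {μ : Measure X}
    [IsProbabilityMeasure μ] {N : ℕ} {F : X → ENNReal} (hF : Measurable F)
    (h : ∫⁻ x, F x ∂μ ≤ 1) :
    ∫⁻ b : Fin N → X, ∏ n, F (b n) ∂(Measure.pi fun _ => μ) ≤ 1 := by
  have h1 := lintegral_prod_eq_prod_lintegral_of_indepFun (μ := Measure.pi fun _ : Fin N => μ)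
    Finset.univ (fun n (b : Fin N → X) => F (b n))
    (iIndepFun_pi (X := fun _ => F) fun _ => hF.aemeasurable)
    (fun n => hF.comp (measurable_pi_apply n))
  rw [h1]
  refine Finset.prod_le_one' fun n _ => ?_
  have h2 := (measurePreserving_eval (fun _ : Fin N => μ) n).lintegral_comp hF
  exact h2.le.trans h

/-- The first `k` deployments of a data set. -/
def Dataset.take {S A : Type*} {H N m : ℕ} (D : Dataset S A H N m) (k : ℕ) (hk : k ≤ m) :
    Dataset S A H N k :=
  fun i => D (Fin.castLE hk i)

lemma measurable_take {N m : ℕ} (k : ℕ) (hk : k ≤ m) :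
    Measurable fun D : Dataset S A H N m => D.take k hk :=
  measurable_pi_lambda _ fun _ => measurable_pi_apply _

/-- A product of conditional exponential moments along the deployments. -/
lemma DeploymentAlgorithm.lintegral_prod_le_one (alg : DeploymentAlgorithm S A H) (M : MDP S A H)
    (F : (j : Fin alg.deployments) → Dataset S A H alg.batch j → Traj S A H → ENNReal)
    (hFm : ∀ j : Fin alg.deployments, Measurable fun q : Dataset S A H alg.batch j × Traj S A H => F j q.1 q.2)
    (hF : ∀ (j : Fin alg.deployments) D, ∫⁻ τ, F j D τ ∂(M.mixLaw alg.policies (alg.weights j D)) ≤ 1)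
    (k : ℕ) (hk : k ≤ alg.deployments) :
    ∫⁻ D, ∏ j : Fin k, ∏ n, F (Fin.castLE hk j) (D.take j j.isLt.le) (D j n)
      ∂(alg.lawUpTo M k hk) ≤ 1 := by
  have hmeas : ∀ (k : ℕ) (hk : k ≤ alg.deployments),
      Measurable fun D : Dataset S A H alg.batch k =>
        ∏ j : Fin k, ∏ n, F (Fin.castLE hk j) (D.take j j.isLt.le) (D j n) := by
    intro k hk
    refine Finset.measurable_prod _ fun j _ => Finset.measurable_prod _ fun n _ => ?_
    have hj : Measurable fun D : Dataset S A H alg.batch k => D j n :=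
      (measurable_pi_apply n).comp (measurable_pi_apply j)
    exact (hFm (Fin.castLE hk j)).comp ((measurable_take j.1 j.isLt.le).prodMk hj)
  induction k with
  | zero =>
    refine (lintegral_mono (g := fun _ => 1) fun D => ?_).trans ?_
    · simp
    · simp
  | succ k ih =>
    have hk' : k ≤ alg.deployments := Nat.le_of_succ_le hk
    rw [DeploymentAlgorithm.lawUpTo, lintegral_map (hmeas (k + 1) hk) (measurable_snoc k)]
    have hm2 := (hmeas (k + 1) hk).comp (measurable_snoc (X := Fin alg.batch → Traj S A H) k)
    refine (Measure.lintegral_compProd hm2).le.trans ?_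
    refine le_trans (lintegral_mono fun D : Dataset S A H alg.batch k => ?_) (ih hk')
    -- The factors of earlier batches depend on earlier data only. Hence the last batch can be
    -- integrated out conditionally on `D`, contributing at most `1`.
    have hb : ∀ b : Fin alg.batch → Traj S A H,
        ((fun D : Dataset S A H alg.batch (k + 1) =>
          ∏ j : Fin (k + 1), ∏ n, F (Fin.castLE hk j) (D.take j j.isLt.le) (D j n)) ∘
          (fun p : Dataset S A H alg.batch k × (Fin alg.batch → Traj S A H) =>
            (Fin.snoc p.1 p.2 : Dataset S A H alg.batch (k + 1)))) (D, b) =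
        (∏ j : Fin k, ∏ n, F (Fin.castLE hk' j) (D.take j j.isLt.le) (D j n)) *
          ∏ n, F ⟨k, hk⟩ D (b n) := by
      intro b
      have ht : ∀ (j : ℕ) (hj : j ≤ k), Dataset.take (S := S) (A := A)
          (Fin.snoc D b : Dataset S A H alg.batch (k + 1)) j (Nat.le_succ_of_le hj) =
          D.take j hj := by
        intro j hj
        funext i
        have : Fin.castLE (Nat.le_succ_of_le hj) i = (Fin.castLE hj i).castSucc := rfl
        simp only [Dataset.take]
        rw [this]
        exact Fin.snoc_castSucc (α := fun _ => Fin alg.batch → Traj S A H) b D (Fin.castLE hj i)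
      simp only [Function.comp_apply]
      rw [Fin.prod_univ_castSucc]
      congr 1
      · refine Finset.prod_congr rfl fun j _ => Finset.prod_congr rfl fun n _ => ?_
        have h1 := ht j.1 j.isLt.le
        have h2 : (Fin.snoc D b : Dataset S A H alg.batch (k + 1)) j.castSucc = D j :=
          Fin.snoc_castSucc (α := fun _ => Fin alg.batch → Traj S A H) b D j
        rw [h2]
        exact congrArg (fun x => F (Fin.castLE hk' j) x (D j n)) h1
      · refine Finset.prod_congr rfl fun n _ => ?_
        have h1 := ht k le_rfl
        have h2 : (Fin.snoc D b : Dataset S A H alg.batch (k + 1)) (Fin.last k) = b :=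
          Fin.snoc_last (α := fun _ => Fin alg.batch → Traj S A H) b D
        rw [h2]
        exact congrArg (fun x => F ⟨k, hk⟩ x (b n)) h1
    simp only [hb]
    have hFD : Measurable (F ⟨k, hk⟩ D) := (hFm ⟨k, hk⟩).comp measurable_prodMk_left
    have hprod : Measurable fun b : Fin alg.batch → Traj S A H => ∏ n, F ⟨k, hk⟩ D (b n) :=
      Finset.measurable_prod _ fun n _ => hFD.comp (measurable_pi_apply n)
    rw [lintegral_const_mul _ hprod]
    refine mul_le_of_le_one_right zero_le ?_
    have hp := M.isProbabilityMeasure_mixLaw _ _ (alg.weights_mem ⟨k, hk⟩ D)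
    exact lintegral_pi_prod_le_one hFD (hF ⟨k, hk⟩ D)

lemma measurableSet_of_sum_le {X : Type*} [MeasurableSpace X] {g : X → ℝ} (hg : Measurable g)
    (L : ℝ) : MeasurableSet {x | g x ≤ L} := measurableSet_le hg measurable_const

lemma DeploymentAlgorithm.measurable_sum (alg : DeploymentAlgorithm S A H)
    (G : (j : Fin alg.deployments) → Dataset S A H alg.batch j → Traj S A H → ℝ)
    (hGm : ∀ j : Fin alg.deployments, Measurable fun q : Dataset S A H alg.batch j × Traj S A H => G j q.1 q.2) :
    Measurable fun D : Dataset S A H alg.batch alg.deployments =>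
      ∑ j, ∑ n, G j (D.take j j.isLt.le) (D j n) := by
  refine Finset.measurable_sum _ fun j _ => Finset.measurable_sum _ fun n _ => ?_
  have hj : Measurable fun D : Dataset S A H alg.batch alg.deployments => D j n :=
    (measurable_pi_apply n).comp (measurable_pi_apply j)
  exact (hGm j).comp ((measurable_take j.1 j.isLt.le).prodMk hj)

/-- Chernoff's bound along the deployments. -/
lemma DeploymentAlgorithm.law_sum_gt_le (alg : DeploymentAlgorithm S A H) (M : MDP S A H)
    (G : (j : Fin alg.deployments) → Dataset S A H alg.batch j → Traj S A H → ℝ)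
    (hGm : ∀ j : Fin alg.deployments, Measurable fun q : Dataset S A H alg.batch j × Traj S A H => G j q.1 q.2)
    (hG : ∀ (j : Fin alg.deployments) D, ∫⁻ τ, ENNReal.ofReal (Real.exp (G j D τ))
      ∂(M.mixLaw alg.policies (alg.weights j D)) ≤ 1) (L : ℝ) :
    alg.law M {D | ¬ ∑ j, ∑ n, G j (D.take j j.isLt.le) (D j n) ≤ L} ≤
      ENNReal.ofReal (Real.exp (-L)) := by
  have h1 := alg.lintegral_prod_le_one M (fun j D τ => ENNReal.ofReal (Real.exp (G j D τ)))
    (fun j => (hGm j).exp.ennreal_ofReal) hG alg.deployments le_rfl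
  have h2 : ∀ D : Dataset S A H alg.batch alg.deployments,
      ∏ j : Fin alg.deployments, ∏ n, ENNReal.ofReal (Real.exp
        (G (Fin.castLE le_rfl j) (D.take j j.isLt.le) (D j n))) =
      ENNReal.ofReal (Real.exp (∑ j, ∑ n, G j (D.take j j.isLt.le) (D j n))) := by
    intro D
    simp only [Real.exp_sum]
    rw [ENNReal.ofReal_prod_of_nonneg fun _ _ => Finset.prod_nonneg fun _ _ => (Real.exp_pos _).le]
    refine Finset.prod_congr rfl fun j _ => ?_
    rw [ENNReal.ofReal_prod_of_nonneg fun _ _ => (Real.exp_pos _).le]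
    rfl
  simp only [h2] at h1
  have h3 : Measurable fun D : Dataset S A H alg.batch alg.deployments =>
      ENNReal.ofReal (Real.exp (∑ j, ∑ n, G j (D.take j j.isLt.le) (D j n))) :=
    (alg.measurable_sum G hGm).exp.ennreal_ofReal
  have h4 := meas_ge_le_lintegral_div (μ := alg.law M) h3.aemeasurable
    (ε := ENNReal.ofReal (Real.exp L)) (by simp [Real.exp_pos]) (by simp)
  refine (measure_mono fun D hD => ?_).trans (h4.trans ?_)
  · have hD' : L < ∑ j, ∑ n, G j (D.take j j.isLt.le) (D j n) := not_le.1 hD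
    exact ENNReal.ofReal_le_ofReal (Real.exp_le_exp.2 hD'.le)
  · refine (ENNReal.div_le_div_right h1 _).trans ?_
    rw [Real.exp_neg, ENNReal.ofReal_inv_of_pos (Real.exp_pos _), one_div]

end ExponentialMoments

/-! ### Concentration of the batch covariance matrices. -/

section CovarianceConcentration

variable {S A : Type*} [MeasurableSpace S] [MeasurableSpace A] {H d : ℕ}

lemma MDP.integral_mixLaw_coord (M : MDP S A H) (φ : FeatureMap S A d)
    (T : Finset (DetPolicy S A H)) {p : T → ℝ} (hp : p ∈ stdSimplex ℝ T) (h : Fin H)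
    (a b : Fin d) :
    ∫ τ, φ (τ h).1 (τ h).2 a * φ (τ h).1 (τ h).2 b ∂(M.mixLaw T p) = M.mixCov φ T p h a b := by
  rw [MDP.mixLaw, integral_finsetSum_measure]
  · simp only [integral_smul_measure, MDP.mixCov, Matrix.sum_apply, Matrix.smul_apply,
      MDP.covariance, Matrix.of_apply]
    exact Finset.sum_congr rfl fun π _ => by rw [ENNReal.toReal_ofReal (hp.1 π)]
  · exact fun π _ => (M.integrable_coord_mul φ _ h a b).smul_measure ENNReal.ofReal_ne_top

/-- The sum of `φ φᵀ` over one batch. -/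
noncomputable def batchCov (φ : FeatureMap S A d) {N : ℕ} (b : Fin N → Traj S A H) (h : Fin H) :
    Matrix (Fin d) (Fin d) ℝ :=
  ∑ n, Matrix.vecMulVec (φ (b n h).1 (b n h).2).ofLp (φ (b n h).1 (b n h).2).ofLp

lemma batchCov_apply (φ : FeatureMap S A d) {N : ℕ} (b : Fin N → Traj S A H) (h : Fin H)
    (i j : Fin d) :
    batchCov φ b h i j = ∑ n, φ (b n h).1 (b n h).2 i * φ (b n h).1 (b n h).2 j := by
  simp [batchCov, Matrix.sum_apply, Matrix.vecMulVec_apply]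

/-- With high probability the empirical covariance matrix of every batch is close to the covariance
matrix of the deployed mixture. -/
lemma DeploymentAlgorithm.exists_covariance_event (alg : DeploymentAlgorithm S A H) (M : MDP S A H)
    (φ : FeatureMap S A d) (e : Fin alg.deployments → Fin H) {η L δ : ℝ} (hη : 0 < η)
    (hL : 2 * L ≤ alg.batch * η ^ 2)
    (hδ : alg.deployments * (d : ℝ) ^ 2 * 2 * Real.exp (-L) ≤ δ) :
    ∃ G : Set (Dataset S A H alg.batch alg.deployments), MeasurableSet G ∧
      alg.law M Gᶜ ≤ ENNReal.ofReal δ ∧ ∀ D ∈ G, ∀ (k : Fin alg.deployments) (i j : Fin d),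
        |(batchCov φ (D k) (e k) - (alg.batch : ℝ) •
          M.mixCov φ alg.policies (alg.weights k (D.take k k.isLt.le)) (e k)) i j| ≤
            alg.batch * η := by
  classical
  let g : (x : Fin alg.deployments × (Fin d × Fin d) × Bool) → (k : Fin alg.deployments) →
      Dataset S A H alg.batch k → Traj S A H → ℝ := fun x k D τ =>
    if k = x.1 then
      (if x.2.2 then η else -η) * (φ (τ (e k)).1 (τ (e k)).2 x.2.1.1 *
        φ (τ (e k)).1 (τ (e k)).2 x.2.1.2 -
        M.mixCov φ alg.policies (alg.weights k D) (e k) x.2.1.1 x.2.1.2) -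
          (if x.2.2 then η else -η) ^ 2 / 2
    else 0
  have hgm : ∀ x (k : Fin alg.deployments), Measurable fun q : Dataset S A H alg.batch k × Traj S A H =>
      g x k q.1 q.2 := by
    intro x k
    simp only [g]
    split_ifs
    all_goals first | exact measurable_const | skip
    all_goals
      refine Measurable.sub_const (Measurable.const_mul (Measurable.sub ?_ ?_) _) _
      · exact ((φ.measurable_coord _).mul (φ.measurable_coord _)).comp
          ((measurable_pi_apply (e k)).comp measurable_snd)
      · simp only [MDP.mixCov, Matrix.sum_apply, Matrix.smul_apply, smul_eq_mul]
        exact Finset.measurable_sum _ fun π _ => (((measurable_pi_apply π).comp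
          (alg.measurable_weights k)).comp measurable_fst).mul_const _
  have hg : ∀ x (k : Fin alg.deployments) D, ∫⁻ τ, ENNReal.ofReal (Real.exp (g x k D τ))
      ∂(M.mixLaw alg.policies (alg.weights k D)) ≤ 1 := by
    intro x k D
    have hp := M.isProbabilityMeasure_mixLaw _ _ (alg.weights_mem k D)
    by_cases hk : k = x.1
    · simp only [g, if_pos hk]
      rw [← M.integral_mixLaw_coord φ alg.policies (alg.weights_mem k D) (e k)]
      refine lintegral_exp_hoeffding (V := fun τ : Traj S A H => φ (τ (e k)).1 (τ (e k)).2 x.2.1.1 *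
        φ (τ (e k)).1 (τ (e k)).2 x.2.1.2) (((φ.measurable_coord _).mul (φ.measurable_coord _)).comp
          (measurable_pi_apply (e k))) (fun τ => ?_) _
      rw [Set.mem_Icc, ← abs_le, abs_mul]
      exact mul_le_one₀ (φ.abs_coord_le _ _ _) (abs_nonneg _) (φ.abs_coord_le _ _ _)
    · simp only [g, if_neg hk]
      simp
  let E : Fin alg.deployments × (Fin d × Fin d) × Bool →
      Set (Dataset S A H alg.batch alg.deployments) :=
    fun x => {D | ∑ k, ∑ n, g x k (D.take k k.isLt.le) (D k n) ≤ L}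
  have hE : ∀ x, MeasurableSet (E x) := fun x =>
    measurableSet_of_sum_le (alg.measurable_sum (g x) (hgm x)) L
  refine ⟨⋂ x, E x, MeasurableSet.iInter hE, ?_, ?_⟩
  · rw [Set.compl_iInter]
    calc alg.law M (⋃ x, (E x)ᶜ) ≤ ∑ x, alg.law M (E x)ᶜ := measure_iUnion_fintype_le _ _
      _ ≤ ∑ _x : Fin alg.deployments × (Fin d × Fin d) × Bool, ENNReal.ofReal (Real.exp (-L)) :=
        Finset.sum_le_sum fun x _ => alg.law_sum_gt_le M (g x) (hgm x) (hg x) L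
      _ = ENNReal.ofReal (alg.deployments * (d : ℝ) ^ 2 * 2 * Real.exp (-L)) := by
        rw [← ENNReal.ofReal_sum_of_nonneg fun _ _ => (Real.exp_pos _).le]
        congr 1
        simp
        ring
      _ ≤ ENNReal.ofReal δ := ENNReal.ofReal_le_ofReal hδ
  · intro D hD k i j
    have key : ∀ b : Bool, (if b then η else -η) * (batchCov φ (D k) (e k) - (alg.batch : ℝ) •
          M.mixCov φ alg.policies (alg.weights k (D.take k k.isLt.le)) (e k)) i j ≤
            alg.batch * η * η := by
      intro b
      have h1 : ∑ k', ∑ n, g (k, (i, j), b) k' (D.take k' k'.isLt.le) (D k' n) ≤ L :=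
        Set.mem_iInter.1 hD (k, (i, j), b)
      rw [Finset.sum_eq_single k] at h1
      · simp only [g, if_true] at h1
        rw [Finset.sum_sub_distrib, ← Finset.mul_sum, Finset.sum_sub_distrib] at h1
        simp only [Finset.sum_const, Finset.card_univ, Fintype.card_fin, nsmul_eq_mul] at h1
        simp only [Matrix.sub_apply, Matrix.smul_apply, smul_eq_mul, batchCov_apply]
        have h2 : (if b = true then η else -η) ^ 2 = η ^ 2 := by split_ifs <;> ring
        rw [h2] at h1
        nlinarith
      · intro k' _ hk'
        simp [g, hk']
      · simp
    have k1 := key true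
    have k2 := key false
    simp only [if_true, Bool.false_eq_true, if_false] at k1 k2
    rw [abs_le]
    constructor
    · by_contra hcon
      push Not at hcon
      nlinarith
    · by_contra hcon
      push Not at hcon
      nlinarith

end CovarianceConcentration

/-! ### Ridge regression and its noise. -/

section Regression

variable {S A : Type*} [MeasurableSpace S] [MeasurableSpace A] {H d N k : ℕ}

lemma quad_empCov (φ : FeatureMap S A d) (D : Dataset S A H N k) (h : Fin H) (x : Vec d) :
    quad (empCov φ D h) x =
      ‖x‖ ^ 2 + ∑ i, ∑ n, (inner ℝ (φ (D i n h).1 (D i n h).2) x) ^ 2 := by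
  simp only [empCov, quad_add, quad_one, quad_sum, quad_vecMulVec, real_inner_comm]

lemma isHermitian_vecMulVec_self (x : Fin d → ℝ) : (Matrix.vecMulVec x x).IsHermitian := by
  ext i j
  simp [Matrix.vecMulVec_apply, mul_comm]

lemma norm_sq_le_quad_empCov (φ : FeatureMap S A d) (D : Dataset S A H N k) (h : Fin H)
    (x : Vec d) : ‖x‖ ^ 2 ≤ quad (empCov φ D h) x := by
  rw [quad_empCov]
  exact le_add_of_nonneg_right (Finset.sum_nonneg fun _ _ => Finset.sum_nonneg fun _ _ => sq_nonneg _)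

lemma posDef_empCov (φ : FeatureMap S A d) (D : Dataset S A H N k) (h : Fin H) :
    (empCov φ D h).PosDef := by
  refine Matrix.PosDef.one.add_posSemidef (Matrix.posSemidef_sum _ fun i _ =>
    Matrix.posSemidef_sum _ fun n _ => posSemidef_of_quad (isHermitian_vecMulVec_self _) fun x => ?_)
  rw [quad_vecMulVec]
  exact sq_nonneg _

/-- The sum `∑ φ(s_h, a_h) (V(s_{h+1}) - (P_h V)(s_h, a_h))` over a data set. -/
noncomputable def noiseVec (φ : FeatureMap S A d) (M : MDP S A H) (D : Dataset S A H N k)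
    (h : Fin H) (V : S → ℝ) : Vec d :=
  ∑ i, ∑ n, (nextValue V (D i n) h - M.transition h V (D i n h).1 (D i n h).2) •
    φ (D i n h).1 (D i n h).2

/-- A self-normalized sum is controlled by the exponent of an exponential supermartingale. -/
lemma quad_inv_noiseVec_le (φ : FeatureMap S A d) (M : MDP S A H) (D : Dataset S A H N k)
    (h : Fin H) (V : S → ℝ) {L : ℝ} {x : Vec d}
    (hx : x = WithLp.toLp 2 ((empCov φ D h)⁻¹ *ᵥ (noiseVec φ M D h V).ofLp))
    (hL : ∑ i, ∑ n, (inner ℝ (φ (D i n h).1 (D i n h).2) x *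
        (nextValue V (D i n) h - M.transition h V (D i n h).1 (D i n h).2) -
          (inner ℝ (φ (D i n h).1 (D i n h).2) x) ^ 2 / 2) ≤ L) :
    quad (empCov φ D h)⁻¹ (noiseVec φ M D h V) ≤ 2 * L := by
  set q := quad (empCov φ D h)⁻¹ (noiseVec φ M D h V) with hq
  have h1 : inner ℝ (noiseVec φ M D h V) x = q := by
    rw [inner_eq_dotProduct, hx, hq, quad]
  have h2 : quad (empCov φ D h) x = q := by
    rw [quad, hx, hq, quad]
    simp only [inv_mulVec_mulVec (posDef_empCov φ D h)]
    exact dotProduct_comm _ _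
  have h3 : ∑ i, ∑ n, inner ℝ (φ (D i n h).1 (D i n h).2) x *
      (nextValue V (D i n) h - M.transition h V (D i n h).1 (D i n h).2) = q := by
    rw [← h1, noiseVec, sum_inner]
    refine Finset.sum_congr rfl fun i _ => ?_
    rw [sum_inner]
    refine Finset.sum_congr rfl fun n _ => ?_
    rw [inner_smul_left, mul_comm]
    rfl
  -- At this `x` the linear part of the exponent is `q` and the quadratic part is `(q - ‖x‖²)/2`, so
  -- the exponent is at least `q/2`.
  have h4 := quad_empCov φ D h x
  simp only [Finset.sum_sub_distrib, ← Finset.sum_div] at hL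
  have h5 := sq_nonneg ‖x‖
  linarith

lemma nextValue_mem {S A : Type*} {H : ℕ} {V : S → ℝ} {B : ℝ} (hB : 0 ≤ B) (hV : ∀ s, V s ∈ Set.Icc 0 B)
    (τ : Traj S A H) (h : Fin H) : nextValue V τ h ∈ Set.Icc 0 B := by
  unfold nextValue
  split_ifs
  · exact hV _
  · exact ⟨le_rfl, hB⟩

lemma norm_sum_smul_feature_le (φ : FeatureMap S A d) (D : Dataset S A H N k) (h : Fin H)
    (c : Fin k → Fin N → ℝ) {B : ℝ} (hc : ∀ i n, |c i n| ≤ B) :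
    ‖∑ i, ∑ n, c i n • φ (D i n h).1 (D i n h).2‖ ≤ k * N * B := by
  calc ‖∑ i, ∑ n, c i n • φ (D i n h).1 (D i n h).2‖
      ≤ ∑ _i : Fin k, ∑ _n : Fin N, B := by
        refine (norm_sum_le _ _).trans (Finset.sum_le_sum fun i _ => ?_)
        refine (norm_sum_le _ _).trans (Finset.sum_le_sum fun n _ => ?_)
        rw [norm_smul]
        calc _ ≤ ‖c i n‖ * 1 := by gcongr; exact φ.norm_le_one _ _
          _ ≤ B := by rw [mul_one]; exact hc i n
    _ = k * N * B := by simp [mul_assoc]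

/-- A deterministic bound: one unit per trajectory. It confines the random direction `Λ⁻¹ · noise`
to the ball covered by the grid. -/
lemma norm_noiseVec_le (φ : FeatureMap S A d) (M : MDP S A H) (D : Dataset S A H N k)
    (h : Fin H) {V : S → ℝ} (hV : Measurable V) (hV1 : ∀ s, V s ∈ Set.Icc (0 : ℝ) 1) :
    ‖noiseVec φ M D h V‖ ≤ k * N := by
  have := norm_sum_smul_feature_le φ D h (B := 1)
    (fun i n => nextValue V (D i n) h - M.transition h V (D i n h).1 (D i n h).2) fun i n => by
      have h1 := nextValue_mem zero_le_one hV1 (D i n) h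
      have h2 := M.transition_mem_Icc h hV hV1 (D i n h).1 (D i n h).2
      rw [abs_le]
      exact ⟨by linarith [h1.1, h2.2], by linarith [h1.2, h2.1]⟩
  simpa [noiseVec] using this

lemma ofLp_sum_smul_feature (φ : FeatureMap S A d) (D : Dataset S A H N k) (h : Fin H)
    (c : Fin k → Fin N → ℝ) :
    (∑ i, ∑ n, c i n • φ (D i n h).1 (D i n h).2 : Vec d).ofLp =
      ∑ i, ∑ n, c i n • (φ (D i n h).1 (D i n h).2).ofLp := by
  simp [WithLp.ofLp_sum]

/-- A priori control of the regression output for every data set. After division by `B` the weights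
stay within the parameter radius, so the function class is stable under backups. -/
lemma norm_ridgeWeights_le (φ : FeatureMap S A d) (D : Dataset S A H N k) (h : Fin H)
    {V : S → ℝ} {B : ℝ} (hB : 0 ≤ B) (hV : ∀ s, V s ∈ Set.Icc 0 B) :
    ‖(WithLp.toLp 2 (ridgeWeights φ D h V) : Vec d)‖ ≤ k * N * B := by
  rw [ridgeWeights, ← ofLp_sum_smul_feature]
  refine (norm_inv_mulVec_le (posDef_empCov φ D h) (norm_sq_le_quad_empCov φ D h) _).trans ?_
  refine norm_sum_smul_feature_le φ D h (fun i n => nextValue V (D i n) h) fun i n => ?_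
  have h1 := nextValue_mem hB hV (D i n) h
  rw [abs_of_nonneg h1.1]
  exact h1.2

/-- The error of ridge regression in terms of the noise. -/
lemma abs_ridge_sub_transition_le (φ : FeatureMap S A d) (M : MDP S A H) (D : Dataset S A H N k)
    (h : Fin H) {V : S → ℝ} {w : Vec d} {C : ℝ} (hw : ‖w‖ ≤ C)
    (hwt : ∀ s a, M.transition h V s a = inner ℝ (φ s a) w) (s : S) (a : A) :
    |(φ s a).ofLp ⬝ᵥ ridgeWeights φ D h V - M.transition h V s a| ≤
      (√(quad (empCov φ D h)⁻¹ (noiseVec φ M D h V)) + C) *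
        √(quad (empCov φ D h)⁻¹ (φ s a)) := by
  have hΛ := posDef_empCov φ D h
  -- The targets split into noise and conditional means, the latter giving `(Λ - 1) w`. Thus the
  -- estimate minus `w` is `Λ⁻¹ noise - Λ⁻¹ w`, and the second term is the ridge bias.
  have h1 : ∑ i, ∑ n, nextValue V (D i n) h • (φ (D i n h).1 (D i n h).2).ofLp =
      (noiseVec φ M D h V).ofLp + (empCov φ D h *ᵥ w.ofLp - w.ofLp) := by
    rw [noiseVec, ofLp_sum_smul_feature]
    simp only [sub_smul, Finset.sum_sub_distrib]
    have : empCov φ D h *ᵥ w.ofLp - w.ofLp = ∑ i, ∑ n,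
        M.transition h V (D i n h).1 (D i n h).2 • (φ (D i n h).1 (D i n h).2).ofLp := by
      simp only [empCov, Matrix.add_mulVec, Matrix.one_mulVec, add_sub_cancel_left,
        Matrix.sum_mulVec, hwt, inner_eq_dotProduct, Matrix.vecMulVec_mulVec]
      refine Finset.sum_congr rfl fun i _ => Finset.sum_congr rfl fun n _ => ?_
      ext j
      simp [mul_comm]
    rw [this]
    abel
  have h2 : ridgeWeights φ D h V = (empCov φ D h)⁻¹ *ᵥ (noiseVec φ M D h V).ofLp + w.ofLp -
      (empCov φ D h)⁻¹ *ᵥ w.ofLp := by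
    rw [ridgeWeights, h1, Matrix.mulVec_add, Matrix.mulVec_sub, mulVec_inv_mulVec hΛ]
    abel
  rw [h2, hwt, inner_eq_dotProduct, dotProduct_sub, dotProduct_add]
  have h3 := abs_dotProduct_inv_mulVec_le hΛ (φ s a) (noiseVec φ M D h V)
  have h4 := abs_dotProduct_inv_mulVec_le hΛ (φ s a) w
  have h5 : √(quad (empCov φ D h)⁻¹ w) ≤ C := by
    refine Real.sqrt_le_iff.2 ⟨(norm_nonneg _).trans hw, ?_⟩
    have := quad_inv_le_norm_sq hΛ one_pos (by simpa using norm_sq_le_quad_empCov φ D h) w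
    rw [inv_one, one_mul] at this
    refine this.trans ?_
    gcongr
  have h6 : √(quad (empCov φ D h)⁻¹ (φ s a)) * √(quad (empCov φ D h)⁻¹ w) ≤
      √(quad (empCov φ D h)⁻¹ (φ s a)) * C := by gcongr
  rw [abs_le] at h3 h4 ⊢
  constructor
  · linarith [h3.1, h4.2]
  · linarith [h3.2, h4.1]

/-- Homogeneity allows a single concentration event for `[0, 1]`-valued functions to serve estimates
with any bound `B`. -/
lemma ridgeWeights_const_mul (φ : FeatureMap S A d) (D : Dataset S A H N k) (h : Fin H) (B : ℝ)
    (V : S → ℝ) : ridgeWeights φ D h (fun s => B * V s) = B • ridgeWeights φ D h V := by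
  have h1 : ∀ τ : Traj S A H, nextValue (fun s => B * V s) τ h = B * nextValue V τ h := by
    intro τ
    unfold nextValue
    split_ifs <;> simp
  simp only [ridgeWeights, h1, mul_smul, ← Finset.smul_sum, Matrix.mulVec_smul]

lemma ridgeWeights_zero (φ : FeatureMap S A d) (D : Dataset S A H N k) (h : Fin H) :
    ridgeWeights φ D h (fun _ => 0) = 0 := by
  have := ridgeWeights_const_mul φ D h 0 (fun _ => 0)
  simpa using this

end Regression

/-! ### Self-normalized concentration, uniform over a function class. -/

section UniformConcentration

variable {S A : Type*} [MeasurableSpace S] [MeasurableSpace A] {H d : ℕ}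

/-- Truncated linear combinations of features along a decision rule. -/
noncomputable def clippedFun {J : Type*} [Fintype J] (ψ : J → S → A → ℝ) (ρ : DetRule S A)
    (θ : J → ℝ) (s : S) : ℝ :=
  clip 1 (∑ j, θ j * ψ j s (ρ.1 s))

variable {J : Type*} [Fintype J] {ψ : J → S → A → ℝ}

lemma measurable_clippedFun (hψ : ∀ j, Measurable fun p : S × A => ψ j p.1 p.2) (ρ : DetRule S A)
    (θ : J → ℝ) : Measurable (clippedFun ψ ρ θ) :=
  (measurable_clip 1).comp (Finset.measurable_sum _ fun j _ =>
    ((hψ j).comp (measurable_prod_rule ρ)).const_mul _)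

lemma clippedFun_mem (ρ : DetRule S A) (θ : J → ℝ) (s : S) :
    clippedFun ψ ρ θ s ∈ Set.Icc (0 : ℝ) 1 := clip_mem zero_le_one _

lemma abs_clippedFun_sub_le (hψ1 : ∀ j s a, |ψ j s a| ≤ 1) (ρ : DetRule S A) {θ θ' : J → ℝ}
    {η : ℝ} (hη : ∀ j, |θ j - θ' j| ≤ η) (s : S) :
    |clippedFun ψ ρ θ s - clippedFun ψ ρ θ' s| ≤ Fintype.card J * η := by
  refine (abs_clip_sub_clip_le _ _ _).trans ?_
  rw [← Finset.sum_sub_distrib]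
  calc _ ≤ ∑ _j : J, η := by
        refine (Finset.abs_sum_le_sum_abs _ _).trans (Finset.sum_le_sum fun j _ => ?_)
        rw [← sub_mul, abs_mul]
        calc _ ≤ η * 1 := mul_le_mul (hη j) (hψ1 _ _ _) (abs_nonneg _) ((abs_nonneg _).trans (hη j))
          _ = η := mul_one _
    _ = _ := by simp

lemma exists_grid_point {ι : Type*} [Fintype ι] [DecidableEq ι] {R Q : ℕ} (hQ : 0 < Q) (x : ι → ℝ)
    (hx : ∀ i, |x i| ≤ R) :
    ∃ z ∈ Fintype.piFinset fun _ : ι => Finset.Icc (-((R * Q : ℕ) : ℤ)) ((R * Q : ℕ) : ℤ),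
      ∀ i, |x i - (z i : ℝ) / Q| ≤ (Q : ℝ)⁻¹ := by
  have hQ' : (0 : ℝ) < Q := by exact_mod_cast hQ
  refine ⟨fun i => ⌊x i * Q⌋, ?_, fun i => ?_⟩
  · rw [Fintype.mem_piFinset]
    intro i
    have h1 := abs_le.1 (hx i)
    rw [Finset.mem_Icc]
    constructor
    · rw [Int.le_floor]
      push_cast
      nlinarith [h1.1]
    · have : ((⌊x i * Q⌋ : ℤ) : ℝ) ≤ ((R * Q : ℕ) : ℤ) := by
        refine (Int.floor_le _).trans ?_
        push_cast
        nlinarith [h1.2]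
      exact_mod_cast this
  · have h1 := Int.floor_le (x i * Q)
    have h2 := Int.lt_floor_add_one (x i * Q)
    have h3 : x i - (⌊x i * Q⌋ : ℝ) / Q = (x i * Q - ⌊x i * Q⌋) * (Q : ℝ)⁻¹ := by field_simp
    rw [h3, abs_mul, abs_of_pos (inv_pos.2 hQ'), abs_of_nonneg (by linarith)]
    exact mul_le_of_le_one_left (inv_pos.2 hQ').le (by linarith)

/-- The exponent of the exponential supermartingale of one trajectory. -/
noncomputable def regressionExponent (φ : FeatureMap S A d) (M : MDP S A H) (h : Fin H)
    (V : S → ℝ) (x : Vec d) (τ : Traj S A H) : ℝ :=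
  inner ℝ (φ (τ h).1 (τ h).2) x * (nextValue V τ h - M.transition h V (τ h).1 (τ h).2) -
    (inner ℝ (φ (τ h).1 (τ h).2) x) ^ 2 / 2

lemma measurable_nextValue {V : S → ℝ} (hV : Measurable V) (h : Fin H) :
    Measurable fun τ : Traj S A H => nextValue V τ h := by
  unfold nextValue
  split_ifs
  · exact hV.comp (measurable_fst.comp (measurable_pi_apply _))
  · exact measurable_const

lemma measurable_regressionExponent (φ : FeatureMap S A d) (M : MDP S A H) (h : Fin H)
    {V : S → ℝ} (hV : Measurable V) (x : Vec d) : Measurable (regressionExponent φ M h V x) := by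
  have h1 : Measurable fun τ : Traj S A H => inner ℝ (φ (τ h).1 (τ h).2) x :=
    (φ.measurable_inner x).comp (measurable_pi_apply h)
  have h2 : Measurable fun τ : Traj S A H => M.transition h V (τ h).1 (τ h).2 :=
    (M.measurable_transition h hV).comp (measurable_pi_apply h)
  exact (h1.mul ((measurable_nextValue hV h).sub h2)).sub ((h1.pow_const 2).div_const 2)

/-- Given `(s_h, a_h)`, this is Hoeffding's lemma for `V(s_{h+1})` with tilt `⟨φ, x⟩`. The last
layer is excluded: `nextValue` is set to `0` there, which is not distributed according to the
kernel. -/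
lemma MDP.lintegral_exp_regressionExponent_le (M : MDP S A H) (φ : FeatureMap S A d)
    (π : Policy S A H) (h : Fin H) (hh : h.1 + 1 < H) {V : S → ℝ} (hV : Measurable V)
    (hV1 : ∀ s, V s ∈ Set.Icc (0 : ℝ) 1) (x : Vec d) :
    ∫⁻ τ, ENNReal.ofReal (Real.exp (regressionExponent φ M h V x τ)) ∂(M.trajLaw π) ≤ 1 := by
  let F : (S × A) × S → ENNReal := fun q => ENNReal.ofReal (Real.exp
    (inner ℝ (φ q.1.1 q.1.2) x * (V q.2 - M.transition h V q.1.1 q.1.2) -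
      (inner ℝ (φ q.1.1 q.1.2) x) ^ 2 / 2))
  have hF : Measurable F := by
    have h1 : Measurable fun q : (S × A) × S => inner ℝ (φ q.1.1 q.1.2) x :=
      (φ.measurable_inner x).comp measurable_fst
    have h2 : Measurable fun q : (S × A) × S => M.transition h V q.1.1 q.1.2 :=
      (M.measurable_transition h hV).comp measurable_fst
    exact ((h1.mul ((hV.comp measurable_snd).sub h2)).sub
      ((h1.pow_const 2).div_const 2)).exp.ennreal_ofReal
  have h1 := M.lintegral_next π h hh hF
  have h2 : ∀ τ : Traj S A H, F (τ h, (τ ⟨h.1 + 1, hh⟩).1) =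
      ENNReal.ofReal (Real.exp (regressionExponent φ M h V x τ)) := by
    intro τ
    simp only [F, regressionExponent, nextValue, dif_pos hh]
  simp only [h2] at h1
  rw [h1]
  calc _ ≤ ∫⁻ _τ, 1 ∂(M.trajLaw π) := lintegral_mono fun τ =>
        lintegral_exp_hoeffding (μ := M.P h (τ h)) hV
          (fun s => ⟨by linarith [(hV1 s).1], (hV1 s).2⟩) (inner ℝ (φ (τ h).1 (τ h).2) x)
    _ = 1 := by simp

/-- It lets exponents switched off after the first `k` deployments live on the full data set, so
that one probability space treats all prefixes. -/
lemma sum_ite_lt_eq_sum_castLE {k m : ℕ} (hk : k ≤ m) (f : Fin m → ℝ) :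
    ∑ j : Fin m, (if j.1 < k then f j else 0) = ∑ j : Fin k, f (Fin.castLE hk j) := by
  obtain ⟨l, rfl⟩ := Nat.exists_eq_add_of_le hk
  rw [Fin.sum_univ_add]
  simp
  rfl

/-- Changing the direction and the value function slightly changes the exponent slightly. -/
lemma regressionExponent_le (φ : FeatureMap S A d) (M : MDP S A H) (h : Fin H) {V V' : S → ℝ}
    (hV : Measurable V) (hV' : Measurable V') (hV1 : ∀ s, V s ∈ Set.Icc (0 : ℝ) 1)
    (hV1' : ∀ s, V' s ∈ Set.Icc (0 : ℝ) 1) {η R : ℝ} (hη0 : 0 ≤ η)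
    (hVV : ∀ s, |V s - V' s| ≤ η) {x x' : Vec d} (hx : ‖x‖ ≤ R) {κ : ℝ}
    (hκ : ∀ s a, |inner ℝ (φ s a) x - inner ℝ (φ s a) x'| ≤ κ) (τ : Traj S A H) :
    regressionExponent φ M h V x τ ≤ regressionExponent φ M h V' x' τ +
      (R * (2 * η) + κ + κ * (R + κ)) := by
  have hd1 : |nextValue V τ h - nextValue V' τ h| ≤ η := by
    unfold nextValue
    split_ifs
    · exact hVV _
    · simpa using hη0
  have hd2 : |M.transition h V (τ h).1 (τ h).2 - M.transition h V' (τ h).1 (τ h).2| ≤ η := by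
    rw [← M.transition_sub h hV hV' (B := 1) (C := 1)
      (fun s => abs_le.2 ⟨by linarith [(hV1 s).1], (hV1 s).2⟩)
      (fun s => abs_le.2 ⟨by linarith [(hV1' s).1], (hV1' s).2⟩)]
    exact M.abs_transition_le h hVV _ _
  have hb1 := nextValue_mem zero_le_one hV1' τ h
  have hb2 := M.transition_mem_Icc h hV' hV1' (τ h).1 (τ h).2
  have ha := (φ.abs_inner_le x (τ h).1 (τ h).2).trans hx
  have hk := hκ (τ h).1 (τ h).2
  unfold regressionExponent
  set a := inner ℝ (φ (τ h).1 (τ h).2) x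
  set a' := inner ℝ (φ (τ h).1 (τ h).2) x'
  set y := nextValue V τ h
  set y' := nextValue V' τ h
  set p := M.transition h V (τ h).1 (τ h).2
  set p' := M.transition h V' (τ h).1 (τ h).2
  have hκ0 : 0 ≤ κ := (abs_nonneg _).trans hk
  have hR0 : 0 ≤ R := (abs_nonneg _).trans ha
  have e1 : |a * ((y - p) - (y' - p'))| ≤ R * (2 * η) := by
    rw [abs_mul]
    refine mul_le_mul ha ?_ (abs_nonneg _) hR0
    have : (y - p) - (y' - p') = (y - y') - (p - p') := by ring
    rw [this]
    exact (abs_sub _ _).trans (by linarith)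
  have e2 : |(a - a') * (y' - p')| ≤ κ := by
    rw [abs_mul]
    have : |y' - p'| ≤ 1 := abs_le.2 ⟨by linarith [hb1.1, hb2.2], by linarith [hb1.2, hb2.1]⟩
    calc _ ≤ κ * 1 := mul_le_mul hk this (abs_nonneg _) hκ0
      _ = κ := mul_one _
  have e3 : |(a - a') * ((a + a') / 2)| ≤ κ * (R + κ) := by
    rw [abs_mul]
    refine mul_le_mul hk ?_ (abs_nonneg _) hκ0
    have : (a + a') / 2 = a - (a - a') / 2 := by ring
    rw [this]
    refine (abs_sub _ _).trans ?_
    rw [abs_div, abs_two]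
    linarith [abs_nonneg (a - a')]
  have e1' := (abs_le.1 e1).2
  have e2' := (abs_le.1 e2).2
  have e3' := (abs_le.1 e3).1
  nlinarith

/-- Self-normalized concentration, uniformly over truncated linear functions along finitely many
decision rules. -/
lemma DeploymentAlgorithm.exists_uniform_event (alg : DeploymentAlgorithm S A H) (M : MDP S A H)
    (φ : FeatureMap S A d) (hψ : ∀ j, Measurable fun p : S × A => ψ j p.1 p.2)
    (hψ1 : ∀ j s a, |ψ j s a| ≤ 1) (rules : Fin H → Finset (DetRule S A)) {c : ℝ}
    (hc : ∀ h, ((rules h).card : ℝ) ≤ c) {R : ℕ} (hRd : d ≤ R) (hd : 0 < d)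
    (hRN : alg.deployments * alg.batch ≤ R) {L δ : ℝ}
    (hδ : H * (alg.deployments + 1) * c *
      (2 * (R : ℝ) ^ 3 * (2 * Fintype.card J + 3 * d) + 1) ^ (d + Fintype.card J) *
        Real.exp (-L) ≤ δ) :
    ∃ G : Set (Dataset S A H alg.batch alg.deployments), MeasurableSet G ∧
      alg.law M Gᶜ ≤ ENNReal.ofReal δ ∧ ∀ D ∈ G, ∀ (k : ℕ) (hk : k ≤ alg.deployments) (h : Fin H)
        (hh : h.1 + 1 < H), ∀ ρ ∈ rules ⟨h.1 + 1, hh⟩, ∀ θ : J → ℝ, (∀ j, |θ j| ≤ R) →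
          quad (empCov φ (D.take k hk) h)⁻¹ (noiseVec φ M (D.take k hk) h (clippedFun ψ ρ θ)) ≤
            2 * (L + 1) := by
  classical
  set m := 2 * Fintype.card J + 3 * d with hm
  -- Resolution at which rounding direction and parameters changes the exponent of one trajectory by
  -- at most `1/R`, hence a sum over at most `R` trajectories by at most `1`. This is the `+ 1` in
  -- `2 * (L + 1)`.
  set Q : ℕ := R ^ 2 * m with hQdef
  have hR : 0 < R := hd.trans_le hRd
  have hQ : 0 < Q := by positivity
  let Z := Fintype.piFinset fun _ : Fin d ⊕ J =>
    Finset.Icc (-((R * Q : ℕ) : ℤ)) ((R * Q : ℕ) : ℤ)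
  have hZ : (Z.card : ℝ) = (2 * (R : ℝ) ^ 3 * (2 * Fintype.card J + 3 * d) + 1) ^
      (d + Fintype.card J) := by
    have h1 : Z.card = (2 * R * Q + 1) ^ (d + Fintype.card J) := by
      simp only [Z, Fintype.card_piFinset, Int.card_Icc, Finset.prod_const, Finset.card_univ,
        Fintype.card_sum, Fintype.card_fin]
      congr 1
      push_cast
      have : ((R : ℤ) * Q + 1 - -(R * Q)) = ((2 * R * Q + 1 : ℕ) : ℤ) := by push_cast; ring
      rw [this, Int.toNat_natCast]
    rw [h1, hQdef, hm]
    push_cast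
    ring
  let dir : (Fin d ⊕ J → ℤ) → Vec d := fun z => WithLp.toLp 2 fun i => (z (Sum.inl i) : ℝ) / Q
  let par : (Fin d ⊕ J → ℤ) → J → ℝ := fun z j => (z (Sum.inr j) : ℝ) / Q
  let nxt : Fin H → Finset (DetRule S A) := fun h =>
    if hh : h.1 + 1 < H then rules ⟨h.1 + 1, hh⟩ else ∅
  have hnxt : ∀ h, ((nxt h).card : ℝ) ≤ c := by
    intro h
    have hc0 : 0 ≤ c := (Nat.cast_nonneg _).trans (hc h)
    simp only [nxt]
    split_ifs
    · exact hc _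
    · simpa using hc0
  -- The union bound runs over layers, prefix lengths, rules of the next layer and grid points. At
  -- the last layer the set of rules is empty, which removes the case without a moment bound.
  let I := Finset.univ.sigma fun h : Fin H =>
    (Finset.univ : Finset (Fin (alg.deployments + 1))) ×ˢ (nxt h ×ˢ Z)
  let g : ((_ : Fin H) × (Fin (alg.deployments + 1) × (DetRule S A × (Fin d ⊕ J → ℤ)))) →
      (j : Fin alg.deployments) → Dataset S A H alg.batch j → Traj S A H → ℝ := fun x j _ τ =>
    if j.1 < x.2.1.1 then
      regressionExponent φ M x.1 (clippedFun ψ x.2.2.1 (par x.2.2.2)) (dir x.2.2.2) τ else 0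
  have hgm : ∀ x (j : Fin alg.deployments),
      Measurable fun q : Dataset S A H alg.batch j × Traj S A H => g x j q.1 q.2 := by
    intro x j
    simp only [g]
    split_ifs
    · exact (measurable_regressionExponent φ M _ (measurable_clippedFun hψ _ _) _).comp
        measurable_snd
    · exact measurable_const
  have hg : ∀ x ∈ I, ∀ (j : Fin alg.deployments) D, ∫⁻ τ, ENNReal.ofReal (Real.exp (g x j D τ))
      ∂(M.mixLaw alg.policies (alg.weights j D)) ≤ 1 := by
    rintro ⟨h, k, ρ, z⟩ hx j D
    refine M.lintegral_mixLaw_le_one _ (alg.weights_mem j D) fun π => ?_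
    have hh : h.1 + 1 < H := by
      by_contra hcon
      simp [I, nxt, hcon] at hx
    simp only [g]
    split_ifs
    · exact M.lintegral_exp_regressionExponent_le φ _ h hh (measurable_clippedFun hψ _ _)
        (clippedFun_mem _ _) _
    · simp
  let E : ((_ : Fin H) × (Fin (alg.deployments + 1) × (DetRule S A × (Fin d ⊕ J → ℤ)))) →
      Set (Dataset S A H alg.batch alg.deployments) :=
    fun x => {D | ∑ j, ∑ n, g x j (D.take j j.isLt.le) (D j n) ≤ L}
  have hE : ∀ x, MeasurableSet (E x) := fun x =>
    measurableSet_of_sum_le (alg.measurable_sum (g x) (hgm x)) L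
  refine ⟨⋂ x ∈ I, E x, Finset.measurableSet_biInter _ fun x _ => hE x, ?_, ?_⟩
  · simp only [Set.compl_iInter]
    calc alg.law M (⋃ x ∈ I, (E x)ᶜ) ≤ ∑ x ∈ I, alg.law M (E x)ᶜ := measure_biUnion_finset_le _ _
      _ ≤ ∑ _x ∈ I, ENNReal.ofReal (Real.exp (-L)) :=
        Finset.sum_le_sum fun x hx => alg.law_sum_gt_le M (g x) (hgm x) (hg x hx) L
      _ = ENNReal.ofReal (I.card * Real.exp (-L)) := by
        rw [← ENNReal.ofReal_sum_of_nonneg fun _ _ => (Real.exp_pos _).le]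
        simp
      _ ≤ ENNReal.ofReal δ := by
        refine ENNReal.ofReal_le_ofReal (le_trans ?_ hδ)
        gcongr
        rw [← hZ]
        simp only [I, Finset.card_sigma, Finset.card_product, Finset.card_univ, Fintype.card_fin]
        push_cast
        calc ∑ h : Fin H, ((alg.deployments : ℝ) + 1) * ((nxt h).card * Z.card)
            ≤ ∑ _h : Fin H, ((alg.deployments : ℝ) + 1) * (c * Z.card) := by
              refine Finset.sum_le_sum fun h _ => ?_
              gcongr
              exact hnxt h
          _ = _ := by simp; ring
  · intro D hD k hk h hh ρ hρ θ hθ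
    set D' := D.take k hk
    set V := clippedFun ψ ρ θ
    have hV : Measurable V := measurable_clippedFun hψ ρ θ
    have hV1 : ∀ s, V s ∈ Set.Icc (0 : ℝ) 1 := clippedFun_mem ρ θ
    have hkR : (k : ℝ) * alg.batch ≤ R := by
      have : k * alg.batch ≤ R := (Nat.mul_le_mul_right _ hk).trans hRN
      exact_mod_cast this
    -- The direction depends on the data, so no moment bound applies to it directly; its rounding to
    -- the grid is covered by the event.
    set x : Vec d := WithLp.toLp 2 ((empCov φ D' h)⁻¹ *ᵥ (noiseVec φ M D' h V).ofLp) with hxdef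
    have hxR : ‖x‖ ≤ R :=
      ((norm_inv_mulVec_le (posDef_empCov φ D' h) (norm_sq_le_quad_empCov φ D' h) _).trans
        (norm_noiseVec_le φ M D' h hV hV1)).trans hkR
    obtain ⟨z, hz, hzx⟩ := exists_grid_point (R := R) hQ (Sum.elim (fun i => x i) θ) (by
      rintro (i | j)
      · exact (abs_coord_le_norm x i).trans hxR
      · exact hθ j)
    refine quad_inv_noiseVec_le φ M D' h V hxdef ?_
    have hDz : ∑ j, ∑ n, g ⟨h, (⟨k, by omega⟩, (ρ, z))⟩ j (D.take j j.isLt.le) (D j n) ≤ L := by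
      have hmem : (⟨h, (⟨k, by omega⟩, (ρ, z))⟩ : (_ : Fin H) × (Fin (alg.deployments + 1) ×
          (DetRule S A × (Fin d ⊕ J → ℤ)))) ∈ I := by
        simp only [I, Finset.mem_sigma, Finset.mem_univ, Finset.mem_product, true_and, nxt,
          dif_pos hh]
        exact ⟨hρ, hz⟩
      exact Set.mem_iInter₂.1 hD _ hmem
    have hsum : ∑ j : Fin k, ∑ n, regressionExponent φ M h (clippedFun ψ ρ (par z)) (dir z)
        (D' j n) ≤ L := by
      refine le_of_eq_of_le ?_ hDz
      have := sum_ite_lt_eq_sum_castLE hk (fun j => ∑ n, regressionExponent φ M h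
        (clippedFun ψ ρ (par z)) (dir z) (D j n))
      refine Eq.trans this.symm (Finset.sum_congr rfl fun j _ => ?_)
      simp only [g]
      split_ifs <;> simp
    have hQ' : (0 : ℝ) < Q := by exact_mod_cast hQ
    have hκ : ∀ s a, |inner ℝ (φ s a) x - inner ℝ (φ s a) (dir z)| ≤ d * (Q : ℝ)⁻¹ := by
      intro s a
      rw [← inner_sub_right, inner_eq_dotProduct, dotProduct]
      calc _ ≤ ∑ _i : Fin d, (Q : ℝ)⁻¹ := by
            refine (Finset.abs_sum_le_sum_abs _ _).trans (Finset.sum_le_sum fun i _ => ?_)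
            rw [abs_mul]
            calc _ ≤ 1 * (Q : ℝ)⁻¹ := mul_le_mul (φ.abs_coord_le s a i) (hzx (Sum.inl i))
                  (abs_nonneg _) zero_le_one
              _ = _ := one_mul _
        _ = _ := by simp
    have hstep : ∀ τ, regressionExponent φ M h V x τ ≤
        regressionExponent φ M h (clippedFun ψ ρ (par z)) (dir z) τ + (R : ℝ)⁻¹ := by
      intro τ
      refine (regressionExponent_le φ M h hV (measurable_clippedFun hψ ρ _) hV1
        (clippedFun_mem ρ _) (η := Fintype.card J * (Q : ℝ)⁻¹) (by positivity)
        (abs_clippedFun_sub_le hψ1 ρ fun j => hzx (Sum.inr j)) hxR hκ τ).trans ?_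
      gcongr
      have hR1 : (1 : ℝ) ≤ R := by exact_mod_cast hR
      have hd1 : (1 : ℝ) ≤ d := by exact_mod_cast hd
      have hdR : (d : ℝ) ≤ R := by exact_mod_cast hRd
      have hQd : (Q : ℝ) = (R : ℝ) ^ 2 * (2 * Fintype.card J + 3 * d) := by
        rw [hQdef, hm]; push_cast; ring
      have hdQ : (d : ℝ) * (Q : ℝ)⁻¹ ≤ 1 := by
        rw [← div_eq_mul_inv, div_le_one hQ', hQd]
        nlinarith [(Nat.cast_nonneg (Fintype.card J) : (0 : ℝ) ≤ Fintype.card J), pow_le_pow_left₀ zero_le_one hR1 2]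
      have hkk : (d : ℝ) * (Q : ℝ)⁻¹ * (R + d * (Q : ℝ)⁻¹) ≤ d * (Q : ℝ)⁻¹ * (R + R) := by
        gcongr
        linarith
      calc (R : ℝ) * (2 * (Fintype.card J * (Q : ℝ)⁻¹)) + d * (Q : ℝ)⁻¹ +
            d * (Q : ℝ)⁻¹ * (R + d * (Q : ℝ)⁻¹)
          ≤ (R : ℝ) * (2 * (Fintype.card J * (Q : ℝ)⁻¹)) + d * (Q : ℝ)⁻¹ * R +
            d * (Q : ℝ)⁻¹ * (R + R) := by
            exact add_le_add (add_le_add le_rfl (le_mul_of_one_le_right (by positivity) hR1)) hkk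
        _ = (R : ℝ) * (2 * Fintype.card J + 3 * d) * (Q : ℝ)⁻¹ := by ring
        _ = (R : ℝ)⁻¹ := by rw [hQd]; field_simp
    calc _ ≤ ∑ j : Fin k, ∑ n, (regressionExponent φ M h (clippedFun ψ ρ (par z)) (dir z)
          (D' j n) + (R : ℝ)⁻¹) :=
          Finset.sum_le_sum fun j _ => Finset.sum_le_sum fun n _ => hstep (D' j n)
      _ = ∑ j : Fin k, ∑ n, regressionExponent φ M h (clippedFun ψ ρ (par z)) (dir z) (D' j n) +
          k * alg.batch * (R : ℝ)⁻¹ := by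
          simp only [Finset.sum_add_distrib]
          simp
          ring
      _ ≤ L + 1 := by
          refine add_le_add hsum ?_
          have hR' : (0 : ℝ) < R := by exact_mod_cast hR
          rw [← div_eq_mul_inv, div_le_one hR']
          exact hkR

end UniformConcentration

/-! ### Error of the value and reward estimators. -/

section Estimators

variable {S A : Type*} [MeasurableSpace S] [MeasurableSpace A] {H d N k : ℕ}

/-- The elliptic bonus `‖φ(s, a)‖_{Λ_h⁻¹}` of a data set. -/
noncomputable def bonus (φ : FeatureMap S A d) (D : Dataset S A H N k) (h : Fin H) (s : S) (a : A) :
    ℝ :=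
  √(quad (empCov φ D h)⁻¹ (φ s a))

lemma measurable_bonus (φ : FeatureMap S A d) (D : Dataset S A H N k) (h : Fin H) :
    Measurable fun p : S × A => bonus φ D h p.1 p.2 :=
  (φ.measurable_quad _).sqrt

lemma bonus_mem (φ : FeatureMap S A d) (D : Dataset S A H N k) (h : Fin H) (s : S) (a : A) :
    bonus φ D h s a ∈ Set.Icc (0 : ℝ) 1 := by
  refine ⟨Real.sqrt_nonneg _, Real.sqrt_le_one.2 ?_⟩
  have := quad_inv_le_norm_sq (posDef_empCov φ D h) one_pos
    (by simpa using norm_sq_le_quad_empCov φ D h) (φ s a)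
  rw [inv_one, one_mul] at this
  exact this.trans (pow_le_one₀ (norm_nonneg _) (φ.norm_le_one s a))

/-- Error propagation for the backward recursion of the estimators. -/
lemma abs_backward_sub_detValue_le (φ : FeatureMap S A d) (M : MDP S A H) (D : Dataset S A H N k)
    (π : DetPolicy S A H) {r : Fin H → S → A → ℝ} (hr : FeasibleReward φ r) {t B β : ℝ}
    (hrt : ∀ h s a, r h s a ≤ t)
    (Cls : ℕ → (S → ℝ) → Prop) {n₀ : ℕ} (hn₀ : n₀ ≤ H)
    (hmeas : ∀ n V, Cls n V → Measurable V ∧ ∀ s, V s ∈ Set.Icc 0 B)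
    (hstep : ∀ i (hi : i < H), i < n₀ → ∀ V, Cls (i + 1) V →
      Cls i (backupStep φ D π r B ⟨i, hi⟩ V))
    (hridge : ∀ i (hi : i < H), i < n₀ → ∀ V, Cls (i + 1) V → ∀ s a,
      |(φ s a).ofLp ⬝ᵥ ridgeWeights φ D ⟨i, hi⟩ V - M.transition ⟨i, hi⟩ V s a| ≤
        β * bonus φ D ⟨i, hi⟩ s a)
    (n : ℕ) (hn : n ≤ n₀) {V W : S → ℝ} (hV : Cls n V) (hW : Measurable W) {b : ℝ}
    (hWb : ∀ s, W s ∈ Set.Icc 0 b) (hb : b + n * t ≤ B) (ht : 0 ≤ t) :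
    |backward φ D π r B n (hn.trans hn₀) V M.init -
        M.detValue π r n (hn.trans hn₀) W M.init| ≤
      β * ∑ i : Fin n, ∫ s, bonus φ D (Fin.castLE (hn.trans hn₀) i) s
          ((π (Fin.castLE (hn.trans hn₀) i)).1 s)
          ∂(M.detStateLaw π i (i.isLt.le.trans (hn.trans hn₀))) +
        ∫ s, |V s - W s| ∂(M.detStateLaw π n (hn.trans hn₀)) := by
  induction n generalizing V W b with
  | zero =>
    have hm : Measurable fun s => |V s - W s| := ((hmeas _ _ hV).1.sub hW).abs
    simp [backward, MDP.detValue, MDP.detStateLaw, integral_dirac' _ _ hm.stronglyMeasurable]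
  | succ n ih =>
    have hnH : n < H := (Nat.lt_of_succ_le hn).trans_le hn₀
    have hn' : n < n₀ := Nat.lt_of_succ_le hn
    obtain ⟨hVm, hVB⟩ := hmeas _ _ hV
    set ρ := π ⟨n, hnH⟩
    set V' := backupStep φ D π r B ⟨n, hnH⟩ V
    set W' : S → ℝ := fun s => r ⟨n, hnH⟩ s (ρ.1 s) + M.transition ⟨n, hnH⟩ W s (ρ.1 s)
    have hV' : Cls n V' := hstep n hnH hn' V hV
    have hW' : Measurable W' := M.measurable_detBackup hr _ ρ hW
    have hWb' : ∀ s, W' s ∈ Set.Icc 0 (b + t) := fun s => by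
      have h1 := hr.mem_Icc ⟨n, hnH⟩ s (ρ.1 s)
      have h2 := M.transition_mem_Icc ⟨n, hnH⟩ hW hWb s (ρ.1 s)
      exact ⟨add_nonneg h1.1 h2.1, by linarith [hrt ⟨n, hnH⟩ s (ρ.1 s), h2.2]⟩
    push_cast at hb
    have hbB : b + t ≤ B := by nlinarith [(Nat.cast_nonneg n : (0 : ℝ) ≤ n)]
    have hih := ih hn'.le hV' hW' hWb' (by linarith)
    have hdiff : Measurable fun s => |V s - W s| := (hVm.sub hW).abs
    have hdb : ∀ s, |(|V s - W s|)| ≤ B := fun s => by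
      have h1 := hVB s
      have h2 := hWb s
      rw [abs_abs, abs_le]
      exact ⟨by linarith [h1.1, h2.2], by linarith [h1.2, h2.1]⟩
    have hpt : ∀ s, |V' s - W' s| ≤ β * bonus φ D ⟨n, hnH⟩ s (ρ.1 s) +
        M.transition ⟨n, hnH⟩ (fun s => |V s - W s|) s (ρ.1 s) := by
      intro s
      -- The true backup lies in `[0, B]` thanks to the budget `b + n * t ≤ B`, so clipping fixes it
      -- and, being nonexpansive, does not increase the error.
      have hc : W' s = clip B (W' s) :=
        (clip_of_mem ⟨(hWb' s).1, (hWb' s).2.trans hbB⟩).symm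
      have h1 : |V' s - W' s| ≤ |((φ s (ρ.1 s)).ofLp ⬝ᵥ ridgeWeights φ D ⟨n, hnH⟩ V +
          r ⟨n, hnH⟩ s (ρ.1 s)) - W' s| := by
        conv_lhs => rw [hc]
        exact abs_clip_sub_clip_le _ _ _
      have h2 := hridge n hnH hn' V hV s (ρ.1 s)
      have h3 : M.transition ⟨n, hnH⟩ (fun s => V s - W s) s (ρ.1 s) =
          M.transition ⟨n, hnH⟩ V s (ρ.1 s) - M.transition ⟨n, hnH⟩ W s (ρ.1 s) :=
        M.transition_sub _ hVm hW (B := B) (C := b)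
          (fun s => abs_le.2 ⟨by linarith [(hVB s).1, (hVB s).2], (hVB s).2⟩)
          (fun s => abs_le.2 ⟨by linarith [(hWb s).1, (hWb s).2], (hWb s).2⟩) _ _
      have h4 : |M.transition ⟨n, hnH⟩ (fun s => V s - W s) s (ρ.1 s)| ≤
          M.transition ⟨n, hnH⟩ (fun s => |V s - W s|) s (ρ.1 s) := abs_integral_le_integral_abs
      rw [h3] at h4
      refine h1.trans ?_
      have h5 : (φ s (ρ.1 s)).ofLp ⬝ᵥ ridgeWeights φ D ⟨n, hnH⟩ V + r ⟨n, hnH⟩ s (ρ.1 s) - W' s =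
          ((φ s (ρ.1 s)).ofLp ⬝ᵥ ridgeWeights φ D ⟨n, hnH⟩ V - M.transition ⟨n, hnH⟩ V s (ρ.1 s)) +
          (M.transition ⟨n, hnH⟩ V s (ρ.1 s) - M.transition ⟨n, hnH⟩ W s (ρ.1 s)) := by
        simp only [W']; ring
      rw [h5]
      exact (abs_add_le _ _).trans (add_le_add h2 h4)
    have i1 : Integrable (fun s => bonus φ D ⟨n, hnH⟩ s (ρ.1 s)) (M.detStateLaw π n hnH.le) :=
      integrable_of_mem_Icc ((measurable_bonus φ D _).comp (measurable_prod_rule ρ))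
        fun s => bonus_mem φ D _ _ _
    have i2 : Integrable (fun s => M.transition ⟨n, hnH⟩ (fun s => |V s - W s|) s (ρ.1 s))
        (M.detStateLaw π n hnH.le) :=
      integrable_of_abs_le ((M.measurable_transition _ hdiff).comp (measurable_prod_rule ρ))
        fun s => M.abs_transition_le _ hdb _ _
    have i3 : Integrable (fun s => |V' s - W' s|) (M.detStateLaw π n hnH.le) :=
      integrable_of_abs_le (C := B) ((hmeas _ _ hV').1.sub hW').abs fun s => by
        have h1 := (hmeas _ _ hV').2 s
        have h2 := hWb' s
        rw [abs_abs, abs_le]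
        exact ⟨by linarith [h1.1, h2.2], by linarith [h1.2, h2.1]⟩
    have hint : ∫ s, |V' s - W' s| ∂(M.detStateLaw π n hnH.le) ≤
        β * ∫ s, bonus φ D ⟨n, hnH⟩ s (ρ.1 s) ∂(M.detStateLaw π n hnH.le) +
        ∫ s, |V s - W s| ∂(M.detStateLaw π (n + 1) hnH) := by
      rw [M.integral_detStateLaw_succ π hnH hdiff hdb, ← integral_const_mul,
        ← integral_add (i1.const_mul β) i2]
      exact integral_mono i3 ((i1.const_mul β).add i2) hpt
    rw [Fin.sum_univ_castSucc, mul_add, add_assoc]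
    refine hih.trans (add_le_add le_rfl hint)

/-- The regression error is at most `β` times the bonus, for all functions of the class. -/
def RegressionGood (φ : FeatureMap S A d) (M : MDP S A H) (D : Dataset S A H N k) {J : Type*}
    [Fintype J] (ψ : J → S → A → ℝ) (rules : Fin H → Finset (DetRule S A)) (R β : ℝ) : Prop :=
  ∀ (h : Fin H) (hh : h.1 + 1 < H), ∀ ρ ∈ rules ⟨h.1 + 1, hh⟩, ∀ θ : J → ℝ, (∀ j, |θ j| ≤ R) →
    ∀ s a, |(φ s a).ofLp ⬝ᵥ ridgeWeights φ D h (clippedFun ψ ρ θ) -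
      M.transition h (clippedFun ψ ρ θ) s a| ≤ β * bonus φ D h s a

/-- The summand `√d` pays for the ridge bias: it bounds the weight of the conditional expectation of
a `[0, 1]`-valued function. -/
lemma MDP.IsLinear.regressionGood {φ : FeatureMap S A d} {M : MDP S A H} (hM : M.IsLinear φ)
    {D : Dataset S A H N k} {J : Type*} [Fintype J] {ψ : J → S → A → ℝ}
    (hψ : ∀ j, Measurable fun p : S × A => ψ j p.1 p.2)
    {rules : Fin H → Finset (DetRule S A)} {R L : ℝ}
    (h : ∀ (h : Fin H) (hh : h.1 + 1 < H), ∀ ρ ∈ rules ⟨h.1 + 1, hh⟩, ∀ θ : J → ℝ,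
      (∀ j, |θ j| ≤ R) →
        quad (empCov φ D h)⁻¹ (noiseVec φ M D h (clippedFun ψ ρ θ)) ≤ L) :
    RegressionGood φ M D ψ rules R (√L + √(d : ℝ)) := by
  intro i hi ρ hρ θ hθ s a
  obtain ⟨w, hw, hwt⟩ := hM.exists_weight_unit i (measurable_clippedFun hψ ρ θ) (clippedFun_mem ρ θ)
  refine (abs_ridge_sub_transition_le φ M D i hw hwt s a).trans ?_
  refine mul_le_mul_of_nonneg_right ?_ (Real.sqrt_nonneg _)
  gcongr
  exact h i hi ρ hρ θ hθ

lemma abs_ridge_sub_transition_scale (φ : FeatureMap S A d) (M : MDP S A H) (D : Dataset S A H N k)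
    (h : Fin H) {B : ℝ} (hB : 0 ≤ B) (V : S → ℝ) (s : S) (a : A) {x : ℝ}
    (hx : |(φ s a).ofLp ⬝ᵥ ridgeWeights φ D h V - M.transition h V s a| ≤ x) :
    |(φ s a).ofLp ⬝ᵥ ridgeWeights φ D h (fun s => B * V s) -
      M.transition h (fun s => B * V s) s a| ≤ B * x := by
  have h1 : M.transition h (fun s => B * V s) s a = B * M.transition h V s a :=
    integral_const_mul _ _
  rw [ridgeWeights_const_mul, dotProduct_smul, h1, smul_eq_mul, ← mul_sub, abs_mul,
    abs_of_nonneg hB]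
  gcongr

/-- Index set of the monomials of degree at most two, without multiplicities of order. -/
abbrev QuadIndex (d : ℕ) : Type := Fin d ⊕ ((Fin d × Fin d) ⊕ Unit)

/-- The monomials of degree at most two in the features. -/
def quadFeature (φ : FeatureMap S A d) : QuadIndex d → S → A → ℝ
  | Sum.inl i, s, a => φ s a i
  | Sum.inr (Sum.inl ij), s, a => φ s a ij.1 * φ s a ij.2
  | Sum.inr (Sum.inr _), _, _ => 1

lemma measurable_quadFeature (φ : FeatureMap S A d) (j : QuadIndex d) :
    Measurable fun p : S × A => quadFeature φ j p.1 p.2 := by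
  rcases j with i | ij | _
  · exact φ.measurable_coord i
  · exact (φ.measurable_coord _).mul (φ.measurable_coord _)
  · exact measurable_const

lemma abs_quadFeature_le (φ : FeatureMap S A d) (j : QuadIndex d) (s : S) (a : A) :
    |quadFeature φ j s a| ≤ 1 := by
  rcases j with i | ij | _
  · exact φ.abs_coord_le _ _ _
  · simp only [quadFeature, abs_mul]
    exact mul_le_one₀ (φ.abs_coord_le _ _ _) (abs_nonneg _) (φ.abs_coord_le _ _ _)
  · simp [quadFeature]

/-- The features as a family of functions. -/
def linFeature (φ : FeatureMap S A d) (i : Fin d) (s : S) (a : A) : ℝ := φ s a i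

/-- The sum of the expected bonuses of the layers below `n`. -/
noncomputable def bonusSum (φ : FeatureMap S A d) (M : MDP S A H) (D : Dataset S A H N k)
    (π : DetPolicy S A H) (n : ℕ) (hn : n ≤ H) : ℝ :=
  ∑ i : Fin n, ∫ s, bonus φ D (Fin.castLE hn i) s ((π (Fin.castLE hn i)).1 s)
    ∂(M.detStateLaw π i (i.isLt.le.trans hn))

/-- The error of `estimateER` for quadratic reward functions. -/
lemma abs_estimateER_sub_le (φ : FeatureMap S A d) (M : MDP S A H) (D : Dataset S A H N k)
    (π : DetPolicy S A H) {rules : Fin H → Finset (DetRule S A)} (hπ : ∀ h, π h ∈ rules h)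
    {R β B : ℝ} (hB : 0 < B) (hR : (k : ℝ) * N ≤ R)
    (hgood : RegressionGood φ M D (quadFeature φ) rules R β) (h : Fin H)
    {X : Matrix (Fin d) (Fin d) ℝ} {c : ℝ} (hX : ∀ i j, |X i j| ≤ R * B) (hc : |c| ≤ R * B)
    (hf : ∀ s a, quad X (φ s a) + c ∈ Set.Icc 0 B) :
    |estimateER φ M.init D π (fun s a => quad X (φ s a) + c) B h -
        ∫ τ, (quad X (φ (τ h).1 (τ h).2) + c) ∂(M.trajLaw (DetPolicy.toPolicy π))| ≤
      B * β * bonusSum φ M D π h h.isLt.le := by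
  set f : S → A → ℝ := fun s a => quad X (φ s a) + c
  have hR0 : 0 ≤ R := le_trans (by positivity) hR
  -- The invariant of the recursion: the terminal reward is quadratic plus a constant, all earlier
  -- functions are linear, and `quadFeature` accommodates both. The rescaled regression weights are
  -- bounded by `k * N`, hence by `R`.
  let Cls : ℕ → (S → ℝ) → Prop := fun i V => ∃ (hi : i < H) (θ : QuadIndex d → ℝ),
    (∀ j, |θ j| ≤ R) ∧ V = fun s => B * clippedFun (quadFeature φ) (π ⟨i, hi⟩) θ s
  have hmeas : ∀ n V, Cls n V → Measurable V ∧ ∀ s, V s ∈ Set.Icc 0 B := by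
    rintro n V ⟨hi, θ, hθ, rfl⟩
    refine ⟨(measurable_clippedFun (measurable_quadFeature φ) _ _).const_mul _, fun s => ?_⟩
    have := clippedFun_mem (ψ := quadFeature φ) (π ⟨n, hi⟩) θ s
    exact ⟨mul_nonneg hB.le this.1, mul_le_of_le_one_right hB.le this.2⟩
  have hstep : ∀ i (hi : i < H), i < h.1 → ∀ V, Cls (i + 1) V →
      Cls i (backupStep φ D π (fun _ _ _ => 0) B ⟨i, hi⟩ V) := by
    intro i hi hih V hV
    have hVB := (hmeas _ _ hV).2
    refine ⟨hi, Sum.elim (fun j => ridgeWeights φ D ⟨i, hi⟩ V j / B) (fun _ => 0), ?_, ?_⟩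
    · rintro (j | j)
      · simp only [Sum.elim_inl]
        rw [abs_div, abs_of_pos hB, div_le_iff₀ hB]
        have h1 := norm_ridgeWeights_le φ D ⟨i, hi⟩ hB.le hVB
        have h2 := abs_coord_le_norm (WithLp.toLp 2 (ridgeWeights φ D ⟨i, hi⟩ V)) j
        refine h2.trans (h1.trans ?_)
        gcongr
      · simpa using hR0
    · funext s
      rw [backupStep, clip_eq_mul hB, clippedFun]
      congr 2
      simp only [Fintype.sum_sum_type, Sum.elim_inl, Sum.elim_inr, quadFeature, zero_mul,
        Finset.sum_const_zero, add_zero, dotProduct, Finset.sum_div]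
      exact Finset.sum_congr rfl fun j _ => by ring
  have hridge : ∀ i (hi : i < H), i < h.1 → ∀ V, Cls (i + 1) V → ∀ s a,
      |(φ s a).ofLp ⬝ᵥ ridgeWeights φ D ⟨i, hi⟩ V - M.transition ⟨i, hi⟩ V s a| ≤
        B * β * bonus φ D ⟨i, hi⟩ s a := by
    rintro i hi hih V ⟨hi1, θ, hθ, rfl⟩ s a
    rw [mul_assoc]
    exact abs_ridge_sub_transition_scale φ M D _ hB.le _ s a
      (hgood ⟨i, hi⟩ hi1 _ (hπ _) θ hθ s a)
  have hterm : Cls h.1 (fun s => f s ((π h).1 s)) := by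
    refine ⟨h.isLt, Sum.elim (fun _ => 0) (Sum.elim (fun ij => X ij.1 ij.2 / B) fun _ => c / B),
      ?_, ?_⟩
    · rintro (j | j | j)
      · simpa using hR0
      · simp only [Sum.elim_inr, Sum.elim_inl]
        rw [abs_div, abs_of_pos hB, div_le_iff₀ hB]
        exact hX _ _
      · simp only [Sum.elim_inr]
        rw [abs_div, abs_of_pos hB, div_le_iff₀ hB]
        exact hc
    · funext s
      have h1 : ∀ a, f s a = B * clip 1 (f s a / B) := fun a => by
        rw [← clip_eq_mul hB, clip_of_mem (hf s a)]
      rw [h1, clippedFun]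
      congr 2
      simp only [Fintype.sum_sum_type, Sum.elim_inl, Sum.elim_inr, quadFeature, zero_mul,
        Finset.sum_const_zero, zero_add, f, quad_eq_sum, Fintype.sum_prod_type, add_div,
        Finset.sum_div, Finset.univ_unique, Finset.sum_singleton, mul_one, Fin.eta]
      congr 1
      exact Finset.sum_congr rfl fun i _ => Finset.sum_congr rfl fun j _ => by ring
  have hW := hmeas _ _ hterm
  have main := abs_backward_sub_detValue_le φ M D π (feasibleReward_zero φ) (t := 0)
    (fun _ _ _ => le_rfl) Cls h.isLt.le hmeas hstep hridge h.1 le_rfl hterm hW.1 hW.2 (by simp)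
    le_rfl
  rw [M.detValue_eq π (feasibleReward_zero φ) h.1 h.isLt.le hW.1 hW.2] at main
  have hfm : Measurable fun p : S × A => f p.1 p.2 := (φ.measurable_quad X).add_const c
  rw [M.integral_trajLaw_det π h hfm]
  simpa [estimateER, bonusSum] using main

/-- The error of `estimateV`. -/
lemma abs_estimateV_sub_le (φ : FeatureMap S A d) (M : MDP S A H) (D : Dataset S A H N k)
    (π : DetPolicy S A H) {rules : Fin H → Finset (DetRule S A)} (hπ : ∀ h, π h ∈ rules h)
    {R β : ℝ} (hH : 0 < H) (hd : 0 < d) (hβ : 0 ≤ β) (hR : (k : ℝ) * N + d ≤ R)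
    (hgood : RegressionGood φ M D (linFeature φ) rules R β)
    {r : Fin H → S → A → ℝ} (hr : FeasibleReward φ r) :
    |estimateV φ M.init D π r - M.value (DetPolicy.toPolicy π) r| ≤
      H * β * bonusSum φ M D π H le_rfl := by
  have hB : (0 : ℝ) < H := by exact_mod_cast hH
  have hH1 : (1 : ℝ) ≤ H := by exact_mod_cast hH
  have hd1 : (1 : ℝ) ≤ d := by exact_mod_cast hd
  -- The zero function needs its own case, as no decision rule exists beyond the last layer.
  -- Regression on it returns `0`, so the last layer is exact.
  let Cls : ℕ → (S → ℝ) → Prop := fun i V => (H ≤ i ∧ V = fun _ => 0) ∨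
    ∃ (hi : i < H) (θ : Fin d → ℝ),
      (∀ j, |θ j| ≤ R) ∧ V = fun s => (H : ℝ) * clippedFun (linFeature φ) (π ⟨i, hi⟩) θ s
  have hlin : ∀ j, Measurable fun p : S × A => linFeature φ j p.1 p.2 :=
    fun j => φ.measurable_coord j
  have hmeas : ∀ n V, Cls n V → Measurable V ∧ ∀ s, V s ∈ Set.Icc (0 : ℝ) H := by
    rintro n V (⟨-, rfl⟩ | ⟨hi, θ, hθ, rfl⟩)
    · exact ⟨measurable_const, fun s => ⟨le_rfl, hB.le⟩⟩
    · refine ⟨(measurable_clippedFun hlin _ _).const_mul _, fun s => ?_⟩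
      have := clippedFun_mem (ψ := linFeature φ) (π ⟨n, hi⟩) θ s
      exact ⟨mul_nonneg hB.le this.1, mul_le_of_le_one_right hB.le this.2⟩
  have hstep : ∀ i (hi : i < H), i < H → ∀ V, Cls (i + 1) V →
      Cls i (backupStep φ D π r H ⟨i, hi⟩ V) := by
    intro i hi _ V hV
    have hVB := (hmeas _ _ hV).2
    obtain ⟨θ, hθ, hθr⟩ := hr ⟨i, hi⟩
    refine Or.inr ⟨hi, fun j => (ridgeWeights φ D ⟨i, hi⟩ V j + θ j) / H, fun j => ?_, ?_⟩
    · rw [abs_div, abs_of_pos hB, div_le_iff₀ hB]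
      have h1 := norm_ridgeWeights_le φ D ⟨i, hi⟩ hB.le hVB
      have h2 : |ridgeWeights φ D ⟨i, hi⟩ V j| ≤ _ :=
        abs_coord_le_norm (WithLp.toLp 2 (ridgeWeights φ D ⟨i, hi⟩ V)) j
      have h3 := abs_coord_le_norm θ j
      have h4 : √(d : ℝ) ≤ d := Real.sqrt_le_iff.2 ⟨by positivity, by nlinarith⟩
      calc |ridgeWeights φ D ⟨i, hi⟩ V j + θ j| ≤ (k : ℝ) * N * H + d * 1 := by
            refine (abs_add_le _ _).trans (add_le_add (h2.trans h1) ?_)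
            rw [mul_one]
            exact h3.trans (hθ.trans h4)
        _ ≤ (k : ℝ) * N * H + d * H := by gcongr
        _ = ((k : ℝ) * N + d) * H := by ring
        _ ≤ R * H := by gcongr
    · funext s
      rw [backupStep, clip_eq_mul hB, clippedFun, (hθr _ _).1, inner_eq_dotProduct]
      congr 2
      simp only [dotProduct, ← Finset.sum_add_distrib, Finset.sum_div, linFeature]
      exact Finset.sum_congr rfl fun j _ => by ring
  have hridge : ∀ i (hi : i < H), i < H → ∀ V, Cls (i + 1) V → ∀ s a,
      |(φ s a).ofLp ⬝ᵥ ridgeWeights φ D ⟨i, hi⟩ V - M.transition ⟨i, hi⟩ V s a| ≤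
        H * β * bonus φ D ⟨i, hi⟩ s a := by
    rintro i hi - V (⟨-, rfl⟩ | ⟨hi1, θ, hθ, rfl⟩) s a
    · rw [ridgeWeights_zero]
      have := (bonus_mem φ D ⟨i, hi⟩ s a).1
      simp only [dotProduct_zero, MDP.transition, integral_zero, sub_zero, abs_zero]
      positivity
    · rw [mul_assoc]
      exact abs_ridge_sub_transition_scale φ M D _ hB.le _ s a
        (hgood ⟨i, hi⟩ hi1 _ (hπ _) θ hθ s a)
  have main := abs_backward_sub_detValue_le φ M D π hr (t := 1) (fun h s a => (hr.mem_Icc h s a).2)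
    Cls le_rfl hmeas hstep hridge H le_rfl (V := fun _ => 0) (Or.inl ⟨le_rfl, rfl⟩)
    (W := fun _ => 0) measurable_const (b := 0) (by simp) (by simp) zero_le_one
  rw [M.value_eq_detValue π hr]
  simpa [estimateV, bonusSum] using main

end Estimators

/-! ### One layer of the exploration. -/

section Layers

variable {S A : Type*} [MeasurableSpace S] [MeasurableSpace A] {H d : ℕ} {φ : FeatureMap S A d}

open Classical in
/-- The decision rules of the explorative policies at one layer. -/
noncomputable def Discretization.expRules {ε : ℝ} (Δ : Discretization φ H ε) (h : Fin H) :
    Finset (DetRule S A) :=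
  Δ.rewCover.image (Δ.rewRule h) ∪ Δ.linCover.image (Δ.linRule h)

open Classical in
/-- The decision rules of the policies to evaluate at one layer. -/
noncomputable def Discretization.evalRules {ε : ℝ} (Δ : Discretization φ H ε) (h : Fin H) :
    Finset (DetRule S A) :=
  Δ.linCover.image (Δ.linRule h)

lemma Discretization.mem_expRules {ε : ℝ} (Δ : Discretization φ H ε) {π : DetPolicy S A H}
    (hπ : π ∈ Δ.expSet) (h : Fin H) : π h ∈ Δ.expRules h :=
  Fintype.mem_piFinset.1 hπ h

lemma Discretization.mem_evalRules {ε : ℝ} (Δ : Discretization φ H ε) {π : DetPolicy S A H}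
    (hπ : π ∈ Δ.evalSet) (h : Fin H) : π h ∈ Δ.evalRules h :=
  Fintype.mem_piFinset.1 hπ h

/-- The expected elliptic norm at layer `h` with respect to the data of one batch. -/
noncomputable def batchBonus (φ : FeatureMap S A d) {N : ℕ} (M : MDP S A H)
    (b : Fin N → Traj S A H) (π : DetPolicy S A H) (h : Fin H) : ℝ :=
  ∫ τ, √(quad (1 + batchCov φ b h)⁻¹ (φ (τ h).1 (τ h).2)) ∂(M.trajLaw (DetPolicy.toPolicy π))

lemma posSemidef_batchCov (φ : FeatureMap S A d) {N : ℕ} (b : Fin N → Traj S A H) (h : Fin H) :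
    (batchCov φ b h).PosSemidef :=
  Matrix.posSemidef_sum _ fun n _ => posSemidef_of_quad (isHermitian_vecMulVec_self _) fun x => by
    rw [quad_vecMulVec]
    exact sq_nonneg _

/-- More data only enlarge `Λ`. The bonus of layer `i` is thus controlled by the one batch designed
for it. -/
lemma bonus_take_le (φ : FeatureMap S A d) {N m : ℕ} (D : Dataset S A H N m) (k : ℕ) (hk : k ≤ m)
    (i : Fin m) (hi : i.1 < k) (h : Fin H) (s : S) (a : A) :
    bonus φ (D.take k hk) h s a ≤ √(quad (1 + batchCov φ (D i) h)⁻¹ (φ s a)) := by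
  refine Real.sqrt_le_sqrt ?_
  have h1 := quad_inv_le_of_le (Matrix.PosDef.one.add_posSemidef (posSemidef_batchCov φ (D i) h))
    (posDef_empCov φ (D.take k hk) h) one_pos (fun x => ?_) (φ s a)
  · simpa using h1
  · rw [one_mul, quad_empCov, quad_add, quad_one, batchCov, quad_sum]
    refine add_le_add le_rfl ?_
    have h2 := Finset.single_le_sum (f := fun j : Fin k => ∑ n,
      (inner ℝ (φ (D.take k hk j n h).1 (D.take k hk j n h).2) x) ^ 2)
      (fun j _ => Finset.sum_nonneg fun n _ => sq_nonneg _) (Finset.mem_univ ⟨i.1, hi⟩)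
    refine le_trans (le_of_eq (Finset.sum_congr rfl fun n _ => ?_)) h2
    rw [quad_vecMulVec, real_inner_comm]
    rfl

/-- Each layer below `n` had its own deployment among the first `k`, so each contributes at most
`e`. -/
lemma bonusSum_take_le (φ : FeatureMap S A d) (M : MDP S A H) {N : ℕ} (D : Dataset S A H N H)
    (π : DetPolicy S A H) (n k : ℕ) (hnk : n ≤ k) (hk : k ≤ H) {e : ℝ} (he : 0 ≤ e)
    (h : ∀ i : Fin H, i.1 < n → batchBonus φ M (D i) π i ≤ e) :
    bonusSum φ M (D.take k hk) π n (hnk.trans hk) ≤ H * e := by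
  have hnH : n ≤ H := hnk.trans hk
  calc bonusSum φ M (D.take k hk) π n (hnk.trans hk) ≤ ∑ _i : Fin n, e := by
        refine Finset.sum_le_sum fun i _ => ?_
        have hi := h (Fin.castLE hnH i) i.isLt
        refine le_trans ?_ hi
        have hp := posSemidef_batchCov φ (D (Fin.castLE hnH i)) (Fin.castLE hnH i)
        have hm : Measurable fun p : S × A =>
            √(quad (1 + batchCov φ (D (Fin.castLE hnH i)) (Fin.castLE hnH i))⁻¹ (φ p.1 p.2)) :=
          (φ.measurable_quad _).sqrt
        rw [batchBonus, M.integral_trajLaw_det π (Fin.castLE hnH i) (F := fun s a =>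
          √(quad (1 + batchCov φ (D (Fin.castLE hnH i)) (Fin.castLE hnH i))⁻¹ (φ s a))) hm]
        refine integral_mono ?_ ?_ fun s => ?_
        · exact integrable_of_mem_Icc ((measurable_bonus φ _ _).comp (measurable_prod_rule _))
            fun s => bonus_mem φ _ _ _ _
        · exact integrable_of_mem_Icc (hm.comp (measurable_prod_rule _))
            fun s => ellipticReward_mem hp _ _
        · exact bonus_take_le φ D k hk (Fin.castLE hnH i) (i.isLt.trans_le hnk) _ _ _
    _ = n * e := by simp
    _ ≤ H * e := by gcongr

/-- Cauchy-Schwarz bounds an entry by the diagonal ones. It converts the spectral bound on `(N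
Σ̂)⁻¹` into the entrywise bound that membership in the quadratic class requires. -/
lemma abs_entry_le_of_quad_le {X : Matrix (Fin d) (Fin d) ℝ} (hX : X.PosSemidef) {c : ℝ}
    (h : ∀ x : Vec d, quad X x ≤ c * ‖x‖ ^ 2) (i j : Fin d) : |X i j| ≤ c := by
  have h1 := sq_dotProduct_mulVec_le hX (Pi.single i 1) (Pi.single j 1)
  simp only [Matrix.mulVec_single_one, single_dotProduct, one_mul, Matrix.col_apply] at h1
  have h2 : ∀ i, X i i ≤ c := fun i => by
    have := h (EuclideanSpace.single i 1)
    simpa [quad] using this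
  have h3 : ∀ i, 0 ≤ X i i := fun i => hX.diag_nonneg
  refine abs_le_of_sq_le_sq (h1.trans ?_) ((h3 i).trans (h2 i))
  rw [sq]
  exact mul_le_mul (h2 i) (h2 j) (h3 j) ((h3 i).trans (h2 i))

lemma isHermitian_estCovMix (φ : FeatureMap S A d) (s₁ : S) {N k : ℕ} (D : Dataset S A H N k)
    (T : Finset (DetPolicy S A H)) (p : T → ℝ) (h : Fin H) :
    (estCovMix φ s₁ D T p h).IsHermitian := by
  ext i j
  simp only [Matrix.conjTranspose_apply, estCovMix, Matrix.sum_apply, Matrix.smul_apply, estCov,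
    Matrix.of_apply, star_trivial, mul_comm]

/-- Entrywise error of the estimated covariance matrices. -/
lemma abs_estCovMix_sub_le {M : MDP S A H} {N k : ℕ} {D : Dataset S A H N k}
    {T : Finset (DetPolicy S A H)} {p : T → ℝ} (hp : p ∈ stdSimplex ℝ T) {h : Fin H} {e R : ℝ}
    (hR : 1 ≤ R)
    (hest : ∀ π ∈ T, ∀ (X : Matrix (Fin d) (Fin d) ℝ) (c : ℝ), (∀ i j, |X i j| ≤ R * 1) →
      |c| ≤ R * 1 → (∀ s a, quad X (φ s a) + c ∈ Set.Icc (0 : ℝ) 1) →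
      |estimateER φ M.init D π (fun s a => quad X (φ s a) + c) 1 h -
        ∫ τ, (quad X (φ (τ h).1 (τ h).2) + c) ∂(M.trajLaw (DetPolicy.toPolicy π))| ≤ e)
    (i j : Fin d) :
    |(estCovMix φ M.init D T p h - M.mixCov φ T p h) i j| ≤ 2 * e := by
  have key : ∀ π ∈ T, |estCov φ M.init D π h i j -
      M.covariance φ (DetPolicy.toPolicy π) h i j| ≤ 2 * e := by
    intro π hπ
    -- The normalized reward of one entry is the quadratic form of a matrix with a single entry
    -- `1/2`, shifted by `1/2`; `2x - 1` undoes this and doubles the error.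
    have hq : ∀ s a, quad (Matrix.single i j (1 / 2 : ℝ)) (φ s a) + 1 / 2 =
        (φ s a i * φ s a j + 1) / 2 := by
      intro s a
      rw [quad_eq_sum, Finset.sum_eq_single i, Finset.sum_eq_single j]
      · simp; ring
      · intro b _ hb
        simp [hb.symm]
      · simp
      · intro b _ hb
        exact Finset.sum_eq_zero fun c _ => by simp [hb.symm]
      · simp
    have h1 := hest π hπ (Matrix.single i j (1 / 2)) (1 / 2) (fun a b => by
        rw [Matrix.single_apply]
        split_ifs
        · rw [abs_of_pos (by norm_num)]; linarith
        · simp; linarith) (by rw [abs_of_pos (by norm_num)]; linarith) (fun s a => by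
        rw [hq]
        have h2 : |φ s a i * φ s a j| ≤ 1 := by
          rw [abs_mul]
          exact mul_le_one₀ (φ.abs_coord_le _ _ _) (abs_nonneg _) (φ.abs_coord_le _ _ _)
        rw [abs_le] at h2
        exact ⟨by linarith [h2.1], by linarith [h2.2]⟩)
    simp only [hq] at h1
    have h3 : ∫ τ, (φ (τ h).1 (τ h).2 i * φ (τ h).1 (τ h).2 j + 1) / 2
        ∂(M.trajLaw (DetPolicy.toPolicy π)) =
        (M.covariance φ (DetPolicy.toPolicy π) h i j + 1) / 2 := by
      rw [integral_div, integral_add (M.integrable_coord_mul φ _ h i j) (integrable_const _)]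
      simp [MDP.covariance]
    rw [h3] at h1
    simp only [estCov, Matrix.of_apply]
    rw [abs_le] at h1 ⊢
    constructor <;> linarith [h1.1, h1.2]
  have h2 : (estCovMix φ M.init D T p h - M.mixCov φ T p h) i j =
      ∑ π : T, p π * (estCov φ M.init D π.1 h i j -
        M.covariance φ (DetPolicy.toPolicy π.1) h i j) := by
    simp only [Matrix.sub_apply, estCovMix, MDP.mixCov, Matrix.sum_apply, Matrix.smul_apply,
      smul_eq_mul, mul_sub, Finset.sum_sub_distrib]
  rw [h2]
  calc _ ≤ ∑ π : T, p π * (2 * e) := by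
        refine (Finset.abs_sum_le_sum_abs _ _).trans (Finset.sum_le_sum fun π _ => ?_)
        rw [abs_mul, abs_of_nonneg (hp.1 π)]
        exact mul_le_mul_of_nonneg_left (key π.1 π.2) (hp.1 π)
    _ = 2 * e := by rw [← Finset.sum_mul, hp.2, one_mul]

/-- One step of the exploration: if the estimators at layer `h` are accurate and the batch of
layer `h` concentrates, then the design problem is feasible and layer `h` is well explored. -/
lemma layer_step {M : MDP S A H} (hM : M.IsLinear φ) (hd : 0 < d) {ε₀ : ℝ} (hε₀ : 0 ≤ ε₀)
    (Δ : Discretization φ H ε₀) (hlam : 0 < M.explorability φ)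
    (hεlam : ε₀ ≤ M.explorability φ / 4) {N k : ℕ} (hN : 0 < N) (D : Dataset S A H N k)
    (b : Fin N → Traj S A H) (h : Fin H) {thr B e η R t : ℝ} (hthr : 0 < thr)
    (hR : 1 ≤ R) (ht : 0 ≤ t)
    (hest : ∀ B' : ℝ, 0 < B' → ∀ π ∈ Δ.expSet, ∀ (X : Matrix (Fin d) (Fin d) ℝ) (c : ℝ),
      (∀ i j, |X i j| ≤ R * B') → |c| ≤ R * B' → (∀ s a, quad X (φ s a) + c ∈ Set.Icc 0 B') →
      |estimateER φ M.init D π (fun s a => quad X (φ s a) + c) B' h -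
        ∫ τ, (quad X (φ (τ h).1 (τ h).2) + c) ∂(M.trajLaw (DetPolicy.toPolicy π))| ≤ B' * e)
    (hn2 : d * (2 * e) + d * η ≤ thr / 2) (hη : 0 ≤ η)
    (hn3 : thr ≤ M.explorability φ ^ 2 / (32 * d)) (hn4 : (N * thr)⁻¹ ≤ B)
    (hn5 : 2 * (4 * d / N + 2 * (B * e)) ≤ t ^ 2)
    {p : Δ.expSet → ℝ}
    (hp : (∃ q, DesignFeasible φ M.init D Δ.expSet thr h q) →
      DesignFeasible φ M.init D Δ.expSet thr h p ∧
      ∀ q, DesignFeasible φ M.init D Δ.expSet thr h q →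
        designObjective φ M.init D Δ.expSet B h p ≤ designObjective φ M.init D Δ.expSet B h q)
    (hcov : ∀ i j, |(batchCov φ b h - (N : ℝ) • M.mixCov φ Δ.expSet p h) i j| ≤ N * η) :
    (∃ q, DesignFeasible φ M.init D Δ.expSet thr h q) ∧
      ∀ π ∈ Δ.expSet, batchBonus φ M b π h ≤ t := by
  have hN' : (0 : ℝ) < N := by exact_mod_cast hN
  have hd' : (0 : ℝ) < d := by exact_mod_cast hd
  have hB : 0 < B := lt_of_lt_of_le (by positivity) hn4
  have hne : Nonempty Δ.expSet := (Δ.evalSet_nonempty.mono Δ.evalSet_subset_expSet).to_subtype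
  have hdη : 0 ≤ d * η := by positivity
  have hclose : ∀ q ∈ stdSimplex ℝ Δ.expSet, ∀ x : Vec d,
      |quad (estCovMix φ M.init D Δ.expSet q h) x - quad (M.mixCov φ Δ.expSet q h) x| ≤
        d * (2 * e) * ‖x‖ ^ 2 := by
    intro q hq x
    rw [← quad_sub]
    refine abs_quad_le_of_entry_le (abs_estCovMix_sub_le hq hR fun π hπ X c h1 h2 h3 => ?_) x
    have := hest 1 one_pos π hπ X c h1 h2 h3
    rwa [one_mul] at this
  have hfeas : ∀ q, DesignFeasible φ M.init D Δ.expSet thr h q ↔ q ∈ stdSimplex ℝ Δ.expSet ∧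
      ∀ x : Vec d, thr * ‖x‖ ^ 2 ≤ quad (estCovMix φ M.init D Δ.expSet q h) x := fun q => by
    rw [DesignFeasible, le_minEig_iff hd (isHermitian_estCovMix _ _ _ _ _ _)]
  have hpd : ∀ q, DesignFeasible φ M.init D Δ.expSet thr h q →
      ((N : ℝ) • estCovMix φ M.init D Δ.expSet q h).PosDef := fun q hq =>
    (posDef_of_quad (isHermitian_estCovMix _ _ _ _ _ _) hthr ((hfeas q).1 hq).2).smul hN'
  -- The eigenvalue constraint makes the rewards of the objective at most `(N * thr)⁻¹ ≤ B`, so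
  -- truncation at `B` is harmless and the estimation error carries the small factor `B`.
  have hinv : ∀ q, DesignFeasible φ M.init D Δ.expSet thr h q → ∀ x : Vec d,
      quad ((N : ℝ) • estCovMix φ M.init D Δ.expSet q h)⁻¹ x ≤ B * ‖x‖ ^ 2 := by
    intro q hq x
    refine (quad_inv_le_norm_sq (hpd q hq) (c := N * thr) (by positivity) (fun y => ?_) x).trans
      (by gcongr)
    rw [quad_smul, mul_assoc]
    exact mul_le_mul_of_nonneg_left (((hfeas q).1 hq).2 y) hN'.le
  have hER : ∀ q, DesignFeasible φ M.init D Δ.expSet thr h q → ∀ π ∈ Δ.expSet,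
      |estimateER φ M.init D π (fun s a =>
          quad ((N : ℝ) • estCovMix φ M.init D Δ.expSet q h)⁻¹ (φ s a)) B h -
        ∫ τ, quad ((N : ℝ) • estCovMix φ M.init D Δ.expSet q h)⁻¹ (φ (τ h).1 (τ h).2)
          ∂(M.trajLaw (DetPolicy.toPolicy π))| ≤ B * e := by
    intro q hq π hπ
    have h1 := hest B hB π hπ ((N : ℝ) • estCovMix φ M.init D Δ.expSet q h)⁻¹ 0
      (fun i j => (abs_entry_le_of_quad_le (hpd q hq).inv.posSemidef (hinv q hq) i j).trans
        (le_mul_of_one_le_left hB.le hR)) (by simp; positivity) (fun s a => by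
        rw [add_zero]
        refine ⟨quad_nonneg (hpd q hq).inv.posSemidef _, (hinv q hq _).trans ?_⟩
        exact mul_le_of_le_one_right hB.le (pow_le_one₀ (norm_nonneg _) (φ.norm_le_one s a)))
    simpa only [add_zero] using h1
  -- The comparison design. Its true covariance exceeds `2 * thr`, which leaves room for the
  -- estimation error `thr / 2` and proves feasibility.
  obtain ⟨q, hqs, hq1, hq2⟩ := hM.exists_exploring_mixture hε₀ Δ h hd hlam hεlam
  have hlam32 : M.explorability φ ^ 2 / (16 * d) = 2 * (M.explorability φ ^ 2 / (32 * d)) := by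
    field_simp; norm_num
  have hqclose : ∀ x : Vec d, quad (M.mixCov φ Δ.expSet q h) x - thr / 2 * ‖x‖ ^ 2 ≤
      quad (estCovMix φ M.init D Δ.expSet q h) x := by
    intro x
    have h1 := (abs_le.1 (hclose q hqs x)).1
    have h2 : d * (2 * e) * ‖x‖ ^ 2 ≤ thr / 2 * ‖x‖ ^ 2 := by
      gcongr; linarith
    linarith
  have hqthr : ∀ x : Vec d, 2 * thr * ‖x‖ ^ 2 ≤ quad (M.mixCov φ Δ.expSet q h) x := fun x => by
    refine le_trans ?_ (hq1 x)
    rw [hlam32]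
    gcongr
  have hqf : DesignFeasible φ M.init D Δ.expSet thr h q := by
    rw [hfeas]
    refine ⟨hqs, fun x => ?_⟩
    have h1 := hqclose x
    have h2 := hqthr x
    have h3 : 0 ≤ thr * ‖x‖ ^ 2 := by positivity
    linarith
  refine ⟨⟨q, hqf⟩, fun π hπ => ?_⟩
  obtain ⟨hpf, hpmin⟩ := hp ⟨q, hqf⟩
  have hqpd : (M.mixCov φ Δ.expSet q h).PosDef :=
    posDef_of_quad (Matrix.posSemidef_sum _ fun π _ =>
      (M.posSemidef_covariance φ _ h).smul (hqs.1 π)).1 (c := 2 * thr) (by positivity) hqthr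
  -- The error `thr / 2` is at most half of the true covariance of `q`, so the estimated one retains
  -- at least half of it.
  have hqinv : ∀ x : Vec d, quad ((N : ℝ) • estCovMix φ M.init D Δ.expSet q h)⁻¹ x ≤
      2 / N * quad (M.mixCov φ Δ.expSet q h)⁻¹ x := by
    intro x
    have h1 := quad_inv_le_of_le hqpd (hpd q hqf) (c := N / 2) (by positivity) (fun y => by
      rw [quad_smul]
      have h1 := hqclose y
      have h2 := hqthr y
      have h3 : quad (M.mixCov φ Δ.expSet q h) y ≤
          2 * quad (estCovMix φ M.init D Δ.expSet q h) y := by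
        have h4 : 0 ≤ thr * ‖y‖ ^ 2 := by positivity
        linarith
      calc (N : ℝ) / 2 * quad (M.mixCov φ Δ.expSet q h) y
          ≤ N / 2 * (2 * quad (estCovMix φ M.init D Δ.expSet q h) y) := by gcongr
        _ = _ := by ring) x
    rwa [inv_div] at h1
  have hbd : ∀ X : Matrix (Fin d) (Fin d) ℝ, ∀ π' : DetPolicy S A H,
      Integrable (fun τ : Traj S A H => quad X (φ (τ h).1 (τ h).2))
        (M.trajLaw (DetPolicy.toPolicy π')) := by
    intro X π'
    simp only [quad_eq_sum]
    exact integrable_finsetSum _ fun i _ => integrable_finsetSum _ fun j _ =>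
      (M.integrable_coord_mul φ _ h i j).const_mul _
  have hobjq : designObjective φ M.init D Δ.expSet B h q ≤ 4 * d / N + B * e := by
    refine ciSup_le fun π' => ?_
    have h1 := (abs_le.1 (hER q hqf π'.1 π'.2)).2
    have h2 : ∫ τ, quad ((N : ℝ) • estCovMix φ M.init D Δ.expSet q h)⁻¹ (φ (τ h).1 (τ h).2)
          ∂(M.trajLaw (DetPolicy.toPolicy π'.1)) ≤ 4 * d / N := by
      calc _ ≤ ∫ τ, 2 / N * quad (M.mixCov φ Δ.expSet q h)⁻¹ (φ (τ h).1 (τ h).2)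
            ∂(M.trajLaw (DetPolicy.toPolicy π'.1)) :=
            integral_mono (hbd _ _) ((hbd _ _).const_mul _) fun τ => hqinv _
        _ = 2 / N * ∫ τ, quad (M.mixCov φ Δ.expSet q h)⁻¹ (φ (τ h).1 (τ h).2)
            ∂(M.trajLaw (DetPolicy.toPolicy π'.1)) := integral_const_mul _ _
        _ ≤ 2 / N * (2 * d) := by gcongr; exact hq2 π'.1 π'.2
        _ = 4 * d / N := by ring
    linarith
  -- Optimality is known only for the estimated objective; passing to true expectations costs `B *
  -- e` once at `p` and once at `q`.
  have hobjp : ∫ τ, quad ((N : ℝ) • estCovMix φ M.init D Δ.expSet p h)⁻¹ (φ (τ h).1 (τ h).2)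
      ∂(M.trajLaw (DetPolicy.toPolicy π)) ≤ 4 * d / N + 2 * (B * e) := by
    have h1 := (abs_le.1 (hER p hpf π hπ)).1
    have h2 : estimateER φ M.init D π (fun s a =>
          quad ((N : ℝ) • estCovMix φ M.init D Δ.expSet p h)⁻¹ (φ s a)) B h ≤
        designObjective φ M.init D Δ.expSet B h p :=
      le_ciSup (f := fun π' : Δ.expSet => estimateER φ M.init D π'.1 (fun s a =>
          quad ((N : ℝ) • estCovMix φ M.init D Δ.expSet p h)⁻¹ (φ s a)) B h)
        (Set.finite_range _).bddAbove ⟨π, hπ⟩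
    have h3 := hpmin q hqf
    linarith
  have hbpd : (1 + batchCov φ b h).PosDef :=
    Matrix.PosDef.one.add_posSemidef (posSemidef_batchCov φ b h)
  -- Estimation and sampling errors together are at most `thr / 2`, hence at most half of the
  -- estimated covariance by feasibility of `p`. The batch matrix thus dominates `N Σ̂_p / 2`.
  have hbinv : ∀ x : Vec d, quad (1 + batchCov φ b h)⁻¹ x ≤
      2 * quad ((N : ℝ) • estCovMix φ M.init D Δ.expSet p h)⁻¹ x := by
    intro x
    have h1 := quad_inv_le_of_le (hpd p hpf) hbpd (c := 1 / 2) (by norm_num) (fun y => by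
      have h1 := (abs_le.1 (abs_quad_le_of_entry_le hcov y)).1
      rw [quad_sub, quad_smul] at h1
      have h2 := (abs_le.1 (hclose p ((hfeas p).1 hpf).1 y)).2
      have h3 := ((hfeas p).1 hpf).2 y
      rw [quad_add, quad_one, quad_smul]
      set u := quad (estCovMix φ M.init D Δ.expSet p h) y
      set v := quad (M.mixCov φ Δ.expSet p h) y
      have h4 : (d * (2 * e) + d * η) * ‖y‖ ^ 2 ≤ thr / 2 * ‖y‖ ^ 2 := by gcongr
      have h5 : (N : ℝ) * (u - d * (2 * e) * ‖y‖ ^ 2 - d * η * ‖y‖ ^ 2) ≥ N * (u / 2) := by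
        refine mul_le_mul_of_nonneg_left ?_ hN'.le
        linarith
      have h6 : (N : ℝ) * v ≥ N * (u - d * (2 * e) * ‖y‖ ^ 2) :=
        mul_le_mul_of_nonneg_left (by linarith) hN'.le
      have h7 : 0 ≤ ‖y‖ ^ 2 := by positivity
      nlinarith) x
    simpa using h1
  have hmem : ∀ τ : Traj S A H, quad (1 + batchCov φ b h)⁻¹ (φ (τ h).1 (τ h).2) ∈
      Set.Icc (0 : ℝ) 1 := fun τ => quad_one_add_inv_mem (posSemidef_batchCov φ b h) _ _
  refine (integral_sqrt_le ((φ.measurable_quad _).comp (measurable_pi_apply h)) hmem).trans ?_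
  refine Real.sqrt_le_iff.2 ⟨ht, ?_⟩
  refine le_trans ?_ hn5
  calc ∫ τ, quad (1 + batchCov φ b h)⁻¹ (φ (τ h).1 (τ h).2) ∂(M.trajLaw (DetPolicy.toPolicy π))
      ≤ ∫ τ, 2 * quad ((N : ℝ) • estCovMix φ M.init D Δ.expSet p h)⁻¹ (φ (τ h).1 (τ h).2)
        ∂(M.trajLaw (DetPolicy.toPolicy π)) :=
        integral_mono (hbd _ _) ((hbd _ _).const_mul _) fun τ => hbinv _
    _ = 2 * ∫ τ, quad ((N : ℝ) • estCovMix φ M.init D Δ.expSet p h)⁻¹ (φ (τ h).1 (τ h).2)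
        ∂(M.trajLaw (DetPolicy.toPolicy π)) := integral_const_mul _ _
    _ ≤ _ := by gcongr

end Layers

/-! ### Logarithmic factors, cardinalities and union bounds. -/

section Numerics

variable {d H : ℕ} {ε δ : ℝ}

lemma exp_logFactor (hd : 2 ≤ d) (hH : 1 ≤ H) (hε : 0 < ε) (hδ : 0 < δ) :
    Real.exp (logFactor d H ε δ) = d * H / (ε * δ) := by
  have hd' : (0 : ℝ) < d := by exact_mod_cast (by omega : 0 < d)
  have hH' : (0 : ℝ) < H := by exact_mod_cast hH
  exact Real.exp_log (by positivity)

/-- With `d ≥ 2` and `ε ≤ 3/8` the argument of the logarithm exceeds `3 > e`. This allows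
lower-order terms to be absorbed into powers of `ι`. -/
lemma one_le_logFactor (hd : 2 ≤ d) (hH : 1 ≤ H) (hε : 0 < ε) (hε1 : ε ≤ 3 / 8) (hδ : 0 < δ)
    (hδ1 : δ < 1) : 1 ≤ logFactor d H ε δ := by
  have hd' : (2 : ℝ) ≤ d := by exact_mod_cast hd
  have hH' : (1 : ℝ) ≤ H := by exact_mod_cast hH
  rw [← Real.exp_le_exp, exp_logFactor hd hH hε hδ]
  have h1 : Real.exp 1 ≤ 3 := Real.exp_one_lt_three.le
  refine h1.trans ?_
  rw [le_div_iff₀ (by positivity)]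
  have h2 : ε * δ ≤ 3 / 8 * 1 := by gcongr
  have h3 : (2 : ℝ) * 1 ≤ d * H := by gcongr
  linarith

/-- A common upper bound for the polynomial quantities of the analysis. -/
noncomputable def polyBound (d H : ℕ) (ε δ : ℝ) : ℝ := Real.exp (9 * logFactor d H ε δ)

lemma polyBound_facts (hd : 2 ≤ d) (hH : 1 ≤ H) (hε : 0 < ε) (hε1 : ε ≤ 3 / 8) (hδ : 0 < δ)
    (hδ1 : δ < 1) :
    1000 * (d * H / (ε * δ)) ≤ polyBound d H ε δ := by
  have h1 := one_le_logFactor hd hH hε hε1 hδ hδ1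
  rw [← exp_logFactor hd hH hε hδ]
  -- Of the exponent `9`, one part reproduces `dH/(εδ)` and the other eight yield the factor `1000`,
  -- since `e⁸ ≥ 1000`.
  have h2 : polyBound d H ε δ = Real.exp (8 * logFactor d H ε δ) * Real.exp (logFactor d H ε δ) := by
    rw [← Real.exp_add, polyBound]; congr 1; ring
  rw [h2]
  gcongr
  have h3 : Real.exp 8 ≤ Real.exp (8 * logFactor d H ε δ) := Real.exp_le_exp.2 (by linarith)
  refine le_trans ?_ h3
  have h4 : (2.7 : ℝ) ≤ Real.exp 1 := by linarith [Real.exp_one_gt_d9]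
  have h5 : Real.exp 8 = Real.exp 1 ^ 8 := by rw [← Real.exp_nat_mul]; norm_num
  rw [h5]
  calc (1000 : ℝ) ≤ 2.7 ^ 8 := by norm_num
    _ ≤ _ := by gcongr

/-- Elementary consequences of `1000 d H / (ε δ) ≤ E`. -/
lemma polyBound_consequences (hd : 2 ≤ d) (hH : 1 ≤ H) (hε : 0 < ε) (hε1 : ε ≤ 3 / 8)
    (hδ : 0 < δ) (hδ1 : δ < 1) {E : ℝ} (hE : 1000 * (d * H / (ε * δ)) ≤ E) :
    1000 ≤ E ∧ (d : ℝ) ≤ E ∧ (H : ℝ) ≤ E ∧ E⁻¹ ^ 2 ≤ δ / 3 ∧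
      1000 * (d * H / ε) ≤ E := by
  have hd' : (1 : ℝ) ≤ d := by exact_mod_cast (by omega : 1 ≤ d)
  have hH' : (1 : ℝ) ≤ H := by exact_mod_cast hH
  have e1 : (d : ℝ) * H / ε ≤ d * H / (ε * δ) := by
    gcongr
    exact mul_le_of_le_one_right hε.le hδ1.le
  have e2 : (d : ℝ) * H ≤ d * H / ε := by
    rw [le_div_iff₀ hε]
    exact mul_le_of_le_one_right (by positivity) (by linarith)
  have e3 : (1 : ℝ) ≤ d * H := one_le_mul_of_one_le_of_one_le hd' hH'
  have e4 : (d : ℝ) ≤ d * H := le_mul_of_one_le_right (by positivity) hH'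
  have e5 : (H : ℝ) ≤ d * H := le_mul_of_one_le_left (by positivity) hd'
  have e6 : δ⁻¹ ≤ d * H / (ε * δ) := by
    have : (d : ℝ) * H / (ε * δ) = (d * H / ε) * δ⁻¹ := by field_simp
    rw [this]
    exact le_mul_of_one_le_left (by positivity) (by linarith)
  have hE0 : 1000 ≤ E := by linarith
  refine ⟨hE0, by linarith, by linarith, ?_, by linarith⟩
  have h1 : δ⁻¹ ≤ E := by linarith
  have h2 : E⁻¹ ≤ δ := (inv_le_comm₀ (by linarith) hδ).2 h1
  have h3 : E⁻¹ ≤ 1 / 3 := by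
    rw [inv_le_comm₀ (by linarith) (by norm_num)]; norm_num; linarith
  have h4 : 0 < E⁻¹ := inv_pos.2 (by linarith)
  rw [sq]
  calc E⁻¹ * E⁻¹ ≤ δ * (1 / 3) := by gcongr
    _ = δ / 3 := by ring

lemma layerBudget_pos (hd : 2 ≤ d) (hH : 1 ≤ H) (hε : 0 < ε) (hι : 1 ≤ logFactor d H ε δ) :
    0 < layerBudget (1 / 1000) d H ε δ := by
  have hd' : (0 : ℝ) < d := by exact_mod_cast (by omega : 0 < d)
  have hH' : (0 : ℝ) < H := by exact_mod_cast hH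
  have : 0 < logFactor d H ε δ := by linarith
  unfold layerBudget
  positivity

lemma episodes_arg_eq (hd : 2 ≤ d) (hH : 1 ≤ H) (hε : 0 < ε) (hι : 1 ≤ logFactor d H ε δ) :
    1000 * d * logFactor d H ε δ / layerBudget (1 / 1000) d H ε δ ^ 2 =
      1000 ^ 3 * ((d : ℝ) ^ 2 * (H : ℝ) ^ 4 / ε ^ 2 * logFactor d H ε δ ^ 3) := by
  have hd' : (0 : ℝ) < d := by exact_mod_cast (by omega : 0 < d)
  have hH' : (0 : ℝ) < H := by exact_mod_cast hH
  have : 0 < logFactor d H ε δ := by linarith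
  have hs : √(d : ℝ) ^ 2 = d := Real.sq_sqrt hd'.le
  have hs0 : 0 < √(d : ℝ) := Real.sqrt_pos.2 hd'
  unfold layerBudget
  rw [div_pow, mul_pow, mul_pow, mul_pow, hs]
  field_simp

lemma one_le_episodes_term (hd : 2 ≤ d) (hH : 1 ≤ H) (hε : 0 < ε) (hε1 : ε ≤ 3 / 8)
    (hι : 1 ≤ logFactor d H ε δ) :
    1 ≤ (d : ℝ) ^ 2 * (H : ℝ) ^ 4 / ε ^ 2 * logFactor d H ε δ ^ 3 := by
  have hd' : (1 : ℝ) ≤ d := by exact_mod_cast (by omega : 1 ≤ d)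
  have hH' : (1 : ℝ) ≤ H := by exact_mod_cast hH
  refine one_le_mul_of_one_le_of_one_le ?_ (one_le_pow₀ hι)
  rw [one_le_div (by positivity)]
  calc ε ^ 2 ≤ 1 := pow_le_one₀ hε.le (by linarith)
    _ ≤ _ := one_le_mul_of_one_le_of_one_le (one_le_pow₀ hd') (one_le_pow₀ hH')

lemma episodes_le (hd : 2 ≤ d) (hH : 1 ≤ H) (hε : 0 < ε) (hε1 : ε ≤ 3 / 8)
    (hι : 1 ≤ logFactor d H ε δ) :
    (episodes (1 / 1000) 1000 d H ε δ : ℝ) ≤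
      (1000 ^ 3 + 1) * ((d : ℝ) ^ 2 * (H : ℝ) ^ 4 / ε ^ 2 * logFactor d H ε δ ^ 3) := by
  have h1 := one_le_episodes_term hd hH hε hε1 hι
  have h2 := (Nat.ceil_lt_add_one (a := 1000 * d * logFactor d H ε δ /
    layerBudget (1 / 1000) d H ε δ ^ 2) (by
      rw [episodes_arg_eq hd hH hε hι]; linarith)).le
  rw [episodes]
  rw [episodes_arg_eq hd hH hε hι] at h2 ⊢
  linarith

lemma le_episodes : 1000 * d * logFactor d H ε δ / layerBudget (1 / 1000) d H ε δ ^ 2 ≤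
    (episodes (1 / 1000) 1000 d H ε δ : ℝ) := Nat.le_ceil _

lemma episodes_le_pow (hd : 2 ≤ d) (hH : 1 ≤ H) (hε : 0 < ε) (hε1 : ε ≤ 3 / 8) (hδ : 0 < δ)
    (hδ1 : δ < 1) : (episodes (1 / 1000) 1000 d H ε δ : ℝ) ≤ polyBound d H ε δ ^ 8 := by
  have hι := one_le_logFactor hd hH hε hε1 hδ hδ1
  have hE := polyBound_facts hd hH hε hε1 hδ hδ1
  set E := polyBound d H ε δ
  obtain ⟨h1000, hdE, hHE, hδE, hXE⟩ := polyBound_consequences hd hH hε hε1 hδ hδ1 hE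
  have hd' : (1 : ℝ) ≤ d := by exact_mod_cast (by omega : 1 ≤ d)
  have hH' : (1 : ℝ) ≤ H := by exact_mod_cast hH
  refine (episodes_le hd hH hε hε1 hι).trans ?_
  have h1 : (d : ℝ) ^ 2 * (H : ℝ) ^ 4 / ε ^ 2 ≤ (E / 1000) ^ 4 := by
    have e1 : (d : ℝ) * H / ε ≤ E / 1000 := by linarith
    have e2 : (d : ℝ) ^ 2 * (H : ℝ) ^ 4 / ε ^ 2 ≤ (d * H / ε) ^ 4 := by
      rw [div_pow, mul_pow]
      have : ε ^ 4 ≤ ε ^ 2 := pow_le_pow_of_le_one hε.le (by linarith) (by norm_num)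
      have : (d : ℝ) ^ 2 ≤ d ^ 4 := pow_le_pow_right₀ hd' (by norm_num)
      gcongr
    exact e2.trans (by gcongr)
  have h2 : logFactor d H ε δ ≤ E / 1000 := by
    have e1 : logFactor d H ε δ + 1 ≤ Real.exp (logFactor d H ε δ) := Real.add_one_le_exp _
    rw [exp_logFactor hd hH hε hδ] at e1
    linarith
  have hE0 : 0 ≤ E := by linarith
  have hι0 : 0 ≤ logFactor d H ε δ := by linarith
  calc (1000 ^ 3 + 1) * ((d : ℝ) ^ 2 * (H : ℝ) ^ 4 / ε ^ 2 * logFactor d H ε δ ^ 3)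
      ≤ (1000 ^ 3 + 1) * ((E / 1000) ^ 4 * (E / 1000) ^ 3) := by gcongr
    _ = (1000 ^ 3 + 1) / 1000 ^ 7 * E ^ 7 := by ring
    _ ≤ E * E ^ 7 := by
      gcongr
      norm_num
      linarith
    _ = E ^ 8 := by ring

lemma radius_le_pow {E : ℝ} (h1000 : 1000 ≤ E) (hdE : (d : ℝ) ≤ E) (hHE : (H : ℝ) ≤ E) {N : ℕ}
    (hN : (N : ℝ) ≤ E ^ 8) : ((H * N + d : ℕ) : ℝ) ≤ E ^ 10 := by
  push_cast
  have hE0 : 0 ≤ E := by linarith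
  calc (H : ℝ) * N + d ≤ E * E ^ 8 + E := by gcongr
    _ ≤ E * E ^ 8 + E ^ 9 := by
      gcongr
      exact le_self_pow₀ (by linarith) (by norm_num)
    _ = 2 * E ^ 9 := by ring
    _ ≤ E * E ^ 9 := by gcongr; linarith
    _ = E ^ 10 := by ring

lemma gridSize_le_pow {E R m : ℝ} (h1000 : 1000 ≤ E) (hR0 : 0 ≤ R) (hR : R ≤ E ^ 10)
    (hm0 : 0 ≤ m) (hm : m ≤ E ^ 3) : 2 * R ^ 3 * m + 1 ≤ E ^ 35 := by
  have hE0 : 0 ≤ E := by linarith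
  have h1 : (1 : ℝ) ≤ E ^ 33 := one_le_pow₀ (by linarith)
  calc 2 * R ^ 3 * m + 1 ≤ 2 * (E ^ 10) ^ 3 * E ^ 3 + E ^ 33 := by gcongr
    _ = 3 * E ^ 33 := by ring
    _ ≤ E ^ 2 * E ^ 33 := by gcongr; nlinarith
    _ = E ^ 35 := by ring

variable {S A : Type*} [MeasurableSpace S] [MeasurableSpace A] {φ : FeatureMap S A d}

lemma linCover_card_le_pow (Δ : Discretization φ H (ε / 3)) (hd : 2 ≤ d) (hH : 1 ≤ H) (hε : 0 < ε)
    (hε1 : ε ≤ 3 / 8) {E : ℝ} (h1000 : 1000 ≤ E) (hXE : 1000 * (d * H / ε) ≤ E) :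
    (Δ.linCover.card : ℝ) ≤ (E ^ 4) ^ d := by
  refine Δ.linCover_card.trans ?_
  have hd' : (1 : ℝ) ≤ d := by exact_mod_cast (by omega : 1 ≤ d)
  have hH' : (1 : ℝ) ≤ H := by exact_mod_cast hH
  have hE0 : 0 ≤ E := by linarith
  have hs : √(d : ℝ) ≤ d := Real.sqrt_le_iff.2 ⟨by positivity, by nlinarith⟩
  have h1 : (H : ℝ) ^ 2 * √(d : ℝ) / ε ≤ (d * H / ε) ^ 2 := by
    rw [div_pow, mul_pow]
    have e1 : ε ^ 2 ≤ ε := by nlinarith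
    have e2 : (H : ℝ) ^ 2 * √(d : ℝ) ≤ d ^ 2 * H ^ 2 := by
      have : √(d : ℝ) ≤ (d : ℝ) ^ 2 := hs.trans (by nlinarith)
      nlinarith [sq_nonneg (H : ℝ)]
    gcongr
  have h2 : (d * H / ε : ℝ) ^ 2 ≤ E ^ 2 := by
    have : (0 : ℝ) ≤ d * H / ε := by positivity
    gcongr
    linarith
  gcongr
  have h3 : 8 * (H : ℝ) ^ 2 * √(d : ℝ) / (ε / 3) = 24 * ((H : ℝ) ^ 2 * √(d : ℝ) / ε) := by
    field_simp; norm_num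
  rw [h3]
  have h5 : (1000 : ℝ) ^ 2 ≤ E ^ 2 := by gcongr
  nlinarith [sq_nonneg (E ^ 2)]

lemma rewCover_card_le_pow (Δ : Discretization φ H (ε / 3)) (hd : 2 ≤ d) (hH : 1 ≤ H) (hε : 0 < ε)
    {E : ℝ} (h1000 : 1000 ≤ E) (hXE : 1000 * (d * H / ε) ≤ E) :
    (Δ.rewCover.card : ℝ) ≤ (E ^ 4) ^ (d ^ 2) := by
  refine Δ.rewCover_card.trans ?_
  have hd' : (1 : ℝ) ≤ d := by exact_mod_cast (by omega : 1 ≤ d)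
  have hH' : (1 : ℝ) ≤ H := by exact_mod_cast hH
  have hE0 : 0 ≤ E := by linarith
  have hs : √(d : ℝ) ≤ d := Real.sqrt_le_iff.2 ⟨by positivity, by nlinarith⟩
  have h1 : (H : ℝ) ^ 2 * √(d : ℝ) / ε ^ 2 ≤ (d * H / ε) ^ 2 := by
    rw [div_pow, mul_pow]
    have e2 : (H : ℝ) ^ 2 * √(d : ℝ) ≤ d ^ 2 * H ^ 2 := by
      have : √(d : ℝ) ≤ (d : ℝ) ^ 2 := hs.trans (by nlinarith)
      nlinarith [sq_nonneg (H : ℝ)]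
    gcongr
  have h2 : (d * H / ε : ℝ) ^ 2 ≤ E ^ 2 := by
    have : (0 : ℝ) ≤ d * H / ε := by positivity
    gcongr
    linarith
  gcongr
  have h3 : 32 * (H : ℝ) ^ 2 * √(d : ℝ) / (ε / 3) ^ 2 = 288 * ((H : ℝ) ^ 2 * √(d : ℝ) / ε ^ 2) := by
    field_simp; norm_num
  rw [h3]
  have h5 : (1000 : ℝ) ^ 2 ≤ E ^ 2 := by gcongr
  nlinarith [sq_nonneg (E ^ 2)]

lemma evalRules_card_le {ε₀ : ℝ} (Δ : Discretization φ H ε₀) (h : Fin H) :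
    ((Δ.evalRules h).card : ℝ) ≤ Δ.linCover.card := by
  classical
  have : (Δ.evalRules h).card ≤ Δ.linCover.card := by
    unfold Discretization.evalRules
    exact Finset.card_image_le
  exact_mod_cast this

lemma expRules_card_le {ε₀ : ℝ} (Δ : Discretization φ H ε₀) (h : Fin H) :
    ((Δ.expRules h).card : ℝ) ≤ Δ.rewCover.card + Δ.linCover.card := by
  classical
  have : (Δ.expRules h).card ≤ Δ.rewCover.card + Δ.linCover.card := by
    unfold Discretization.expRules
    exact (Finset.card_union_le _ _).trans (add_le_add Finset.card_image_le Finset.card_image_le)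
  exact_mod_cast this

/-- In powers of `E`: layers and prefixes cost `3`, the rules `5d²`, the grid of dimension `d² + 2d
+ 1` at most `105d²`. The failure exponent `142d²` leaves more than the `2` needed to get below
`δ/3`. -/
lemma union_bound_exp {E c g : ℝ} (hd : 2 ≤ d) (h1000 : 1000 ≤ E) (hHE : (H : ℝ) ≤ E)
    (hc0 : 0 ≤ c) (hc : c ≤ (E ^ 4) ^ (d ^ 2) + (E ^ 4) ^ d) (hg0 : 0 ≤ g) (hg : g ≤ E ^ 35)
    (hδE : E⁻¹ ^ 2 ≤ δ / 3) :
    H * ((H : ℝ) + 1) * c * g ^ (d + (d + (d * d + 1))) * (E ^ (142 * d ^ 2))⁻¹ ≤ δ / 3 := by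
  refine le_trans ?_ hδE
  have hE0 : 0 < E := by linarith
  have hE1 : 1 ≤ E := by linarith
  have h1 : (H : ℝ) * (H + 1) ≤ E ^ 3 := by
    have : (0 : ℝ) ≤ H := Nat.cast_nonneg _
    calc (H : ℝ) * (H + 1) ≤ E * (E + E) := by gcongr
      _ = 2 * E ^ 2 := by ring
      _ ≤ E * E ^ 2 := by gcongr; linarith
      _ = E ^ 3 := by ring
  have h2 : c ≤ E ^ (5 * d ^ 2) := by
    have e1 : (E ^ 4) ^ d ≤ (E ^ 4) ^ (d ^ 2) :=
      pow_le_pow_right₀ (one_le_pow₀ hE1) (by nlinarith)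
    calc c ≤ 2 * E ^ (4 * d ^ 2) := by rw [pow_mul]; linarith
      _ ≤ E ^ (d ^ 2) * E ^ (4 * d ^ 2) := by
        gcongr
        calc (2 : ℝ) ≤ E := by linarith
          _ ≤ E ^ (d ^ 2) := le_self_pow₀ hE1 (by positivity)
      _ = E ^ (5 * d ^ 2) := by rw [← pow_add]; congr 1; ring
  have h3 : g ^ (d + (d + (d * d + 1))) ≤ E ^ (105 * d ^ 2) := by
    calc g ^ (d + (d + (d * d + 1))) ≤ (E ^ 35) ^ (d + (d + (d * d + 1))) := by gcongr
      _ = E ^ (35 * (d + (d + (d * d + 1)))) := (pow_mul _ _ _).symm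
      _ ≤ E ^ (105 * d ^ 2) := pow_le_pow_right₀ hE1 (by nlinarith)
  calc H * ((H : ℝ) + 1) * c * g ^ (d + (d + (d * d + 1))) * (E ^ (142 * d ^ 2))⁻¹
      ≤ E ^ 3 * E ^ (5 * d ^ 2) * E ^ (105 * d ^ 2) * (E ^ (142 * d ^ 2))⁻¹ := by gcongr
    _ ≤ E⁻¹ ^ 2 := by
      rw [inv_pow, ← div_eq_mul_inv, div_le_iff₀ (by positivity), ← div_eq_inv_mul,
        le_div_iff₀ (by positivity), ← pow_add, ← pow_add, ← pow_add]
      exact pow_le_pow_right₀ hE1 (by nlinarith)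

/-- Here neither the rules (`4d`) nor the grid of dimension `2d` (`70d`) contributes a `d²`. This
linear count is what saves a factor `√d` in planning. -/
lemma union_bound_eval {E c g : ℝ} (hd : 2 ≤ d) (h1000 : 1000 ≤ E) (hHE : (H : ℝ) ≤ E)
    (hc0 : 0 ≤ c) (hc : c ≤ (E ^ 4) ^ d) (hg0 : 0 ≤ g) (hg : g ≤ E ^ 35) (hδE : E⁻¹ ^ 2 ≤ δ / 3) :
    H * ((H : ℝ) + 1) * c * g ^ (d + d) * (E ^ (97 * d))⁻¹ ≤ δ / 3 := by
  refine le_trans ?_ hδE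
  have hE0 : 0 < E := by linarith
  have hE1 : 1 ≤ E := by linarith
  have h1 : (H : ℝ) * (H + 1) ≤ E ^ 3 := by
    have : (0 : ℝ) ≤ H := Nat.cast_nonneg _
    calc (H : ℝ) * (H + 1) ≤ E * (E + E) := by gcongr
      _ = 2 * E ^ 2 := by ring
      _ ≤ E * E ^ 2 := by gcongr; linarith
      _ = E ^ 3 := by ring
  have h3 : g ^ (d + d) ≤ E ^ (70 * d) := by
    calc g ^ (d + d) ≤ (E ^ 35) ^ (d + d) := by gcongr
      _ = E ^ (35 * (d + d)) := (pow_mul _ _ _).symm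
      _ ≤ E ^ (70 * d) := pow_le_pow_right₀ hE1 (by linarith)
  calc H * ((H : ℝ) + 1) * c * g ^ (d + d) * (E ^ (97 * d))⁻¹
      ≤ E ^ 3 * (E ^ 4) ^ d * E ^ (70 * d) * (E ^ (97 * d))⁻¹ := by gcongr
    _ ≤ E⁻¹ ^ 2 := by
      rw [inv_pow, ← div_eq_mul_inv, div_le_iff₀ (by positivity), ← div_eq_inv_mul,
        le_div_iff₀ (by positivity), ← pow_mul, ← pow_add, ← pow_add, ← pow_add]
      exact pow_le_pow_right₀ hE1 (by omega)

lemma union_bound_cov {E : ℝ} (h1000 : 1000 ≤ E) (hHE : (H : ℝ) ≤ E) (hdE : (d : ℝ) ≤ E)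
    (hδE : E⁻¹ ^ 2 ≤ δ / 3) : H * (d : ℝ) ^ 2 * 2 * (E ^ 6)⁻¹ ≤ δ / 3 := by
  refine le_trans ?_ hδE
  have hE0 : 0 < E := by linarith
  calc H * (d : ℝ) ^ 2 * 2 * (E ^ 6)⁻¹ ≤ E * E ^ 2 * E * (E ^ 6)⁻¹ := by gcongr; linarith
    _ = E⁻¹ ^ 2 := by field_simp

end Numerics

/-! ### Induction over layers, and planning. -/

section Exploration

variable {S A : Type*} [MeasurableSpace S] [MeasurableSpace A] {H d : ℕ} {φ : FeatureMap S A d}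
  {C₁ C₂ C₃ ε δ : ℝ}

/-- On the good event, all design problems are feasible and all layers are well explored. -/
lemma explore_layers {M : MDP S A H} (hM : M.IsLinear φ) (hd : 0 < d) (hε : 0 ≤ ε / 3)
    {Δ : Discretization φ H (ε / 3)} (sol : DesignSolver φ M.init C₁ C₂ C₃ ε δ Δ)
    (hlam : 0 < M.explorability φ) (hεlam : ε / 3 ≤ M.explorability φ / 4)
    (hN : 0 < episodes C₁ C₂ d H ε δ) (D : Dataset S A H (episodes C₁ C₂ d H ε δ) H)
    {R β β' η t : ℝ} (hthr : 0 < eigThreshold C₁ C₃ d H ε δ) (hR1 : 1 ≤ R) (ht : 0 ≤ t)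
    (hR : (H : ℝ) * episodes C₁ C₂ d H ε δ ≤ R) (hβ : 0 ≤ β) (hββ' : β ≤ β')
    (hgood : ∀ k hk, RegressionGood φ M (D.take k hk) (quadFeature φ) Δ.expRules R β)
    (hn2 : d * (2 * (β' * (H * t))) + d * η ≤ eigThreshold C₁ C₃ d H ε δ / 2) (hη : 0 ≤ η)
    (hn3 : eigThreshold C₁ C₃ d H ε δ ≤ M.explorability φ ^ 2 / (32 * d))
    (hn4 : (episodes C₁ C₂ d H ε δ * eigThreshold C₁ C₃ d H ε δ)⁻¹ ≤ rewardBound C₁ C₂ d H ε δ)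
    (hn5 : 2 * (4 * d / episodes C₁ C₂ d H ε δ +
      2 * (rewardBound C₁ C₂ d H ε δ * (β' * (H * t)))) ≤ t ^ 2)
    (hcov : ∀ (h : Fin H) (i j : Fin d), |(batchCov φ (D h) h -
      (episodes C₁ C₂ d H ε δ : ℝ) • M.mixCov φ Δ.expSet (sol.weights h (D.before h)) h) i j| ≤
        episodes C₁ C₂ d H ε δ * η) (h : Fin H) :
    (∃ q, DesignFeasible φ M.init (D.before h) Δ.expSet (eigThreshold C₁ C₃ d H ε δ) h q) ∧
      ∀ π ∈ Δ.expSet, batchBonus φ M (D h) π h ≤ t := by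
  obtain ⟨n, hn⟩ := h
  -- Estimates at layer `n` use only the first `n` batches, and their error involves only bonuses of
  -- strictly earlier layers, so there is no circularity. The accuracy fed to `layer_step` is the
  -- same at all layers: errors do not compound.
  induction n using Nat.strong_induction_on with
  | _ n ih =>
    refine layer_step hM hd hε Δ hlam hεlam hN (D.before ⟨n, hn⟩) (D ⟨n, hn⟩) ⟨n, hn⟩ hthr hR1 ht
      (e := β' * (H * t)) ?_ hn2 hη hn3 hn4 hn5 (sol.argmin ⟨n, hn⟩ (D.before ⟨n, hn⟩))
      (hcov ⟨n, hn⟩)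
    intro B hB π hπ X c hX hc hf
    have hkR : (n : ℝ) * episodes C₁ C₂ d H ε δ ≤ R := by
      refine le_trans ?_ hR
      gcongr
    have h1 := abs_estimateER_sub_le φ M (D.take n hn.le) π (Δ.mem_expRules hπ) hB hkR
      (hgood n hn.le) ⟨n, hn⟩ hX hc hf
    have h2 := bonusSum_take_le φ M D π n n le_rfl hn.le ht fun i hi =>
      (ih i.1 hi i.isLt).2 π hπ
    refine h1.trans ?_
    rw [mul_assoc]
    have h3 : 0 ≤ (H : ℝ) * t := by positivity
    calc B * (β * bonusSum φ M (D.take n hn.le) π n hn.le) ≤ B * (β * (H * t)) := by gcongr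
      _ ≤ B * (β' * (H * t)) := by gcongr

/-- Planning with uniformly accurate value estimates. -/
lemma planning_near_optimal {M : MDP S A H} (hM : M.IsLinear φ) (hH : 1 ≤ H)
    (Δ : Discretization φ H (ε / 3)) {N k : ℕ} (D : Dataset S A H N k)
    {r : Fin H → S → A → ℝ} (hr : FeasibleReward φ r)
    (hest : ∀ π ∈ Δ.evalSet,
      |estimateV φ M.init D π r - M.value (DetPolicy.toPolicy π) r| ≤ ε / 3) :
    (∃ π, IsPlanningOutput M.init Δ D r π) ∧ ∀ π, IsPlanningOutput M.init Δ D r π →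
      M.optValue r - ε ≤ M.value (DetPolicy.toPolicy π) r := by
  constructor
  · obtain ⟨π, hπ, hmax⟩ := Δ.evalSet.exists_max_image (fun π => estimateV φ M.init D π r)
      Δ.evalSet_nonempty
    exact ⟨π, hπ, hmax⟩
  · rintro π ⟨hπ, hmax⟩
    obtain ⟨π₀, hπ₀, hopt⟩ := hM.exists_evalSet_near_optimal hH Δ hr
    have : Nonempty (Policy S A H) := ⟨DetPolicy.toPolicy π⟩
    -- Restricting to the cover loses `ε/3`; the estimates at `π₀` and at `π` lose `ε/3` each.
    have h1 : M.optValue r ≤ M.value (DetPolicy.toPolicy π₀) r + ε / 3 := ciSup_le hopt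
    have h2 := (abs_le.1 (hest π₀ hπ₀)).1
    have h3 := (abs_le.1 (hest π hπ)).2
    have h4 := hmax π₀ hπ₀
    linarith

end Exploration

/-! ### Verification of the numerical conditions for the chosen constants. -/

section Constants

variable {d H : ℕ} {ε δ : ℝ}

/-- The regression factor of exploration: the square root of an exponent of order `d²ι`. -/
lemma sqrt_add_sqrt_le_exp {d : ℕ} (hd : 2 ≤ d) {ι : ℝ} (hι : 1 ≤ ι) :
    √(2 * (142 * (d : ℝ) ^ 2 * (9 * ι) + 1)) + √(d : ℝ) ≤ 52 * (d * ι) := by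
  have hd' : (2 : ℝ) ≤ d := by exact_mod_cast hd
  have hdι : (d : ℝ) ≤ d * ι := le_mul_of_one_le_right (by positivity) hι
  have h1 : √(2 * (142 * (d : ℝ) ^ 2 * (9 * ι) + 1)) ≤ 51 * (d * ι) := by
    refine Real.sqrt_le_iff.2 ⟨by positivity, ?_⟩
    have e1 : (d : ℝ) ^ 2 * ι ≤ (d : ℝ) ^ 2 * ι ^ 2 := by
      gcongr; nlinarith
    have e2 : (1 : ℝ) ≤ (d : ℝ) ^ 2 * ι ^ 2 :=
      one_le_mul_of_one_le_of_one_le (one_le_pow₀ (by linarith)) (one_le_pow₀ hι)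
    nlinarith
  have h2 : √(d : ℝ) ≤ d := Real.sqrt_le_iff.2 ⟨by positivity, by nlinarith⟩
  linarith

lemma sqrt_add_sqrt_le_eval {d : ℕ} (hd : 2 ≤ d) {ι : ℝ} (hι : 1 ≤ ι) :
    √(2 * (97 * (d : ℝ) * (9 * ι) + 1)) + √(d : ℝ) ≤ 43 * (√(d : ℝ) * ι) := by
  have hd' : (2 : ℝ) ≤ d := by exact_mod_cast hd
  have hs : √(d : ℝ) ^ 2 = d := Real.sq_sqrt (by positivity)
  have h1 : √(2 * (97 * (d : ℝ) * (9 * ι) + 1)) ≤ 42 * (√(d : ℝ) * ι) := by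
    refine Real.sqrt_le_iff.2 ⟨by positivity, ?_⟩
    rw [mul_pow, mul_pow, hs]
    have e1 : (d : ℝ) * ι ≤ (d : ℝ) * ι ^ 2 := by
      gcongr; nlinarith
    have e2 : (2 : ℝ) ≤ (d : ℝ) * ι ^ 2 := by
      have : (1 : ℝ) ≤ ι ^ 2 := one_le_pow₀ hι
      nlinarith
    nlinarith
  have h2 : √(d : ℝ) ≤ √(d : ℝ) * ι := le_mul_of_one_le_right (by positivity) hι
  linarith

lemma le_episodes_mul_sq (hb : 0 < layerBudget (1 / 1000) d H ε δ) :
    1000 * d * logFactor d H ε δ ≤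
      episodes (1 / 1000) 1000 d H ε δ * layerBudget (1 / 1000) d H ε δ ^ 2 :=
  (div_le_iff₀ (by positivity)).1 le_episodes

/-- Estimation contributes `104 d²Hε̄ι` and sampling `dε̄`, against half of the threshold, `500
d²Hε̄ι`. -/
lemma estimation_error_le (hd : 2 ≤ d) (hH : 1 ≤ H) (hι : 1 ≤ logFactor d H ε δ)
    (hb : 0 < layerBudget (1 / 1000) d H ε δ) :
    d * (2 * (52 * (d * logFactor d H ε δ) * (H * layerBudget (1 / 1000) d H ε δ))) +
      d * layerBudget (1 / 1000) d H ε δ ≤ eigThreshold (1 / 1000) 1000 d H ε δ / 2 := by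
  have hd' : (1 : ℝ) ≤ d := by exact_mod_cast (by omega : 1 ≤ d)
  have hH' : (1 : ℝ) ≤ H := by exact_mod_cast hH
  unfold eigThreshold
  set b := layerBudget (1 / 1000) d H ε δ
  set ι := logFactor d H ε δ
  have h1 : (1 : ℝ) ≤ d * H * ι :=
    one_le_mul_of_one_le_of_one_le (one_le_mul_of_one_le_of_one_le hd' hH') hι
  have h2 : d * b ≤ d * b * (d * H * ι) := le_mul_of_one_le_right (by positivity) h1
  have h3 : 0 ≤ d * b * (d * H * ι) := by positivity
  nlinarith

/-- The factor `ι` cancels and the threshold is just `d^{3/2} ε / H`, so smallness of `ε` suffices.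
Of the logarithm only `log(1/λ^⋆) ≥ 1/2` is used, from `λ^⋆ ≤ 1/d ≤ 1/2`. -/
lemma eigThreshold_le (hd : 2 ≤ d) (hH : 1 ≤ H) (hι : 1 ≤ logFactor d H ε δ) {lam : ℝ}
    (hlam : 0 < lam) (hlamd : lam ≤ 1 / d)
    (hε : ε < H * lam ^ 2 / (32 * (d : ℝ) ^ (7 / 2 : ℝ) * Real.log (1 / lam))) :
    eigThreshold (1 / 1000) 1000 d H ε δ ≤ lam ^ 2 / (32 * d) := by
  have hd' : (2 : ℝ) ≤ d := by exact_mod_cast hd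
  have hH' : (1 : ℝ) ≤ H := by exact_mod_cast hH
  have hs : √(d : ℝ) ^ 2 = d := Real.sq_sqrt (by positivity)
  have hs0 : 0 < √(d : ℝ) := Real.sqrt_pos.2 (by positivity)
  have hι0 : logFactor d H ε δ ≠ 0 := by linarith
  have hpow : (d : ℝ) ^ (7 / 2 : ℝ) = d ^ 3 * √(d : ℝ) := by
    rw [Real.sqrt_eq_rpow, ← Real.rpow_natCast, ← Real.rpow_add (by positivity)]
    norm_num
  have hlog : 1 / 2 ≤ Real.log (1 / lam) := by
    have h1 : (2 : ℝ) ≤ 1 / lam := by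
      rw [le_div_iff₀ hlam]
      rw [le_div_iff₀ (by positivity)] at hlamd
      nlinarith
    have h2 := Real.log_le_log (by norm_num) h1
    linarith [Real.log_two_gt_d9]
  rw [hpow] at hε
  set l := Real.log (1 / lam)
  have heq : eigThreshold (1 / 1000) 1000 d H ε δ = (d : ℝ) ^ 2 / (H * √(d : ℝ)) * ε := by
    unfold eigThreshold layerBudget
    field_simp
  rw [heq]
  calc (d : ℝ) ^ 2 / (H * √(d : ℝ)) * ε
      ≤ (d : ℝ) ^ 2 / (H * √(d : ℝ)) * (H * lam ^ 2 / (32 * (d ^ 3 * √(d : ℝ)) * l)) := by gcongr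
    _ = lam ^ 2 / (32 * (d * √(d : ℝ) ^ 2 * l)) := by field_simp
    _ = lam ^ 2 / (32 * (d * d * l)) := by rw [hs]
    _ ≤ lam ^ 2 / (32 * d) := by
      gcongr
      have : 1 ≤ d * l := by nlinarith
      nlinarith

lemma eigThreshold_pos (hd : 2 ≤ d) (hH : 1 ≤ H) (hι : 1 ≤ logFactor d H ε δ)
    (hb : 0 < layerBudget (1 / 1000) d H ε δ) : 0 < eigThreshold (1 / 1000) 1000 d H ε δ := by
  have hd' : (0 : ℝ) < d := by exact_mod_cast (by omega : 0 < d)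
  have hH' : (0 : ℝ) < H := by exact_mod_cast hH
  have : 0 < logFactor d H ε δ := by linarith
  unfold eigThreshold
  positivity

lemma episodes_pos (hd : 2 ≤ d) (hι : 1 ≤ logFactor d H ε δ)
    (hb : 0 < layerBudget (1 / 1000) d H ε δ) : 0 < episodes (1 / 1000) 1000 d H ε δ := by
  have hd' : (0 : ℝ) < d := by exact_mod_cast (by omega : 0 < d)
  have : 0 < logFactor d H ε δ := by linarith
  refine Nat.ceil_pos.2 ?_
  positivity

/-- The product of bound, batch size and threshold is `Nε̄²/(dι)`, and `N` was chosen to make this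
at least `1`. -/
lemma inv_le_rewardBound (hd : 2 ≤ d) (hH : 1 ≤ H) (hι : 1 ≤ logFactor d H ε δ)
    (hb : 0 < layerBudget (1 / 1000) d H ε δ) :
    (episodes (1 / 1000) 1000 d H ε δ * eigThreshold (1 / 1000) 1000 d H ε δ)⁻¹ ≤
      rewardBound (1 / 1000) 1000 d H ε δ := by
  have hd' : (0 : ℝ) < d := by exact_mod_cast (by omega : 0 < d)
  have hH' : (0 : ℝ) < H := by exact_mod_cast hH
  have hN : (0 : ℝ) < episodes (1 / 1000) 1000 d H ε δ := by
    exact_mod_cast episodes_pos hd hι hb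
  have hle := le_episodes_mul_sq hb
  unfold eigThreshold rewardBound
  set b := layerBudget (1 / 1000) d H ε δ
  set ι := logFactor d H ε δ
  set N : ℝ := Nat.cast (episodes (1 / 1000) 1000 d H ε δ)
  have hι0 : 0 < ι := by linarith
  rw [inv_le_iff_one_le_mul₀ (by positivity)]
  have : b / (1000 * (d : ℝ) ^ 3 * H * ι ^ 2) * (N * (1000 * (d : ℝ) ^ 2 * H * b * ι)) =
      N * b ^ 2 / (d * ι) := by
    field_simp
  rw [this, one_le_div (by positivity)]
  nlinarith [mul_pos hd' hι0]

/-- Both terms are small multiples of `ε̄²`: `8d/N` by the choice of `N`, and the estimation error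
because `B` contains a factor `ε̄` next to that of the bonuses. -/
lemma design_error_le (hd : 2 ≤ d) (hH : 1 ≤ H) (hι : 1 ≤ logFactor d H ε δ)
    (hb : 0 < layerBudget (1 / 1000) d H ε δ) :
    2 * (4 * d / episodes (1 / 1000) 1000 d H ε δ + 2 * (rewardBound (1 / 1000) 1000 d H ε δ *
      (52 * (d * logFactor d H ε δ) * (H * layerBudget (1 / 1000) d H ε δ)))) ≤
      layerBudget (1 / 1000) d H ε δ ^ 2 := by
  have hd' : (1 : ℝ) ≤ d := by exact_mod_cast (by omega : 1 ≤ d)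
  have hH' : (0 : ℝ) < H := by exact_mod_cast hH
  have hN : (0 : ℝ) < episodes (1 / 1000) 1000 d H ε δ := by
    exact_mod_cast episodes_pos hd hι hb
  have hle := le_episodes_mul_sq hb
  unfold rewardBound
  set b := layerBudget (1 / 1000) d H ε δ
  set ι := logFactor d H ε δ
  set N : ℝ := Nat.cast (episodes (1 / 1000) 1000 d H ε δ)
  have hι0 : 0 < ι := by linarith
  have h1 : (d : ℝ) / N ≤ b ^ 2 / 1000 := by
    rw [div_le_div_iff₀ hN (by norm_num)]
    nlinarith
  have h2 : b / (1000 * (d : ℝ) ^ 3 * H * ι ^ 2) * (52 * (d * ι) * (H * b)) =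
      52 / 1000 * (b ^ 2 / (d ^ 2 * ι)) := by
    field_simp
  have h3 : b ^ 2 / ((d : ℝ) ^ 2 * ι) ≤ b ^ 2 :=
    div_le_self (by positivity) (one_le_mul_of_one_le_of_one_le (one_le_pow₀ hd') hι)
  have h4 : 4 * (d : ℝ) / N = 4 * (d / N) := by ring
  rw [h2, h4]
  linarith [sq_nonneg b]

/-- Here `ε̄` is calibrated: two factors `H`, the `√d` of the evaluation factor and `ι` cancel
exactly, leaving `43ε/1000`. -/
lemma planning_error_le (hd : 2 ≤ d) (hH : 1 ≤ H) (hε : 0 < ε) (hι : 1 ≤ logFactor d H ε δ) :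
    H * (43 * (√(d : ℝ) * logFactor d H ε δ)) * (H * layerBudget (1 / 1000) d H ε δ) ≤ ε / 3 := by
  have hd' : (0 : ℝ) < d := by exact_mod_cast (by omega : 0 < d)
  have hH' : (0 : ℝ) < H := by exact_mod_cast hH
  have hs0 : 0 < √(d : ℝ) := Real.sqrt_pos.2 hd'
  have hι0 : 0 < logFactor d H ε δ := by linarith
  have : H * (43 * (√(d : ℝ) * logFactor d H ε δ)) * (H * layerBudget (1 / 1000) d H ε δ) =
      43 / 1000 * ε := by
    unfold layerBudget
    field_simp
  rw [this]
  linarith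

lemma exp_neg_mul_eq (n : ℕ) {L : ℝ} (hL : L = n * (9 * logFactor d H ε δ)) :
    Real.exp (-L) = (polyBound d H ε δ ^ n)⁻¹ := by
  rw [Real.exp_neg, polyBound, ← Real.exp_nat_mul, hL]

end Constants

/-! ### The three good events and their consequences. -/

section GoodEvents

variable {S A : Type*} [MeasurableSpace S] [MeasurableSpace A] {H d : ℕ} {φ : FeatureMap S A d}
  {M : MDP S A H} {ε δ : ℝ} {Δ : Discretization φ H (ε / 3)}

instance (alg : DeploymentAlgorithm S A H) (M : MDP S A H) : IsProbabilityMeasure (alg.law M) := by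
  unfold DeploymentAlgorithm.law; infer_instance

/-- The radius of the parameter class of the value functions. -/
noncomputable def paramRadius (d H : ℕ) (ε δ : ℝ) : ℕ := H * episodes (1 / 1000) 1000 d H ε δ + d

/-- All prefixes `k` are needed, since the design of layer `h` is computed from the first `h`
batches. The deviation level is the logarithm of `E` to the power `142d²`. -/
lemma exists_regression_event_exp (hM : M.IsLinear φ) (hH : 1 ≤ H) (hd : 2 ≤ d) (hε : 0 < ε)
    (hε1 : ε ≤ 3 / 8) (hδ : 0 < δ) (hδ1 : δ < 1)
    (sol : DesignSolver φ M.init (1 / 1000) 1000 1000 ε δ Δ) :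
    ∃ G : Set (Dataset S A H (episodes (1 / 1000) 1000 d H ε δ) H), MeasurableSet G ∧
      (explorationAlgorithm sol).law M Gᶜ ≤ ENNReal.ofReal (δ / 3) ∧ ∀ D ∈ G, ∀ k hk,
        RegressionGood φ M (D.take k hk) (quadFeature φ) Δ.expRules (paramRadius d H ε δ)
          (√(2 * (142 * (d : ℝ) ^ 2 * (9 * logFactor d H ε δ) + 1)) + √(d : ℝ)) := by
  have hN := episodes_le_pow hd hH hε hε1 hδ hδ1
  obtain ⟨h1000, hdE, hHE, hδE, hXE⟩ := polyBound_consequences hd hH hε hε1 hδ hδ1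
    (polyBound_facts hd hH hε hε1 hδ hδ1)
  have hE0 : 0 ≤ polyBound d H ε δ := by linarith
  have hJ : Fintype.card (QuadIndex d) = d + (d * d + 1) := by simp [QuadIndex]
  have hm : 2 * ((d + (d * d + 1) : ℕ) : ℝ) + 3 * d ≤ polyBound d H ε δ ^ 3 := by
    push_cast
    calc 2 * ((d : ℝ) + (d * d + 1)) + 3 * d
        ≤ 2 * (polyBound d H ε δ + (polyBound d H ε δ * polyBound d H ε δ + 1)) +
          3 * polyBound d H ε δ := by gcongr
      _ ≤ polyBound d H ε δ ^ 3 := by nlinarith [sq_nonneg (polyBound d H ε δ)]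
  obtain ⟨G, hGm, hG, hGD⟩ := (explorationAlgorithm sol).exists_uniform_event M φ
    (ψ := quadFeature φ) (measurable_quadFeature φ) (abs_quadFeature_le φ) Δ.expRules
    (expRules_card_le Δ) (R := paramRadius d H ε δ) (Nat.le_add_left _ _) (by omega)
    (Nat.le_add_right _ _) (L := 142 * (d : ℝ) ^ 2 * (9 * logFactor d H ε δ)) (δ := δ / 3) (by
      rw [exp_neg_mul_eq (142 * d ^ 2) (by push_cast; ring), hJ]
      exact union_bound_exp hd h1000 hHE (by positivity)
        (add_le_add (rewCover_card_le_pow Δ hd hH hε h1000 hXE)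
          (linCover_card_le_pow Δ hd hH hε hε1 h1000 hXE)) (by positivity)
        (gridSize_le_pow h1000 (by positivity) (radius_le_pow h1000 hdE hHE hN) (by positivity)
          hm) hδE)
  exact ⟨G, hGm, hG, fun D hD k hk => hM.regressionGood (measurable_quadFeature φ)
    (hGD D hD k hk)⟩

/-- A separate event for planning: restricting to linear features and to the rules of the linear
cover gives the smaller regression factor, and only the final data matter. -/
lemma exists_regression_event_eval (hM : M.IsLinear φ) (hH : 1 ≤ H) (hd : 2 ≤ d) (hε : 0 < ε)
    (hε1 : ε ≤ 3 / 8) (hδ : 0 < δ) (hδ1 : δ < 1)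
    (sol : DesignSolver φ M.init (1 / 1000) 1000 1000 ε δ Δ) :
    ∃ G : Set (Dataset S A H (episodes (1 / 1000) 1000 d H ε δ) H), MeasurableSet G ∧
      (explorationAlgorithm sol).law M Gᶜ ≤ ENNReal.ofReal (δ / 3) ∧ ∀ D ∈ G,
        RegressionGood φ M D (linFeature φ) Δ.evalRules (paramRadius d H ε δ)
          (√(2 * (97 * (d : ℝ) * (9 * logFactor d H ε δ) + 1)) + √(d : ℝ)) := by
  have hN := episodes_le_pow hd hH hε hε1 hδ hδ1
  obtain ⟨h1000, hdE, hHE, hδE, hXE⟩ := polyBound_consequences hd hH hε hε1 hδ hδ1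
    (polyBound_facts hd hH hε hε1 hδ hδ1)
  have hm : 2 * (d : ℝ) + 3 * d ≤ polyBound d H ε δ ^ 3 := by
    have : polyBound d H ε δ * 1000 ^ 2 ≤ polyBound d H ε δ * polyBound d H ε δ ^ 2 := by gcongr
    nlinarith
  obtain ⟨G, hGm, hG, hGD⟩ := (explorationAlgorithm sol).exists_uniform_event M φ
    (ψ := linFeature φ) φ.measurable_coord (fun j s a => φ.abs_coord_le s a j) Δ.evalRules
    (evalRules_card_le Δ) (R := paramRadius d H ε δ) (Nat.le_add_left _ _) (by omega)
    (Nat.le_add_right _ _) (L := 97 * (d : ℝ) * (9 * logFactor d H ε δ)) (δ := δ / 3) (by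
      rw [exp_neg_mul_eq (97 * d) (by push_cast; ring), Fintype.card_fin]
      exact union_bound_eval hd h1000 hHE (by positivity)
        (linCover_card_le_pow Δ hd hH hε hε1 h1000 hXE) (by positivity)
        (gridSize_le_pow h1000 (by positivity) (radius_le_pow h1000 hdE hHE hN) (by positivity)
          hm) hδE)
  exact ⟨G, hGm, hG, fun D hD => hM.regressionGood φ.measurable_coord (hGD D hD H le_rfl)⟩

lemma exists_batch_event (hH : 1 ≤ H) (hd : 2 ≤ d) (hε : 0 < ε)
    (hε1 : ε ≤ 3 / 8) (hδ : 0 < δ) (hδ1 : δ < 1)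
    (sol : DesignSolver φ M.init (1 / 1000) 1000 1000 ε δ Δ) :
    ∃ G : Set (Dataset S A H (episodes (1 / 1000) 1000 d H ε δ) H), MeasurableSet G ∧
      (explorationAlgorithm sol).law M Gᶜ ≤ ENNReal.ofReal (δ / 3) ∧
      ∀ D ∈ G, ∀ (h : Fin H) (i j : Fin d), |(batchCov φ (D h) h -
        (episodes (1 / 1000) 1000 d H ε δ : ℝ) •
          M.mixCov φ Δ.expSet (sol.weights h (D.before h)) h) i j| ≤
        episodes (1 / 1000) 1000 d H ε δ * layerBudget (1 / 1000) d H ε δ := by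
  have hι := one_le_logFactor hd hH hε hε1 hδ hδ1
  have hb := layerBudget_pos hd hH hε hι
  have hd' : (1 : ℝ) ≤ d := by exact_mod_cast (by omega : 1 ≤ d)
  obtain ⟨h1000, hdE, hHE, hδE, hXE⟩ := polyBound_consequences hd hH hε hε1 hδ hδ1
    (polyBound_facts hd hH hε hε1 hδ hδ1)
  exact (explorationAlgorithm sol).exists_covariance_event M φ (fun h => h) hb
    (L := 6 * (9 * logFactor d H ε δ)) (δ := δ / 3)
    (le_trans (by nlinarith) (le_episodes_mul_sq hb)) (by
      rw [exp_neg_mul_eq 6 (by push_cast; ring)]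
      exact union_bound_cov h1000 hHE hdE hδE)

lemma ofReal_one_sub_le_inter {Ω : Type*} [MeasurableSpace Ω] {μ : Measure Ω}
    [IsProbabilityMeasure μ] {G₁ G₂ G₃ : Set Ω} (hδ : 0 ≤ δ)
    (hm₁ : MeasurableSet G₁) (hm₂ : MeasurableSet G₂) (hm₃ : MeasurableSet G₃)
    (h₁ : μ G₁ᶜ ≤ ENNReal.ofReal (δ / 3)) (h₂ : μ G₂ᶜ ≤ ENNReal.ofReal (δ / 3))
    (h₃ : μ G₃ᶜ ≤ ENNReal.ofReal (δ / 3)) : ENNReal.ofReal (1 - δ) ≤ μ (G₁ ∩ G₂ ∩ G₃) := by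
  have h : μ (G₁ ∩ G₂ ∩ G₃)ᶜ ≤ ENNReal.ofReal δ := by
    rw [Set.compl_inter, Set.compl_inter]
    calc _ ≤ μ G₁ᶜ + μ G₂ᶜ + μ G₃ᶜ :=
          (measure_union_le _ _).trans (add_le_add (measure_union_le _ _) le_rfl)
      _ ≤ ENNReal.ofReal (δ / 3) + ENNReal.ofReal (δ / 3) + ENNReal.ofReal (δ / 3) := by gcongr
      _ = ENNReal.ofReal δ := by
        rw [← ENNReal.ofReal_add (by positivity) (by positivity),
          ← ENNReal.ofReal_add (by positivity) (by positivity)]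
        congr 1
        ring
  have h2 := prob_compl_eq_one_sub (μ := μ) ((hm₁.inter hm₂).inter hm₃).compl
  rw [compl_compl] at h2
  rw [h2, ENNReal.ofReal_sub _ hδ, ENNReal.ofReal_one]
  exact tsub_le_tsub_left h _

/-- The guarantees of exploration and planning on the good event. -/
lemma guarantees_of_good (hM : M.IsLinear φ) (hH : 1 ≤ H) (hd : 2 ≤ d)
    (hlam : 0 < M.explorability φ) (hε : 0 < ε) (hε1 : ε ≤ 3 / 8) (hδ : 0 < δ) (hδ1 : δ < 1)
    (hεlam : ε / 3 ≤ M.explorability φ / 4)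
    (hsmall : ε < H * M.explorability φ ^ 2 /
      (32 * (d : ℝ) ^ (7 / 2 : ℝ) * Real.log (1 / M.explorability φ)))
    (sol : DesignSolver φ M.init (1 / 1000) 1000 1000 ε δ Δ)
    (D : Dataset S A H (episodes (1 / 1000) 1000 d H ε δ) H)
    (hexp : ∀ k hk, RegressionGood φ M (D.take k hk) (quadFeature φ) Δ.expRules
      (paramRadius d H ε δ)
      (√(2 * (142 * (d : ℝ) ^ 2 * (9 * logFactor d H ε δ) + 1)) + √(d : ℝ)))
    (heval : RegressionGood φ M D (linFeature φ) Δ.evalRules (paramRadius d H ε δ)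
      (√(2 * (97 * (d : ℝ) * (9 * logFactor d H ε δ) + 1)) + √(d : ℝ)))
    (hcov : ∀ (h : Fin H) (i j : Fin d), |(batchCov φ (D h) h -
      (episodes (1 / 1000) 1000 d H ε δ : ℝ) •
        M.mixCov φ Δ.expSet (sol.weights h (D.before h)) h) i j| ≤
      episodes (1 / 1000) 1000 d H ε δ * layerBudget (1 / 1000) d H ε δ) :
    (∀ h, ∃ p, DesignFeasible φ M.init (D.before h) Δ.expSet
      (eigThreshold (1 / 1000) 1000 d H ε δ) h p) ∧
    ∀ r : Fin H → S → A → ℝ, FeasibleReward φ r →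
      (∃ π, IsPlanningOutput M.init Δ D r π) ∧
      ∀ π, IsPlanningOutput M.init Δ D r π →
        M.optValue r - ε ≤ M.value (DetPolicy.toPolicy π) r := by
  have hι := one_le_logFactor hd hH hε hε1 hδ hδ1
  have hb := layerBudget_pos hd hH hε hι
  have hd1 : (1 : ℝ) ≤ d := by exact_mod_cast (by omega : 1 ≤ d)
  have hR : ((paramRadius d H ε δ : ℕ) : ℝ) = H * episodes (1 / 1000) 1000 d H ε δ + d := by
    unfold paramRadius; push_cast; ring
  have hlayers := explore_layers hM (by omega) (by positivity) sol hlam hεlam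
    (episodes_pos hd hι hb) D (eigThreshold_pos hd hH hι hb)
    (by rw [hR]; exact hd1.trans (le_add_of_nonneg_left (by positivity))) hb.le
    (by rw [hR]; linarith) (by positivity) (sqrt_add_sqrt_le_exp hd hι) hexp
    (estimation_error_le hd hH hι hb) hb.le
    (eigThreshold_le hd hH hι hlam (M.explorability_le_inv φ hH (by omega)) hsmall)
    (inv_le_rewardBound hd hH hι hb) (design_error_le hd hH hι hb) hcov
  refine ⟨fun h => (hlayers h).1, fun r hr => planning_near_optimal hM hH Δ D hr fun π hπ => ?_⟩
  have h1 := abs_estimateV_sub_le φ M D π (Δ.mem_evalRules hπ) hH (by omega) (by positivity)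
    hR.ge heval hr
  have h2 := bonusSum_take_le φ M D π H H le_rfl le_rfl hb.le fun i _ =>
    (hlayers i).2 π (Δ.evalSet_subset_expSet hπ)
  refine h1.trans (le_trans ?_ (planning_error_le hd hH hε hι))
  have h3 := sqrt_add_sqrt_le_eval hd hι
  have h4 : 0 ≤ (H : ℝ) * layerBudget (1 / 1000) d H ε δ := by positivity
  exact (mul_le_mul_of_nonneg_left h2 (by positivity)).trans
    (mul_le_mul_of_nonneg_right (mul_le_mul_of_nonneg_left h3 (by positivity)) h4)

end GoodEvents

end RewardFree

theorem theorem5p1 :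
    ∃ C₁ C₂ C₃ C₄ C₅ : ℝ, 0 < C₁ ∧ 0 < C₂ ∧ 0 < C₃ ∧ 0 < C₄ ∧ 0 < C₅ ∧
      ∀ (S : Type u) (A : Type v) [MeasurableSpace S] [MeasurableSpace A] (H d : ℕ)
        (φ : FeatureMap S A d) (M : MDP S A H) (ε δ : ℝ)
        (Δ : Discretization φ H (ε / 3)) (sol : DesignSolver φ M.init C₁ C₂ C₃ ε δ Δ),
        1 ≤ H → 2 ≤ d → M.IsLinear φ → 0 < M.explorability φ →
        0 < ε → 0 < δ → δ < 1 →
        ε / 3 ≤ M.explorability φ / 4 →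
        ε < H * M.explorability φ ^ 2 /
          (C₄ * (d : ℝ) ^ (7 / 2 : ℝ) * Real.log (1 / M.explorability φ)) →
        (explorationAlgorithm sol).deployments = H ∧
        ((explorationAlgorithm sol).trajectories : ℝ) ≤
          C₅ * ((d : ℝ) ^ 2 * (H : ℝ) ^ 5 / ε ^ 2) * Real.log (d * H / (ε * δ)) ^ 3 ∧
        ∃ G : Set (Dataset S A H (explorationAlgorithm sol).batch
            (explorationAlgorithm sol).deployments),
          MeasurableSet G ∧
          ENNReal.ofReal (1 - δ) ≤ (explorationAlgorithm sol).law M G ∧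
          ∀ D ∈ G,
            (∀ h, ∃ p, DesignFeasible φ M.init (D.before h) Δ.expSet
              (eigThreshold C₁ C₃ d H ε δ) h p) ∧
            ∀ r : Fin H → S → A → ℝ, FeasibleReward φ r →
              (∃ π, IsPlanningOutput M.init Δ D r π) ∧
              ∀ π, IsPlanningOutput M.init Δ D r π →
                M.optValue r - ε ≤ M.value (DetPolicy.toPolicy π) r := by
  -- The factor `1000 ^ 3` is `C₂ / C₁²` from the batch size, and the extra `1` absorbs rounding up;
  -- `32` matches the requirement `λ²/(32d)` on the threshold.
  refine ⟨1 / 1000, 1000, 1000, 32, 1000 ^ 3 + 1, by norm_num, by norm_num, by norm_num,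
    by norm_num, by norm_num, ?_⟩
  intro S A _ _ H d φ M ε δ Δ sol hH hd hM hlam hε hδ hδ1 hεlam hsmall
  have hd2 : (2 : ℝ) ≤ d := by exact_mod_cast hd
  -- From `ε/3 ≤ λ^⋆/4` and `λ^⋆ ≤ 1/d ≤ 1/2`.
  have hε1 : ε ≤ 3 / 8 := by
    have h1 := M.explorability_le_inv φ hH (by omega)
    have h2 : (1 : ℝ) / d ≤ 1 / 2 := one_div_le_one_div_of_le (by norm_num) hd2
    linarith
  refine ⟨rfl, ?_, ?_⟩
  · have h1 := episodes_le hd hH hε hε1 (one_le_logFactor hd hH hε hε1 hδ hδ1)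
    have h2 : ((explorationAlgorithm sol).trajectories : ℝ) =
        H * episodes (1 / 1000) 1000 d H ε δ := by
      simp [DeploymentAlgorithm.trajectories, explorationAlgorithm]
    rw [h2]
    calc (H : ℝ) * episodes (1 / 1000) 1000 d H ε δ
        ≤ H * ((1000 ^ 3 + 1) *
          ((d : ℝ) ^ 2 * (H : ℝ) ^ 4 / ε ^ 2 * logFactor d H ε δ ^ 3)) := by gcongr
      _ = _ := by rw [logFactor]; ring
  · obtain ⟨G₁, hm₁, hG₁, hD₁⟩ := exists_regression_event_exp hM hH hd hε hε1 hδ hδ1 sol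
    obtain ⟨G₂, hm₂, hG₂, hD₂⟩ := exists_regression_event_eval hM hH hd hε hε1 hδ hδ1 sol
    obtain ⟨G₃, hm₃, hG₃, hD₃⟩ := exists_batch_event hH hd hε hε1 hδ hδ1 sol
    exact ⟨G₁ ∩ G₂ ∩ G₃, (hm₁.inter hm₂).inter hm₃,
      ofReal_one_sub_le_inter hδ.le hm₁ hm₂ hm₃ hG₁ hG₂ hG₃, fun D hD =>
      guarantees_of_good hM hH hd hlam hε hε1 hδ hδ1 hεlam hsmall sol D (hD₁ D hD.1.1)
        (hD₂ D hD.1.2) (hD₃ D hD.2)⟩
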